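/- Let $X$ be a topological space and let $\mathcal{G}$ be a gr-stack on $X$ (a stack in groupoids with a group-like monoidal structure compatible with restrictions). Write $\mathcal{E}q(\mathcal{G})$ for the gr-stack of monoidal self-equivalences of $\mathcal{G}$ (its objects over an open set $U$ are the monoidal self-equivalences of $\mathcal{G}|_U$, its arrows the monoidal natural transformations, its product is composition), and $j:\mathcal{G}\to\mathcal{E}q(\mathcal{G})$, $g\mapsto(\gamma\mapsto g\gamma g^{-1})$, for inner conjugation. Let $\mathcal{P}$ be a $\mathcal{G}$-2-gerbe on $X$, that is, a 2-stack in 2-groupoids on $X$ which is locally non-empty and locally connected, together with the following local trivialization: an open covering $\mathcal{U}=(U_i)_{i\in I}$ of $X$, objects $x_i\in\mathcal{P}_{U_i}$, monoidal equivalences of the restriction $\mathcal{G}|_{U_i}$ with the gr-stack $\mathcal{G}_{x_i}=\mathrm{Ar}(x_i,x_i)$ of self-paths of $x_i$ (with composition as product), and paths $\phi_{ij}:x_j\to x_i$ above $U_{ij}=U_i\cap U_j$. We identify objects and arrows of $\mathcal{G}$ above an open subset of $U_i$ with self-paths of $x_i$ and 2-arrows between them. (a) One can choose, for all $i,j$,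 an object $\lambda_{ij}$ of $\mathcal{E}q(\mathcal{G})_{U_{ij}}$ with 2-arrows $M_{ij}(\gamma):\phi_{ij}\,\gamma\Rightarrow\lambda_{ij}(\gamma)\,\phi_{ij}$, natural in $\gamma$ and compatible with the monoidal structures and with restrictions; and, for all $i,j,k$, an object $g_{ijk}$ of $\mathcal{G}_{U_{ijk}}$ with a 2-arrow $m_{ijk}:g_{ijk}\,\phi_{ik}\Rightarrow\phi_{ij}\,\phi_{jk}$. (b) For every such choice there are unique families of arrows $$\widetilde m_{ijk}:j(g_{ijk})\,\lambda_{ik}\to\lambda_{ij}\,\lambda_{jk}\ \text{ in }\mathcal{E}q(\mathcal{G})_{U_{ijk}},\qquad \nu_{ijkl}:\lambda_{ij}(g_{jkl})\,g_{ijl}\to g_{ijk}\,g_{ikl}\ \text{ in }\mathcal{G}_{U_{ijkl}}$$ induced by the 2-arrows $M$ and $m$, in the following sense. Let $\{\widetilde m_{ijk},\gamma\}:g_{ijk}\,\lambda_{ik}(\gamma)\to\lambda_{ij}\lambda_{jk}(\gamma)\,g_{ijk}$ be the composite of the canonical isomorphism $g_{ijk}\,\lambda_{ik}(\gamma)\cong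 j(g_{ijk})(\lambda_{ik}(\gamma))\,g_{ijk}$ with $\widetilde m_{ijk}(\gamma)\,g_{ijk}$. Then, up to whiskering, above $U_{ijk}$ and its open subsets, $$m_{ijk}\circ\{\widetilde m_{ijk},\gamma\}\circ M_{ik}(\gamma)=M_{ij}(\lambda_{jk}(\gamma))\circ M_{jk}(\gamma)\circ m_{ijk}$$ as 2-arrows $g_{ijk}\,\phi_{ik}\,\gamma\Rightarrow\lambda_{ij}\lambda_{jk}(\gamma)\,\phi_{ij}\,\phi_{jk}$, and above $U_{ijkl}$ and its open subsets $$m_{ijk}\circ m_{ikl}\circ\nu_{ijkl}=m_{jkl}\circ M_{ij}(g_{jkl})^{-1}\circ m_{ijl}$$ as 2-arrows $\lambda_{ij}(g_{jkl})\,g_{ijl}\,\phi_{il}\Rightarrow\phi_{ij}\,\phi_{jk}\,\phi_{kl}$. (c) The quadruple $(\lambda_{ij},\widetilde m_{ijk},g_{ijk},\nu_{ijkl})$ is a $\mathcal{G}$-valued Čech 1-cocycle quadruple for $\mathcal{U}$, that is, (omitting whiskerings on the right) $$\widetilde m_{ijk}\;\,{}^{g_{ijk}}\widetilde m_{ikl}\;\,j(\nu_{ijkl})=(\lambda_{ij}\,\widetilde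 m_{jkl})\;\,{}^{\lambda_{ij}(g_{jkl})}\widetilde m_{ijl}$$ in $\mathcal{E}q(\mathcal{G})$ above $U_{ijkl}$, and $$\nu_{ijkl}\;\,({}^{\lambda_{ij}(g_{jkl})}\nu_{ijlm})\;\,\lambda_{ij}(\nu_{jklm})={}^{g_{ijk}}\nu_{iklm}\;\,\{\widetilde m_{ijk},g_{klm}\}^{-1}\;\,({}^{\lambda_{ij}\lambda_{jk}(g_{klm})}\nu_{ijkm})$$ in $\mathcal{G}$ above $U_{ijklm}$, where a left exponent denotes whiskering on the left by the given object (by its image under $j$ in the first equation). (d) For a group-like monoidal category $C$ with unit $I$ let $\mathrm{Ar}_I\,C$ be the collection of arrows of $C$ with source $I$, and $t$ the target map. Consider the weak crossed square with vertical maps $t:\mathrm{Ar}_I\,\mathcal{G}\to\mathrm{Ob}\,\mathcal{G}$ and $t:\mathrm{Ar}_I\,\mathcal{E}q(\mathcal{G})\to\mathrm{Ob}\,\mathcal{E}q(\mathcal{G})$ and horizontal maps $j$; by definition, a Čech 1-cocycle with values in it is a quadruple obtained from a $\mathcal{G}$-valued Čech 1-cocycle quadruple by replacing each arrow $a:Y\to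 Z$ among the $\widetilde m_{ijk}$ and $\nu_{ijkl}$ by an arrow $aY^{-1}:I\to ZY^{-1}$, where $Y^{-1}$ is an inverse of $Y$. Then the quadruple of (b) can be modified in this way, and so $\mathcal{P}$ and its local trivialization determine a Čech 1-cocycle for $\mathcal{U}$ with values in the weak crossed square attached to $\mathcal{G}\to\mathcal{E}q(\mathcal{G})$. -/

import Mathlib

universe v u w w₁ v₁ u₁ t

namespace Breen

open CategoryTheory TopologicalSpace Opposite

section GrCategory

open MonoidalCategory

/-- A monoidal category is *group-like* (a gr-category) when every arrow is invertible and every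
object has an inverse for the tensor product, up to isomorphism. -/
class IsGrCategory (C : Type*) [Category C] [MonoidalCategory C] : Prop where
  isGroupoid : IsGroupoid C
  exists_inv (x : C) : ∃ y : C, Nonempty (x ⊗ y ≅ 𝟙_ C) ∧ Nonempty (y ⊗ x ≅ 𝟙_ C)

attribute [instance] IsGrCategory.isGroupoid

variable {C : Type*} [Category C] [MonoidalCategory C] [IsGrCategory C]

/-- A chosen inverse of an object of a gr-category. -/
noncomputable def tinv (g : C) : C := (IsGrCategory.exists_inv g).choose

/-- The chosen isomorphism `g⁻¹ ⊗ g ≅ 𝟙`. -/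
noncomputable def tinvIso (g : C) : tinv g ⊗ g ≅ 𝟙_ C :=
  (IsGrCategory.exists_inv g).choose_spec.2.some

/-- The chosen isomorphism `g ⊗ g⁻¹ ≅ 𝟙`. -/
noncomputable def tinvIso' (g : C) : g ⊗ tinv g ≅ 𝟙_ C :=
  (IsGrCategory.exists_inv g).choose_spec.1.some

/-- Right multiplication by an object of a gr-category is an equivalence. -/
instance tensorRight_isEquivalence (g : C) : (tensorRight g).IsEquivalence :=
  (CategoryTheory.Equivalence.mk (tensorRight g) (tensorRight (tinv g))
    ((rightUnitorNatIso C).symm ≪≫ (tensoringRight C).mapIso (tinvIso' g).symm ≪≫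
      tensorRightTensor _ _)
    ((tensorRightTensor _ _).symm ≪≫ (tensoringRight C).mapIso (tinvIso g) ≪≫
      rightUnitorNatIso C)).isEquivalence_functor

/-- Left multiplication by an object of a gr-category is an equivalence. -/
instance tensorLeft_isEquivalence (g : C) : (tensorLeft g).IsEquivalence :=
  (CategoryTheory.Equivalence.mk (tensorLeft g) (tensorLeft (tinv g))
    ((leftUnitorNatIso C).symm ≪≫ (tensoringLeft C).mapIso (tinvIso g).symm ≪≫
      tensorLeftTensor _ _)
    ((tensorLeftTensor _ _).symm ≪≫ (tensoringLeft C).mapIso (tinvIso' g) ≪≫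
      leftUnitorNatIso C)).isEquivalence_functor

/-- Cancellation of an object on the right. -/
noncomputable def cancelIso (g : C) {a b : C} (e : a ⊗ g ≅ b ⊗ g) : a ≅ b :=
  (tensorRight g).preimageIso e

@[simp] lemma cancelIso_whiskerRight (g : C) {a b : C} (e : a ⊗ g ≅ b ⊗ g) :
    (cancelIso g e).hom ▷ g = e.hom :=
  (tensorRight g).map_preimage e.hom

lemma whiskerRight_cancel (g : C) {a b : C} {f f' : a ⟶ b} (h : f ▷ g = f' ▷ g) : f = f' :=
  (tensorRight g).map_injective h

/-- The underlying functor `γ ↦ (g ⊗ γ) ⊗ g⁻¹` of inner conjugation by `g`. -/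
noncomputable def conj (g : C) : C ⥤ C := tensorLeft g ⋙ tensorRight (tinv g)

instance (g : C) : (conj g).IsEquivalence := by unfold conj; infer_instance

/-- The canonical isomorphism `(g ⊗ γ ⊗ g⁻¹) ⊗ g ≅ g ⊗ γ`. -/
noncomputable def conjIso (g γ : C) : (conj g).obj γ ⊗ g ≅ g ⊗ γ :=
  α_ _ _ _ ≪≫ whiskerLeftIso (g ⊗ γ) (tinvIso g) ≪≫ ρ_ _

lemma conjIso_naturality (g : C) {γ δ : C} (f : γ ⟶ δ) :
    (conj g).map f ▷ g ≫ (conjIso g δ).hom = (conjIso g γ).hom ≫ g ◁ f := by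
  dsimp [conj, conjIso]
  simp only [Category.assoc]
  rw [associator_naturality_left_assoc, whiskerLeftIso_hom, whiskerLeftIso_hom,
    ← whisker_exchange_assoc, rightUnitor_naturality]

lemma conjIso_inv_naturality (g : C) {γ δ : C} (f : γ ⟶ δ) :
    (conjIso g γ).inv ≫ (conj g).map f ▷ g = g ◁ f ≫ (conjIso g δ).inv := by
  rw [Iso.inv_comp_eq, ← Category.assoc, ← conjIso_naturality]; simp

noncomputable def conjε (g : C) : 𝟙_ C ≅ (conj g).obj (𝟙_ C) :=
  cancelIso g (λ_ g ≪≫ (ρ_ g).symm ≪≫ (conjIso g _).symm)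

noncomputable def conjμ (g γ δ : C) : (conj g).obj γ ⊗ (conj g).obj δ ≅ (conj g).obj (γ ⊗ δ) :=
  cancelIso g (α_ _ _ _ ≪≫ whiskerLeftIso _ (conjIso g δ) ≪≫ (α_ _ _ _).symm ≪≫
    whiskerRightIso (conjIso g γ) δ ≪≫ α_ _ _ _ ≪≫ (conjIso g (γ ⊗ δ)).symm)

lemma conjε_spec (g : C) :
    (conjε g).hom ▷ g ≫ (conjIso g _).hom = (λ_ g).hom ≫ (ρ_ g).inv := by
  simp [conjε]

lemma conjμ_spec (g γ δ : C) :
    (conjμ g γ δ).hom ▷ g ≫ (conjIso g (γ ⊗ δ)).hom = (α_ _ _ _).hom ≫ _ ◁ (conjIso g δ).hom ≫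
      (α_ _ _ _).inv ≫ (conjIso g γ).hom ▷ δ ≫ (α_ _ _ _).hom := by
  simp [conjμ]

/-- Inner conjugation is a monoidal functor. -/
noncomputable instance conjMonoidal (g : C) : (conj g).Monoidal :=
  Functor.CoreMonoidal.toMonoidal
    { εIso := conjε g
      μIso := conjμ g
      μIso_hom_natural_left := fun {γ γ'} f δ => by
        apply whiskerRight_cancel g
        rw [← cancel_mono (conjIso g (γ' ⊗ δ)).hom]
        simp only [comp_whiskerRight, Category.assoc, conjμ_spec, conjIso_naturality, reassoc_of% conjμ_spec]
        rw [associator_naturality_left_assoc, ← whisker_exchange_assoc,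
          associator_inv_naturality_left_assoc, ← comp_whiskerRight_assoc, conjIso_naturality,
          comp_whiskerRight_assoc, associator_naturality_middle]
      μIso_hom_natural_right := fun {δ δ'} γ f => by
        apply whiskerRight_cancel g
        rw [← cancel_mono (conjIso g (γ ⊗ δ')).hom]
        simp only [comp_whiskerRight, Category.assoc, conjμ_spec, conjIso_naturality, reassoc_of% conjμ_spec]
        rw [associator_naturality_middle_assoc, ← whiskerLeft_comp_assoc, conjIso_naturality,
          whiskerLeft_comp_assoc, associator_inv_naturality_right_assoc, whisker_exchange_assoc,
          associator_naturality_right]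
      associativity := fun γ δ ε => by
        apply whiskerRight_cancel g
        rw [← cancel_mono (conjIso g _).hom]
        simp only [comp_whiskerRight, Category.assoc, conjμ_spec, conjIso_naturality, reassoc_of% conjμ_spec]
        rw [associator_naturality_left_assoc, ← whisker_exchange_assoc,
          associator_inv_naturality_left_assoc, ← comp_whiskerRight_assoc, conjμ_spec,
          associator_naturality_middle_assoc, ← whiskerLeft_comp_assoc, conjμ_spec]
        monoidal
      left_unitality := fun γ => by
        apply whiskerRight_cancel g
        rw [← cancel_mono (conjIso g _).hom]
        simp only [comp_whiskerRight, Category.assoc, conjIso_naturality, reassoc_of% conjμ_spec]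
        rw [associator_naturality_left_assoc, ← whisker_exchange_assoc,
          associator_inv_naturality_left_assoc, ← comp_whiskerRight_assoc, conjε_spec]
        monoidal
      right_unitality := fun γ => by
        apply whiskerRight_cancel g
        rw [← cancel_mono (conjIso g _).hom]
        simp only [comp_whiskerRight, Category.assoc, conjIso_naturality, reassoc_of% conjμ_spec]
        rw [associator_naturality_middle_assoc, ← whiskerLeft_comp_assoc, conjε_spec]
        monoidal }


/-- The effect of an arrow `u : g ⟶ h` on inner conjugation. -/
noncomputable def conjMapApp {g h : C} (u : g ⟶ h) (γ : C) : (conj g).obj γ ≅ (conj h).obj γ :=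
  cancelIso h (whiskerLeftIso _ (asIso u).symm ≪≫ conjIso g γ ≪≫ whiskerRightIso (asIso u) γ ≪≫
    (conjIso h γ).symm)

lemma conjMapApp_spec {g h : C} (u : g ⟶ h) (γ : C) :
    (conj g).obj γ ◁ u ≫ (conjMapApp u γ).hom ▷ h ≫ (conjIso h γ).hom =
      (conjIso g γ).hom ≫ u ▷ γ := by
  simp [conjMapApp]

/-- Inner conjugation is functorial in the conjugating object: an arrow `u : g ⟶ h` induces a
natural transformation `γ ↦ u γ u⁻¹`. -/
noncomputable def conjMap {g h : C} (u : g ⟶ h) : conj g ⟶ conj h where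
  app γ := (conjMapApp u γ).hom
  naturality γ δ f := by
    apply whiskerRight_cancel h
    rw [← cancel_mono (conjIso h δ).hom, ← cancel_epi ((conj g).obj γ ◁ u)]
    simp only [comp_whiskerRight, Category.assoc, conjIso_naturality, reassoc_of% conjMapApp_spec]
    rw [whisker_exchange_assoc, conjMapApp_spec, reassoc_of% conjIso_naturality, whisker_exchange]

lemma conjMap_spec {g h : C} (u : g ⟶ h) (γ : C) :
    (conj g).obj γ ◁ u ≫ (conjMap u).app γ ▷ h ≫ (conjIso h γ).hom =
      (conjIso g γ).hom ≫ u ▷ γ := conjMapApp_spec u γ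

open Functor Functor.LaxMonoidal Functor.OplaxMonoidal

lemma conj_ε (g : C) : ε (conj g) = (conjε g).hom := rfl
lemma conj_μ (g γ δ : C) : μ (conj g) γ δ = (conjμ g γ δ).hom := rfl

lemma tensor_exchange {D : Type*} [Category D] [MonoidalCategory D] {A A' B B' h δ E Y : D}
    (f : A ⟶ A') (f' : B ⟶ B') (b : B' ⊗ h ⟶ h ⊗ δ) (a : A' ⊗ h ⟶ E) (k : E ⊗ δ ⟶ Y) :
    (f ⊗ₘ f') ▷ h ≫ (α_ _ _ _).hom ≫ A' ◁ b ≫ (α_ _ _ _).inv ≫ a ▷ δ ≫ k =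
      (α_ _ _ _).hom ≫ A ◁ (f' ▷ h ≫ b) ≫ (α_ _ _ _).inv ≫ (f ▷ h ≫ a) ▷ δ ≫ k := by
  have e : f ▷ (B' ⊗ h) ≫ A' ◁ b = A ◁ b ≫ f ▷ (h ⊗ δ) := (whisker_exchange f b).symm
  simp only [tensorHom_def', comp_whiskerRight, Category.assoc, associator_naturality_left_assoc,
    MonoidalCategory.whiskerLeft_comp, reassoc_of% e, associator_inv_naturality_left_assoc,
    associator_naturality_middle_assoc]

instance conjMap_isMonoidal {g h : C} (u : g ⟶ h) : NatTrans.IsMonoidal (conjMap u) where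
  unit := by
    apply whiskerRight_cancel h
    rw [← cancel_mono (conjIso h _).hom, ← cancel_epi (𝟙_ C ◁ u)]
    simp only [comp_whiskerRight, Category.assoc, conj_ε, conjε_spec]
    rw [whisker_exchange_assoc, conjMap_spec, reassoc_of% conjε_spec]
    simp
  tensor γ δ := by
    apply whiskerRight_cancel h
    rw [← cancel_mono (conjIso h _).hom, ← cancel_epi (((conj g).obj γ ⊗ (conj g).obj δ) ◁ u)]
    simp only [comp_whiskerRight, Category.assoc, conj_μ, conjμ_spec]
    rw [whisker_exchange_assoc, conjMap_spec, reassoc_of% conjμ_spec, tensor_exchange,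
      associator_naturality_right_assoc, ← MonoidalCategory.whiskerLeft_comp_assoc, conjMap_spec,
      MonoidalCategory.whiskerLeft_comp_assoc, associator_inv_naturality_middle_assoc, ← comp_whiskerRight_assoc,
      conjMap_spec, comp_whiskerRight_assoc, associator_naturality_left]

/-- The isomorphism `g h γ h⁻¹ g⁻¹ ≅ (g h) γ (g h)⁻¹`. -/
noncomputable def conjTensor (g h γ : C) :
    (conj g).obj ((conj h).obj γ) ≅ (conj (g ⊗ h)).obj γ :=
  cancelIso (g ⊗ h) ((α_ _ _ _).symm ≪≫ whiskerRightIso (conjIso g _) h ≪≫ α_ _ _ _ ≪≫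
    whiskerLeftIso g (conjIso h γ) ≪≫ (α_ _ _ _).symm ≪≫ (conjIso (g ⊗ h) γ).symm)

section Compare

variable {D : Type*} [Category D] [MonoidalCategory D] (R : C ⥤ D) [R.Monoidal]

/-- The isomorphism `R (g γ g⁻¹) h ≅ h (R γ)` induced by `R g ≅ h`. -/
noncomputable def mapConjIso {g : C} {h : D} (u : R.obj g ≅ h) (γ : C) :
    R.obj ((conj g).obj γ) ⊗ h ≅ h ⊗ R.obj γ :=
  whiskerLeftIso _ u.symm ≪≫ Functor.Monoidal.μIso R _ _ ≪≫ R.mapIso (conjIso g γ) ≪≫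
    (Functor.Monoidal.μIso R _ _).symm ≪≫ whiskerRightIso u _

lemma mapConjIso_naturality {g : C} {h : D} (u : R.obj g ≅ h) {γ δ : C} (f : γ ⟶ δ) :
    R.map ((conj g).map f) ▷ h ≫ (mapConjIso R u δ).hom = (mapConjIso R u γ).hom ≫ h ◁ R.map f := by
  simp only [mapConjIso, Iso.trans_hom, whiskerLeftIso_hom, whiskerRightIso_hom, Iso.symm_hom,
    Functor.Monoidal.μIso_hom, Functor.Monoidal.μIso_inv, Functor.mapIso_hom, Category.assoc]
  rw [← whisker_exchange_assoc, μ_natural_left_assoc, ← R.map_comp_assoc, conjIso_naturality,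
    R.map_comp_assoc, ← δ_natural_right_assoc, whisker_exchange]

lemma mapConjIso_unit {g : C} {h : D} (u : R.obj g ≅ h) :
    (ε R ≫ R.map (conjε g).hom) ▷ h ≫ (mapConjIso R u _).hom =
      (λ_ h).hom ≫ (ρ_ h).inv ≫ h ◁ ε R := by
  have h2 : (mapConjIso R u (𝟙_ C)).hom = R.obj ((conj g).obj (𝟙_ C)) ◁ u.inv ≫ μ R _ g ≫
      R.map (conjIso g (𝟙_ C)).hom ≫
      OplaxMonoidal.δ R g (𝟙_ C) ≫ u.hom ▷ R.obj (𝟙_ C) := by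
    simp [mapConjIso]
  rw [h2, comp_whiskerRight_assoc, ← whisker_exchange_assoc, μ_natural_left_assoc,
    ← R.map_comp_assoc, conjε_spec, R.map_comp_assoc, ← whisker_exchange_assoc]
  have h3 : (λ_ (R.obj g)).hom = ε R ▷ R.obj g ≫ μ R _ _ ≫ R.map (λ_ g).hom := by simp
  have h4 : (ρ_ (R.obj g)).inv ≫ R.obj g ◁ ε R = R.map (ρ_ g).inv ≫ OplaxMonoidal.δ R g (𝟙_ C) := by
    simp
  rw [← reassoc_of% h3, ← reassoc_of% h4, whisker_exchange, leftUnitor_naturality_assoc,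
    rightUnitor_inv_naturality_assoc]
  simp

lemma mapConj_tensor_aux (g γ δ : C) :
    (μ R ((conj g).obj γ) ((conj g).obj δ) ≫ R.map (conjμ g γ δ).hom) ▷ R.obj g ≫
      μ R _ _ ≫ R.map (conjIso g (γ ⊗ δ)).hom = (α_ _ _ _).hom ≫
      R.obj ((conj g).obj γ) ◁ (μ R _ _ ≫ R.map (conjIso g δ).hom ≫ OplaxMonoidal.δ R _ _) ≫
      (α_ _ _ _).inv ≫ (μ R _ _ ≫ R.map (conjIso g γ).hom) ▷ R.obj δ ≫ μ R _ _ ≫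
      R.map (α_ _ _ _).hom := by
  rw [comp_whiskerRight_assoc, μ_natural_left_assoc, ← R.map_comp, conjμ_spec]
  simp only [Functor.map_comp, MonoidalCategory.whiskerLeft_comp, comp_whiskerRight, Category.assoc,
    μ_natural_left_assoc]
  have h3 : R.obj ((conj g).obj γ) ◁ OplaxMonoidal.δ R g δ ≫
      (α_ (R.obj ((conj g).obj γ)) (R.obj g) (R.obj δ)).inv ≫
      μ R ((conj g).obj γ) g ▷ R.obj δ ≫ μ R ((conj g).obj γ ⊗ g) δ =
      μ R _ _ ≫ R.map (α_ ((conj g).obj γ) g δ).inv := by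
    rw [← LaxMonoidal.associativity_inv, ← MonoidalCategory.whiskerLeft_comp_assoc,
      Functor.Monoidal.δ_μ, MonoidalCategory.whiskerLeft_id, Category.id_comp]
  have h4 : μ R ((conj g).obj γ) ((conj g).obj δ) ▷ R.obj g ≫ μ R _ g ≫
      R.map (α_ ((conj g).obj γ) ((conj g).obj δ) g).hom =
      (α_ _ _ _).hom ≫ R.obj ((conj g).obj γ) ◁ μ R _ _ ≫ μ R _ _ := associativity R _ _ _
  rw [reassoc_of% h3, reassoc_of% h4, μ_natural_right_assoc]

lemma mapConjIso_tensor {g : C} {h : D} (u : R.obj g ≅ h) (γ δ : C) :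
    (μ R _ _ ≫ R.map (conjμ g γ δ).hom) ▷ h ≫ (mapConjIso R u _).hom = (α_ _ _ _).hom ≫
      R.obj ((conj g).obj γ) ◁ (mapConjIso R u δ).hom ≫ (α_ _ _ _).inv ≫
      (mapConjIso R u γ).hom ▷ R.obj δ ≫ (α_ _ _ _).hom ≫ h ◁ μ R γ δ := by
  have h0 := mapConj_tensor_aux R g γ δ
  have h2 (γ : C) : (mapConjIso R u γ).hom = R.obj ((conj g).obj γ) ◁ u.inv ≫ μ R _ g ≫
      R.map (conjIso g γ).hom ≫ OplaxMonoidal.δ R g γ ≫ u.hom ▷ R.obj γ := by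
    simp [mapConjIso]
  rw [h2, ← whisker_exchange_assoc, reassoc_of% h0, h2, h2]
  simp only [MonoidalCategory.whiskerLeft_comp, comp_whiskerRight, Category.assoc]
  have h3 : R.obj ((conj g).obj γ) ◁ (u.hom ▷ R.obj δ) ≫
      (α_ (R.obj ((conj g).obj γ)) h (R.obj δ)).inv ≫
      (R.obj ((conj g).obj γ) ◁ u.inv) ▷ R.obj δ = (α_ _ _ _).inv := by
    rw [associator_inv_naturality_middle_assoc, ← comp_whiskerRight,
      ← MonoidalCategory.whiskerLeft_comp]
    simp
  have h4 : μ R (g ⊗ γ) δ ≫ R.map (α_ g γ δ).hom ≫ OplaxMonoidal.δ R g (γ ⊗ δ) =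
    OplaxMonoidal.δ R g γ ▷ R.obj δ ≫ (α_ _ _ _).hom ≫ R.obj g ◁ μ R γ δ := by
    rw [← cancel_epi (μ R g γ ▷ R.obj δ), LaxMonoidal.associativity_assoc,
      Functor.Monoidal.μ_δ, Category.comp_id, ← comp_whiskerRight_assoc, Functor.Monoidal.μ_δ,
      id_whiskerRight, Category.id_comp]
  rw [reassoc_of% h3, reassoc_of% h4, associator_naturality_left_assoc,
    associator_naturality_right_assoc, ← whisker_exchange]

variable [IsGrCategory D]

/-- The comparison `h (R γ) h⁻¹ ≅ R (g γ g⁻¹)` induced by an isomorphism `R g ≅ h`, for a monoidal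
functor `R`. -/
noncomputable def conjCompareApp {g : C} {h : D} (u : R.obj g ≅ h) (γ : C) :
    (conj h).obj (R.obj γ) ≅ R.obj ((conj g).obj γ) :=
  cancelIso h (conjIso h (R.obj γ) ≪≫ (mapConjIso R u γ).symm)

lemma conjCompareApp_spec {g : C} {h : D} (u : R.obj g ≅ h) (γ : C) :
    (conjCompareApp R u γ).hom ▷ h ≫ (mapConjIso R u γ).hom = (conjIso h (R.obj γ)).hom := by
  simp [conjCompareApp]

noncomputable def conjCompare {g : C} {h : D} (u : R.obj g ≅ h) : R ⋙ conj h ≅ conj g ⋙ R :=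
  NatIso.ofComponents (conjCompareApp R u) (fun {γ δ} f => by
    apply whiskerRight_cancel h
    rw [← cancel_mono (mapConjIso R u δ).hom]
    dsimp
    simp only [comp_whiskerRight, Category.assoc, conjCompareApp_spec, mapConjIso_naturality,
      reassoc_of% conjCompareApp_spec, conjIso_naturality])

lemma conjCompare_spec {g : C} {h : D} (u : R.obj g ≅ h) (γ : C) :
    (conjCompare R u).hom.app γ ▷ h ≫ (mapConjIso R u γ).hom = (conjIso h (R.obj γ)).hom :=
  conjCompareApp_spec R u γ

instance {g : C} {h : D} (u : R.obj g ≅ h) : NatTrans.IsMonoidal (conjCompare R u).hom where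
  unit := by
    apply whiskerRight_cancel h
    rw [← cancel_mono (mapConjIso R u _).hom]
    change ((ε (conj h) ≫ (conj h).map (ε R)) ≫ (conjCompare R u).hom.app _) ▷ h ≫ _ =
      (ε R ≫ R.map (conjε g).hom) ▷ h ≫ _
    rw [mapConjIso_unit, comp_whiskerRight, Category.assoc, conjCompare_spec]
    simp only [conj_ε, comp_whiskerRight, Category.assoc,
      conjIso_naturality, reassoc_of% conjε_spec]
  tensor γ δ := by
    apply whiskerRight_cancel h
    rw [← cancel_mono (mapConjIso R u _).hom]
    change ((μ (conj h) _ _ ≫ (conj h).map (μ R γ δ)) ≫ (conjCompareApp R u _).hom) ▷ h ≫ _ =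
      (((conjCompareApp R u γ).hom ⊗ₘ (conjCompareApp R u δ).hom) ≫
        (μ R ((conj g).obj γ) ((conj g).obj δ) ≫ R.map (conjμ g γ δ).hom)) ▷ h ≫ _
    rw [comp_whiskerRight_assoc, conjCompareApp_spec, comp_whiskerRight_assoc,
      comp_whiskerRight_assoc, mapConjIso_tensor, tensor_exchange, conjCompareApp_spec,
      conjCompareApp_spec, conjIso_naturality, conj_μ, reassoc_of% conjμ_spec]

end Compare
end GrCategory

section

open MonoidalCategory

section Fibred

variable {X : Type w} [TopologicalSpace X] (F : Pseudofunctor (LocallyDiscrete (Opens X)ᵒᵖ) Cat.{v, u})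

/-- The fibre category `F_U` of a fibred category over the open sets of `X`. -/
def Fib (U : Opens X) : Type u := F.obj ⟨op U⟩

instance (U : Opens X) : Category.{v} (Fib F U) :=
  inferInstanceAs (Category.{v} (F.obj ⟨op U⟩))

/-- The restriction functor `F_U ⥤ F_V` for `V ⊆ U`. -/
def res {V U : Opens X} (h : V ≤ U) : Fib F U ⥤ Fib F V :=
  (F.map (homOfLE h).op.toLoc).toFunctor

/-- The transitivity isomorphism `(x|_V)|_W ≅ x|_W`. -/
def resComp {W V U : Opens X} (h : V ≤ U) (h' : W ≤ V) :
    res F h ⋙ res F h' ≅ res F (h'.trans h) :=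
  (Cat.Hom.toNatIso (F.mapComp' (homOfLE h).op.toLoc (homOfLE h').op.toLoc
    (homOfLE (h'.trans h)).op.toLoc rfl)).symm

/-- The isomorphism `x|_U ≅ x`. -/
def resId (U : Opens X) : res F (le_refl U) ≅ 𝟭 (Fib F U) :=
  Cat.Hom.toNatIso (F.mapId ⟨op U⟩)

lemma resComp_assoc {Z W V U : Opens X} (h : V ≤ U) (h' : W ≤ V) (h'' : Z ≤ W) (x : Fib F U) :
    (res F h'').map ((resComp F h h').hom.app x) ≫ (resComp F (h'.trans h) h'').hom.app x =
      (resComp F h' h'').hom.app ((res F h).obj x) ≫ (resComp F h (h''.trans h')).hom.app x := by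
  exact F.mapComp'_inv_whiskerRight_mapComp'₀₂₃_inv_app _ _ _ _ _ _ rfl rfl rfl x

end Fibred

/-- A *gr-stack* on `X`: a stack in groupoids on `X` with a monoidal structure compatible with
restrictions, in which every object is invertible. -/
structure GrStack (X : Type w) [TopologicalSpace X] where
  /-- the underlying fibred category -/
  F : Pseudofunctor (LocallyDiscrete (Opens X)ᵒᵖ) Cat.{v, u}
  isStack : F.IsStack (Opens.grothendieckTopology X)
  /-- the tensor product on each fibre -/
  monoidal (U : Opens X) : MonoidalCategory (Fib F U)
  /-- restrictions are monoidal functors -/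
  resMonoidal {V U : Opens X} (h : V ≤ U) : (res F h).Monoidal
  resComp_isMonoidal {W V U : Opens X} (h : V ≤ U) (h' : W ≤ V) :
    NatTrans.IsMonoidal (resComp F h h').hom
  resId_isMonoidal (U : Opens X) : NatTrans.IsMonoidal (resId F U).hom
  isGrCategory (U : Opens X) : IsGrCategory (Fib F U)

namespace GrStack

variable {X : Type w} [TopologicalSpace X] (𝒢 : GrStack.{v, u} X)

/-- The gr-category `𝒢_U`. -/
abbrev fib (U : Opens X) : Type u := Fib 𝒢.F U

instance (U : Opens X) : MonoidalCategory (𝒢.fib U) := 𝒢.monoidal U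

instance (U : Opens X) : IsGrCategory (𝒢.fib U) := 𝒢.isGrCategory U

/-- The restriction functor `𝒢_U ⥤ 𝒢_V`. -/
abbrev res {V U : Opens X} (h : V ≤ U) : 𝒢.fib U ⥤ 𝒢.fib V := Breen.res 𝒢.F h

instance {V U : Opens X} (h : V ≤ U) : (𝒢.res h).Monoidal := 𝒢.resMonoidal h

/-- The transitivity isomorphism `(x|_V)|_W ≅ x|_W`. -/
abbrev resComp {W V U : Opens X} (h : V ≤ U) (h' : W ≤ V) :
    𝒢.res h ⋙ 𝒢.res h' ≅ 𝒢.res (h'.trans h) := Breen.resComp 𝒢.F h h'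

instance {W V U : Opens X} (h : V ≤ U) (h' : W ≤ V) :
    NatTrans.IsMonoidal (𝒢.resComp h h').hom := 𝒢.resComp_isMonoidal h h'

/-- The transitivity isomorphism at an object. -/
def rc {W V U : Opens X} (h : V ≤ U) (h' : W ≤ V) (x : 𝒢.fib U) :
    (𝒢.res h').obj ((𝒢.res h).obj x) ≅ (𝒢.res (h'.trans h)).obj x :=
  (𝒢.resComp h h').app x

/-- The unit object of `𝒢_U`. -/
abbrev one (U : Opens X) : 𝒢.fib U := 𝟙_ (𝒢.fib U)

/-- The product of `𝒢_U`. -/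
abbrev mul {U : Opens X} (γ δ : 𝒢.fib U) : 𝒢.fib U := γ ⊗ δ

end GrStack

end

section

open MonoidalCategory

section Paste

variable {A B : Type*} [Category A] [Category B]

/-- Vertical pasting of two squares of functors. -/
def pasteIso {R : A ⥤ B} {G F : A ⥤ A} {G' F' : B ⥤ B} (a : R ⋙ G' ≅ G ⋙ R)
    (b : R ⋙ F' ≅ F ⋙ R) : R ⋙ (G' ⋙ F') ≅ (G ⋙ F) ⋙ R :=
  (Functor.associator R G' F').symm ≪≫ Functor.isoWhiskerRight a F' ≪≫
    Functor.associator G R F' ≪≫ Functor.isoWhiskerLeft G b ≪≫ (Functor.associator G F R).symm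

@[simp] lemma pasteIso_hom_app {R : A ⥤ B} {G F : A ⥤ A} {G' F' : B ⥤ B} (a : R ⋙ G' ≅ G ⋙ R)
    (b : R ⋙ F' ≅ F ⋙ R) (x : A) :
    (pasteIso a b).hom.app x = F'.map (a.hom.app x) ≫ b.hom.app (G.obj x) := by
  simp [pasteIso]

instance [MonoidalCategory A] [MonoidalCategory B] {R : A ⥤ B} {G F : A ⥤ A} {G' F' : B ⥤ B}
    (a : R ⋙ G' ≅ G ⋙ R) (b : R ⋙ F' ≅ F ⋙ R) [R.LaxMonoidal] [G.LaxMonoidal] [F.LaxMonoidal]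
    [G'.LaxMonoidal] [F'.LaxMonoidal] [NatTrans.IsMonoidal a.hom] [NatTrans.IsMonoidal b.hom] :
    NatTrans.IsMonoidal (pasteIso a b).hom :=
  inferInstanceAs (NatTrans.IsMonoidal ((Functor.associator R G' F').inv ≫
    Functor.whiskerRight a.hom F' ≫ (Functor.associator G R F').hom ≫
    Functor.whiskerLeft G b.hom ≫ (Functor.associator G F R).inv))

end Paste

variable {X : Type w} [TopologicalSpace X] (𝒢 : GrStack.{v, u} X)

/-- An object of `𝓔q(𝒢)_U`: a monoidal self-equivalence of the restriction to `U` of the gr-stack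
`𝒢`, that is, a family of monoidal self-equivalences of the gr-categories `𝒢_W`, for `W ⊆ U`,
together with coherent monoidal isomorphisms expressing compatibility with restrictions. -/
structure SelfEq (U : Opens X) where
  fn (W : Opens X) (h : W ≤ U) : 𝒢.fib W ⥤ 𝒢.fib W
  monoidal (W : Opens X) (h : W ≤ U) : (fn W h).Monoidal
  isEquivalence (W : Opens X) (h : W ≤ U) : (fn W h).IsEquivalence
  nat {W' W : Opens X} (h' : W' ≤ W) (h : W ≤ U) :
    𝒢.res h' ⋙ fn W' (h'.trans h) ≅ fn W h ⋙ 𝒢.res h'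
  nat_isMonoidal {W' W : Opens X} (h' : W' ≤ W) (h : W ≤ U) : NatTrans.IsMonoidal (nat h' h).hom
  nat_comp {W'' W' W : Opens X} (h'' : W'' ≤ W') (h' : W' ≤ W) (h : W ≤ U) (γ : 𝒢.fib W) :
    (nat h'' (h'.trans h)).hom.app ((𝒢.res h').obj γ) ≫
      (𝒢.res h'').map ((nat h' h).hom.app γ) ≫ (𝒢.resComp h' h'').hom.app ((fn W h).obj γ) =
    (fn W'' ((h''.trans h').trans h)).map ((𝒢.resComp h' h'').hom.app γ) ≫
      (nat (h''.trans h') h).hom.app γ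

namespace SelfEq

variable {𝒢} {U V : Opens X}

instance (F : SelfEq 𝒢 U) (W : Opens X) (h : W ≤ U) : (F.fn W h).Monoidal := F.monoidal W h

instance (F : SelfEq 𝒢 U) (W : Opens X) (h : W ≤ U) : (F.fn W h).IsEquivalence :=
  F.isEquivalence W h

instance (F : SelfEq 𝒢 U) {W' W : Opens X} (h' : W' ≤ W) (h : W ≤ U) :
    NatTrans.IsMonoidal (F.nat h' h).hom := F.nat_isMonoidal h' h

/-- The isomorphism `F (γ|_{W'}) ≅ (F γ)|_{W'}`. -/
def nt (F : SelfEq 𝒢 U) {W' W : Opens X} (h' : W' ≤ W) (h : W ≤ U) (γ : 𝒢.fib W) :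
    (F.fn W' (h'.trans h)).obj ((𝒢.res h').obj γ) ≅ (𝒢.res h').obj ((F.fn W h).obj γ) :=
  (F.nat h' h).app γ

lemma nt_naturality (F : SelfEq 𝒢 U) {W' W : Opens X} (h' : W' ≤ W) (h : W ≤ U) {γ δ : 𝒢.fib W}
    (f : γ ⟶ δ) : (F.fn W' (h'.trans h)).map ((𝒢.res h').map f) ≫ (F.nt h' h δ).hom =
      (F.nt h' h γ).hom ≫ (𝒢.res h').map ((F.fn W h).map f) :=
  (F.nat h' h).hom.naturality f

lemma nt_comp (F : SelfEq 𝒢 U) {W'' W' W : Opens X} (h'' : W'' ≤ W') (h' : W' ≤ W) (h : W ≤ U)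
    (γ : 𝒢.fib W) :
    (F.nt h'' (h'.trans h) ((𝒢.res h').obj γ)).hom ≫
      (𝒢.res h'').map (F.nt h' h γ).hom ≫ (𝒢.rc h' h'' ((F.fn W h).obj γ)).hom =
    (F.fn W'' ((h''.trans h').trans h)).map (𝒢.rc h' h'' γ).hom ≫
      (F.nt (h''.trans h') h γ).hom :=
  F.nat_comp h'' h' h γ

/-- An arrow of `𝓔q(𝒢)_U`: a monoidal transformation compatible with restrictions. -/
@[ext]
structure Hom (F G : SelfEq 𝒢 U) where
  app (W : Opens X) (h : W ≤ U) : F.fn W h ⟶ G.fn W h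
  isMonoidal (W : Opens X) (h : W ≤ U) : NatTrans.IsMonoidal (app W h)
  naturality {W' W : Opens X} (h' : W' ≤ W) (h : W ≤ U) (γ : 𝒢.fib W) :
    (F.nt h' h γ).hom ≫ (𝒢.res h').map ((app W h).app γ) =
      (app W' (h'.trans h)).app ((𝒢.res h').obj γ) ≫ (G.nt h' h γ).hom

instance {F G : SelfEq 𝒢 U} (f : Hom F G) (W : Opens X) (h : W ≤ U) :
    NatTrans.IsMonoidal (f.app W h) := f.isMonoidal W h

instance : Category (SelfEq 𝒢 U) where
  Hom := Hom
  id F :=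
    { app := fun W h => 𝟙 _
      isMonoidal := fun W h => inferInstance
      naturality := by intros; simp }
  comp f g :=
    { app := fun W h => f.app W h ≫ g.app W h
      isMonoidal := fun W h => inferInstance
      naturality := by
        intro W' W h' h γ
        simp only [NatTrans.comp_app, Functor.map_comp, Category.assoc]
        rw [reassoc_of% (f.naturality h' h γ), g.naturality h' h γ] }
  id_comp f := Hom.ext (by funext W h; exact Category.id_comp _)
  comp_id f := Hom.ext (by funext W h; exact Category.comp_id _)
  assoc f g k := Hom.ext (by funext W h; exact Category.assoc _ _ _)

/-- The component at `γ` of an arrow of `𝓔q(𝒢)_U`. -/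
def ev {F G : SelfEq 𝒢 U} (f : F ⟶ G) (W : Opens X) (h : W ≤ U) (γ : 𝒢.fib W) :
    (F.fn W h).obj γ ⟶ (G.fn W h).obj γ := (Hom.app f W h).app γ

@[ext] lemma hom_ext {F G : SelfEq 𝒢 U} {f g : F ⟶ G}
    (h : ∀ W hW γ, ev f W hW γ = ev g W hW γ) : f = g :=
  Hom.ext (by funext W hW; ext γ; exact h W hW γ)

@[simp] lemma id_ev (F : SelfEq 𝒢 U) (W : Opens X) (h : W ≤ U) (γ : 𝒢.fib W) :
    ev (𝟙 F) W h γ = 𝟙 _ := rfl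

@[simp] lemma comp_ev {F G H : SelfEq 𝒢 U} (f : F ⟶ G) (g : G ⟶ H) (W : Opens X) (h : W ≤ U)
    (γ : 𝒢.fib W) : ev (f ≫ g) W h γ = ev f W h γ ≫ ev g W h γ := rfl

lemma ev_naturality {F G : SelfEq 𝒢 U} (f : F ⟶ G) {W : Opens X} (h : W ≤ U) {γ δ : 𝒢.fib W}
    (a : γ ⟶ δ) : (F.fn W h).map a ≫ ev f W h δ = ev f W h γ ≫ (G.fn W h).map a :=
  (Hom.app f W h).naturality a

lemma ev_nt {F G : SelfEq 𝒢 U} (f : F ⟶ G) {W' W : Opens X} (h' : W' ≤ W) (h : W ≤ U)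
    (γ : 𝒢.fib W) : (F.nt h' h γ).hom ≫ (𝒢.res h').map (ev f W h γ) =
      ev f W' (h'.trans h) ((𝒢.res h').obj γ) ≫ (G.nt h' h γ).hom :=
  Hom.naturality f h' h γ

/-- The composite `γ ↦ F (G γ)`. -/
def comp (F G : SelfEq 𝒢 U) : SelfEq 𝒢 U where
  fn W h := G.fn W h ⋙ F.fn W h
  monoidal W h := inferInstance
  isEquivalence W h := inferInstance
  nat h' h := pasteIso (G.nat h' h) (F.nat h' h)
  nat_isMonoidal h' h := inferInstance
  nat_comp {W'' W' W} h'' h' h γ := by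
    have e := F.nt_comp h'' h' h ((G.fn _ h).obj γ)
    have e' := congrArg (F.fn W'' ((h''.trans h').trans h)).map (G.nt_comp h'' h' h γ)
    have n := F.nt_naturality h'' (h'.trans h) (G.nt h' h γ).hom
    simp only [pasteIso_hom_app]
    change ((F.fn W'' _).map (G.nt h'' _ _).hom ≫ (F.nt h'' _ _).hom) ≫
      (𝒢.res h'').map ((F.fn W' _).map (G.nt h' _ _).hom ≫ (F.nt h' _ _).hom) ≫
        (𝒢.rc h' h'' _).hom = (F.fn W'' _).map ((G.fn W'' _).map (𝒢.rc h' h'' γ).hom) ≫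
        (F.fn W'' _).map (G.nt _ _ _).hom ≫ (F.nt _ _ _).hom
    simp only [Functor.map_comp, Category.assoc] at e' ⊢
    rw [← reassoc_of% n, e, reassoc_of% e']

lemma comp_nt (F G : SelfEq 𝒢 U) {W' W : Opens X} (h' : W' ≤ W) (h : W ≤ U) (γ : 𝒢.fib W) :
    ((comp F G).nt h' h γ).hom = (F.fn W' (h'.trans h)).map (G.nt h' h γ).hom ≫
      (F.nt h' h ((G.fn W h).obj γ)).hom :=
  pasteIso_hom_app _ _ _

variable (𝒢 U) in
/-- The identity self-equivalence. -/
def one : SelfEq 𝒢 U where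
  fn W h := 𝟭 _
  monoidal W h := inferInstance
  isEquivalence W h := inferInstance
  nat h' h := (𝒢.res h').rightUnitor ≪≫ (𝒢.res h').leftUnitor.symm
  nat_isMonoidal h' h := inferInstanceAs
    (NatTrans.IsMonoidal ((𝒢.res h').rightUnitor.hom ≫ (𝒢.res h').leftUnitor.inv))
  nat_comp h'' h' h γ := by simp

lemma one_nt {W' W : Opens X} (h' : W' ≤ W) (h : W ≤ U) (γ : 𝒢.fib W) :
    ((one 𝒢 U).nt h' h γ).hom = 𝟙 _ := by
  change 𝟙 _ ≫ 𝟙 _ = 𝟙 _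
  exact Category.comp_id _

/-- Horizontal composition of arrows. -/
def hcomp {F F' G G' : SelfEq 𝒢 U} (f : F ⟶ F') (g : G ⟶ G') : comp F G ⟶ comp F' G' where
  app W h := Hom.app g W h ◫ Hom.app f W h
  isMonoidal W h := by
    have := f.isMonoidal W h
    have := g.isMonoidal W h
    change NatTrans.IsMonoidal (Hom.app g W h ◫ Hom.app f W h)
    infer_instance
  naturality {W' W} h' h γ := by
    have ef := ev_nt f h' h ((G'.fn _ h).obj γ)
    have eg := congrArg (F.fn W' (h'.trans h)).map (ev_nt g h' h γ)
    have n := F.nt_naturality h' h (ev g W h γ)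
    have n' := ev_naturality f (h'.trans h) (G'.nt h' h γ).hom
    have n'' := ev_naturality f h (ev g W h γ)
    have n3 := ev_naturality f (h'.trans h) (ev g W' (h'.trans h) ((𝒢.res h').obj γ))
    simp only [Functor.map_comp] at eg
    simp only [comp_nt, NatTrans.hcomp_app]
    change ((F.fn W' _).map (G.nt h' h γ).hom ≫ (F.nt h' h _).hom) ≫
        (𝒢.res h').map (ev f W h _ ≫ (F'.fn W h).map (ev g W h γ)) =
      (ev f W' _ _ ≫ (F'.fn W' _).map (ev g W' _ _)) ≫ (F'.fn W' _).map (G'.nt h' h γ).hom ≫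
        (F'.nt h' h _).hom
    rw [← n'', ← n3, Functor.map_comp]
    simp only [Category.assoc]
    rw [← reassoc_of% n, reassoc_of% eg, ef, reassoc_of% n']

lemma hcomp_ev {F F' G G' : SelfEq 𝒢 U} (f : F ⟶ F') (g : G ⟶ G') (W : Opens X) (h : W ≤ U)
    (γ : 𝒢.fib W) : ev (hcomp f g) W h γ =
      ev f W h ((G.fn W h).obj γ) ≫ (F'.fn W h).map (ev g W h γ) := rfl

/-- Isomorphisms of self-equivalences are given by componentwise isomorphisms. -/
def isoMk {F G : SelfEq 𝒢 U} (e : ∀ W h, F.fn W h ≅ G.fn W h)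
    (hm : ∀ W h, NatTrans.IsMonoidal (e W h).hom)
    (hn : ∀ {W' W : Opens X} (h' : W' ≤ W) (h : W ≤ U) (γ : 𝒢.fib W),
      (F.nt h' h γ).hom ≫ (𝒢.res h').map ((e W h).hom.app γ) =
        (e W' (h'.trans h)).hom.app ((𝒢.res h').obj γ) ≫ (G.nt h' h γ).hom) : F ≅ G where
  hom := Hom.mk (fun W h => (e W h).hom) hm hn
  inv := Hom.mk (fun W h => (e W h).inv) (fun W h => inferInstance) (fun {W' W} h' h γ => by
    rw [← cancel_epi ((e W' (h'.trans h)).hom.app ((𝒢.res h').obj γ)), ← reassoc_of% (hn h' h γ),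
      ← Functor.map_comp, Iso.hom_inv_id_app, Iso.hom_inv_id_app_assoc,
      CategoryTheory.Functor.map_id, Category.comp_id])
  hom_inv_id := Hom.ext (by funext W h; exact (e W h).hom_inv_id)
  inv_hom_id := Hom.ext (by funext W h; exact (e W h).inv_hom_id)

lemma nt_eq {W' W : Opens X} (h' : W' ≤ W)
    {A : 𝒢.fib W'} {B : 𝒢.fib W} {k l : A ⟶ (𝒢.res h').obj B} (e : k = l) :
    k ≫ (𝒢.res h').map (𝟙 B) = 𝟙 A ≫ l := by
  rw [CategoryTheory.Functor.map_id, Category.comp_id, Category.id_comp, e]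

lemma map_map_comp {A B : Type*} [Category A] [Category B] (F : A ⥤ B) {x y z : A} (a : x ⟶ y)
    (b : y ⟶ z) {w : B} (c : F.obj z ⟶ w) : F.map a ≫ F.map b ≫ c = F.map (a ≫ b) ≫ c := by simp

/-- The associativity isomorphism; its components are identities. -/
def assocIso (F G H : SelfEq 𝒢 U) : comp (comp F G) H ≅ comp F (comp G H) :=
  isoMk (fun W h => (Functor.associator (H.fn W h) (G.fn W h) (F.fn W h)).symm)
    (fun W h => by
      change NatTrans.IsMonoidal (Functor.associator (H.fn W h) (G.fn W h) (F.fn W h)).inv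
      infer_instance)
    (fun h' h γ => by
      have e : ((comp (comp F G) H).nt h' h γ).hom = ((comp F (comp G H)).nt h' h γ).hom := by
        rw [comp_nt, comp_nt, comp_nt, comp_nt]
        exact map_map_comp (F.fn _ _) ((G.fn _ _).map (H.nt h' h γ).hom) (G.nt h' h _).hom
          (F.nt h' h _).hom
      exact nt_eq h' e)

/-- The left unit isomorphism; its components are identities. -/
def leftUnitIso (F : SelfEq 𝒢 U) : comp (one 𝒢 U) F ≅ F :=
  isoMk (fun W h => (F.fn W h).rightUnitor)
    (fun W h => by
      change NatTrans.IsMonoidal (F.fn W h).rightUnitor.hom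
      infer_instance)
    (fun h' h γ => by
      have e : ((comp (one 𝒢 U) F).nt h' h γ).hom = (F.nt h' h γ).hom := by
        rw [comp_nt, one_nt]
        exact Category.comp_id _
      exact nt_eq h' e)

/-- The right unit isomorphism; its components are identities. -/
def rightUnitIso (F : SelfEq 𝒢 U) : comp F (one 𝒢 U) ≅ F :=
  isoMk (fun W h => (F.fn W h).leftUnitor)
    (fun W h => by
      change NatTrans.IsMonoidal (F.fn W h).leftUnitor.hom
      infer_instance)
    (fun h' h γ => by
      have e : ((comp F (one 𝒢 U)).nt h' h γ).hom = (F.nt h' h γ).hom := by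
        rw [comp_nt, one_nt]
        change (F.fn _ _).map (𝟙 ((𝒢.res h').obj γ)) ≫ _ = _
        rw [CategoryTheory.Functor.map_id]
        exact Category.id_comp _
      exact nt_eq h' e)

@[simp] lemma assocIso_ev (F G H : SelfEq 𝒢 U) (W : Opens X) (h : W ≤ U) (γ : 𝒢.fib W) :
    ev (assocIso F G H).hom W h γ = 𝟙 _ := rfl

@[simp] lemma leftUnitIso_ev (F : SelfEq 𝒢 U) (W : Opens X) (h : W ≤ U) (γ : 𝒢.fib W) :
    ev (leftUnitIso F).hom W h γ = 𝟙 _ := rfl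

@[simp] lemma rightUnitIso_ev (F : SelfEq 𝒢 U) (W : Opens X) (h : W ≤ U) (γ : 𝒢.fib W) :
    ev (rightUnitIso F).hom W h γ = 𝟙 _ := rfl

lemma comp_obj (F G : SelfEq 𝒢 U) (W : Opens X) (h : W ≤ U) (γ : 𝒢.fib W) :
    ((comp F G).fn W h).obj γ = (F.fn W h).obj ((G.fn W h).obj γ) := rfl

lemma comp_map (F G : SelfEq 𝒢 U) (W : Opens X) (h : W ≤ U) {γ δ : 𝒢.fib W} (f : γ ⟶ δ) :
    ((comp F G).fn W h).map f = (F.fn W h).map ((G.fn W h).map f) := rfl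

lemma one_map (W : Opens X) (h : W ≤ U) {γ δ : 𝒢.fib W} (f : γ ⟶ δ) :
    ((one 𝒢 U).fn W h).map f = f := rfl

/-- `𝓔q(𝒢)_U` is a monoidal category under composition of self-equivalences. -/
instance : MonoidalCategory (SelfEq 𝒢 U) where
  tensorObj := comp
  tensorUnit := one 𝒢 U
  tensorHom f g := hcomp f g
  whiskerLeft F _ _ g := hcomp (𝟙 F) g
  whiskerRight f G := hcomp f (𝟙 G)
  associator := assocIso
  leftUnitor := leftUnitIso
  rightUnitor := rightUnitIso
  tensorHom_def {F₁ G₁ F₂ G₂} f g := by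
    ext W h γ
    change ev f W h _ ≫ (G₁.fn W h).map (ev g W h γ) = (ev f W h _ ≫ (G₁.fn W h).map (𝟙 _)) ≫
      𝟙 _ ≫ (G₁.fn W h).map (ev g W h γ)
    rw [CategoryTheory.Functor.map_id, Category.comp_id, Category.id_comp]
  id_tensorHom_id F G := by
    ext W h γ
    simp only [hcomp_ev, id_ev, CategoryTheory.Functor.map_id]
    exact Category.id_comp _
  tensorHom_comp_tensorHom {F₁ G₁ H₁ F₂ G₂ H₂} f f' g g' := by
    ext W h γ
    have := ev_naturality g h (ev f' W h γ)
    change (ev f W h _ ≫ (G₁.fn W h).map (ev f' W h γ)) ≫ ev g W h _ ≫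
      (H₁.fn W h).map (ev g' W h γ) = (ev f W h _ ≫ ev g W h _) ≫
        (H₁.fn W h).map (ev f' W h γ ≫ ev g' W h γ)
    rw [CategoryTheory.Functor.map_comp, Category.assoc, Category.assoc, reassoc_of% this]
  whiskerLeft_id F G := by
    ext W h γ
    simp only [hcomp_ev, id_ev, CategoryTheory.Functor.map_id]
    exact Category.id_comp _
  id_whiskerRight F G := by
    ext W h γ
    simp only [hcomp_ev, id_ev, CategoryTheory.Functor.map_id]
    exact Category.id_comp _
  associator_naturality {F₁ F₂ F₃ G₁ G₂ G₃} f g k := by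
    ext W h γ
    change ((ev f W h _ ≫ (G₁.fn W h).map (ev g W h _)) ≫
      (G₁.fn W h).map ((G₂.fn W h).map (ev k W h γ))) ≫ 𝟙 _ = 𝟙 _ ≫ ev f W h _ ≫
        (G₁.fn W h).map (ev g W h _ ≫ (G₂.fn W h).map (ev k W h γ))
    rw [Category.comp_id, Category.id_comp, Functor.map_comp, Category.assoc]
  leftUnitor_naturality f := by
    ext W h γ
    change (𝟙 _ ≫ ev f W h γ) ≫ 𝟙 _ = 𝟙 _ ≫ ev f W h γ
    rw [Category.comp_id]
  rightUnitor_naturality {F G} f := by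
    ext W h γ
    change (ev f W h γ ≫ (G.fn W h).map (𝟙 _)) ≫ 𝟙 _ = 𝟙 _ ≫ ev f W h γ
    rw [Category.comp_id, CategoryTheory.Functor.map_id, Category.comp_id, Category.id_comp]
  pentagon F G H K := by
    ext W h γ
    change (𝟙 _ ≫ (F.fn W h).map ((G.fn W h).map ((H.fn W h).map (𝟙 _)))) ≫ 𝟙 _ ≫ 𝟙 _ ≫
      (F.fn W h).map (𝟙 _) = 𝟙 _ ≫ 𝟙 _
    simp only [CategoryTheory.Functor.map_id, Category.comp_id]
  triangle F G := by
    ext W h γ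
    change 𝟙 _ ≫ 𝟙 _ ≫ (F.fn W h).map (𝟙 _) = 𝟙 _ ≫ (F.fn W h).map (𝟙 _)
    simp only [CategoryTheory.Functor.map_id, Category.comp_id]

end SelfEq

end

section

open MonoidalCategory

section MapConj

open Functor Functor.LaxMonoidal Functor.OplaxMonoidal

variable {C D E : Type*} [Category C] [Category D] [Category E] [MonoidalCategory C]
  [MonoidalCategory D] [MonoidalCategory E] [IsGrCategory C]

lemma mapConjIso_hom (R : C ⥤ D) [R.Monoidal] {g : C} {h : D} (u : R.obj g ≅ h) (γ : C) :
    (mapConjIso R u γ).hom = R.obj ((conj g).obj γ) ◁ u.inv ≫ μ R _ g ≫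
      R.map (conjIso g γ).hom ≫ OplaxMonoidal.δ R g γ ≫ u.hom ▷ R.obj γ := by
  simp [mapConjIso]

lemma mapConjIso_comp (R : C ⥤ D) (R' : D ⥤ E) [R.Monoidal] [R'.Monoidal] {g : C} {h : D} {k : E}
    (u : R.obj g ≅ h) (u' : R'.obj h ≅ k) (γ : C) :
    (mapConjIso (R ⋙ R') (R'.mapIso u ≪≫ u') γ).hom =
      R'.obj (R.obj ((conj g).obj γ)) ◁ u'.inv ≫ μ R' _ _ ≫ R'.map (mapConjIso R u γ).hom ≫
        OplaxMonoidal.δ R' _ _ ≫ u'.hom ▷ R'.obj (R.obj γ) := by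
  simp [mapConjIso]

lemma mapConjIso_natTrans (S S' : C ⥤ D) [S.Monoidal] [S'.Monoidal] (c : S ≅ S')
    [NatTrans.IsMonoidal c.hom] {g : C} {h : D} (u : S'.obj g ≅ h) (γ : C) :
    c.hom.app ((conj g).obj γ) ▷ h ≫ (mapConjIso S' u γ).hom =
      (mapConjIso S (c.app g ≪≫ u) γ).hom ≫ h ◁ c.hom.app γ := by
  have h1 (x y : C) : μ S x y ≫ c.hom.app (x ⊗ y) =
      c.hom.app x ▷ S.obj y ≫ S'.obj x ◁ c.hom.app y ≫ μ S' x y := by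
    rw [NatTrans.IsMonoidal.tensor, MonoidalCategory.tensorHom_def, Category.assoc]
  have h2 (x y : C) : c.hom.app (x ⊗ y) ≫ OplaxMonoidal.δ S' x y =
      OplaxMonoidal.δ S x y ≫ c.hom.app x ▷ S.obj y ≫ S'.obj x ◁ c.hom.app y := by
    rw [← cancel_epi (μ S x y), reassoc_of% (h1 x y), Functor.Monoidal.μ_δ,
      Functor.Monoidal.μ_δ_assoc, Category.comp_id]
  have n := c.hom.naturality (conjIso g γ).hom
  rw [mapConjIso_hom, mapConjIso_hom]
  simp only [Iso.trans_hom, Iso.trans_inv, Iso.app_hom, Iso.app_inv, comp_whiskerRight,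
    Category.assoc]
  rw [← whisker_exchange, ← reassoc_of% (h2 g γ), reassoc_of% n, reassoc_of% (h1 _ g),
    MonoidalCategory.whiskerLeft_comp_assoc, whisker_exchange_assoc,
    ← MonoidalCategory.whiskerLeft_comp_assoc (S'.obj _), Iso.inv_hom_id_app,
    MonoidalCategory.whiskerLeft_id, Category.id_comp, ← whisker_exchange_assoc]

lemma mapConjIso_conjMap [IsGrCategory D] (R : C ⥤ D) [R.Monoidal] {g g' : C} {h h' : D}
    (u : R.obj g ≅ h) (u' : R.obj g' ≅ h') (a : g ⟶ g') (b : h ⟶ h')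
    (e : R.map a ≫ u'.hom = u.hom ≫ b) (γ : C) :
    R.obj ((conj g).obj γ) ◁ b ≫ R.map ((conjMap a).app γ) ▷ h' ≫ (mapConjIso R u' γ).hom =
      (mapConjIso R u γ).hom ≫ b ▷ R.obj γ := by
  have e' : b ≫ u'.inv = u.inv ≫ R.map a := by
    rw [Iso.comp_inv_eq, Category.assoc, e, Iso.inv_hom_id_assoc]
  rw [mapConjIso_hom, mapConjIso_hom, ← whisker_exchange_assoc,
    ← MonoidalCategory.whiskerLeft_comp_assoc, e', μ_natural_left_assoc,
    MonoidalCategory.whiskerLeft_comp_assoc, μ_natural_right_assoc]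
  simp only [Category.assoc]
  rw [← R.map_comp_assoc ((conjMap a).app γ ▷ g'), ← R.map_comp_assoc, conjMap_spec,
    R.map_comp_assoc, ← comp_whiskerRight, ← e, comp_whiskerRight, ← δ_natural_left_assoc]

end MapConj

variable {X : Type w} [TopologicalSpace X] {𝒢 : GrStack.{v, u} X}

lemma mapConjIso_rc {W'' W' W U : Opens X} (h'' : W'' ≤ W') (h' : W' ≤ W) (h : W ≤ U)
    (g : 𝒢.fib U) (γ : 𝒢.fib W) :
    (𝒢.res h'').map ((conjCompareApp (𝒢.res h') (𝒢.rc h h' g) γ).hom) ▷ _ ≫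
      (𝒢.rc h' h'' ((conj ((𝒢.res h).obj g)).obj γ)).hom ▷ _ ≫
        (mapConjIso (𝒢.res (h''.trans h')) (𝒢.rc h (h''.trans h') g) γ).hom =
    (mapConjIso (𝒢.res h'') (𝒢.rc (h'.trans h) h'' g) ((𝒢.res h').obj γ)).hom ≫
      _ ◁ (𝒢.rc h' h'' γ).hom := by
  have e : (𝒢.res h'').mapIso (𝒢.rc h h' g) ≪≫ 𝒢.rc (h'.trans h) h'' g =
      (𝒢.resComp h' h'').app ((𝒢.res h).obj g) ≪≫ 𝒢.rc h (h''.trans h') g := by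
    ext
    exact resComp_assoc 𝒢.F h h' h'' g
  have k := mapConjIso_natTrans (𝒢.res h' ⋙ 𝒢.res h'') (𝒢.res (h''.trans h')) (𝒢.resComp h' h'')
    (𝒢.rc h (h''.trans h') g) γ
  rw [← e, mapConjIso_comp] at k
  refine (congrArg (_ ≫ ·) k).trans ?_
  rw [mapConjIso_hom (𝒢.res h'') (𝒢.rc (h'.trans h) h'' g)]
  simp only [Category.assoc]
  rw [← whisker_exchange_assoc, Functor.LaxMonoidal.μ_natural_left_assoc,
    ← Functor.map_comp_assoc, conjCompareApp_spec]
  rfl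

namespace SelfEq

variable {U V : Opens X}

/-- Restriction of self-equivalences to a smaller open set. -/
def restrict (h : V ≤ U) (F : SelfEq 𝒢 U) : SelfEq 𝒢 V where
  fn W hW := F.fn W (hW.trans h)
  monoidal _ _ := inferInstance
  isEquivalence _ _ := inferInstance
  nat h' hW := F.nat h' (hW.trans h)
  nat_isMonoidal _ _ := inferInstance
  nat_comp h'' h' hW γ := F.nat_comp h'' h' (hW.trans h) γ

/-- Restriction of arrows to a smaller open set. -/
def restrictMap (h : V ≤ U) {F G : SelfEq 𝒢 U} (f : F ⟶ G) : restrict h F ⟶ restrict h G :=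
  Hom.mk (fun W hW => Hom.app f W (hW.trans h)) (fun W hW => Hom.isMonoidal f W (hW.trans h))
    (fun h' hW γ => Hom.naturality f h' (hW.trans h) γ)

/-- Inner conjugation by an object `g` of `𝒢_U`, as an object of `𝓔q(𝒢)_U`: on `𝒢_W` it is
conjugation by `g|_W`. -/
noncomputable def inner (g : 𝒢.fib U) : SelfEq 𝒢 U where
  fn W h := conj ((𝒢.res h).obj g)
  monoidal W h := inferInstance
  isEquivalence W h := inferInstance
  nat h' h := conjCompare (𝒢.res h') (𝒢.rc h h' g)
  nat_isMonoidal h' h := inferInstance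
  nat_comp {W'' W' W} h'' h' h γ := by
    apply whiskerRight_cancel ((𝒢.res ((h''.trans h').trans h)).obj g)
    rw [← cancel_mono (mapConjIso (𝒢.res (h''.trans h')) (𝒢.rc h (h''.trans h') g) γ).hom]
    have k := mapConjIso_rc h'' h' h g γ
    change ((conjCompareApp (𝒢.res h'') (𝒢.rc (h'.trans h) h'' g) ((𝒢.res h').obj γ)).hom ≫
      (𝒢.res h'').map (conjCompareApp (𝒢.res h') (𝒢.rc h h' g) γ).hom ≫
      (𝒢.rc h' h'' _).hom) ▷ _ ≫ _ =
      ((conj ((𝒢.res ((h''.trans h').trans h)).obj g)).map (𝒢.rc h' h'' γ).hom ≫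
        (conjCompareApp (𝒢.res (h''.trans h')) (𝒢.rc h (h''.trans h') g) γ).hom) ▷ _ ≫ _
    rw [comp_whiskerRight_assoc, comp_whiskerRight_assoc, k, comp_whiskerRight_assoc,
      conjCompareApp_spec, reassoc_of% conjCompareApp_spec]
    exact (conjIso_naturality _ _).symm

/-- Inner conjugation on arrows. -/
noncomputable def innerMap {g g' : 𝒢.fib U} (a : g ⟶ g') : inner g ⟶ inner g' :=
  Hom.mk (fun W h => conjMap ((𝒢.res h).map a))
    (fun W h => conjMap_isMonoidal ((𝒢.res h).map a)) (fun {W' W} h' h γ => by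
    have n : (𝒢.res h').map ((𝒢.res h).map a) ≫ (𝒢.rc h h' g').hom =
        (𝒢.rc h h' g).hom ≫ (𝒢.res (h'.trans h)).map a := (𝒢.resComp h h').hom.naturality a
    have k := mapConjIso_conjMap (𝒢.res h') (𝒢.rc h h' g) (𝒢.rc h h' g') _ _ n γ
    change (conjCompareApp (𝒢.res h') (𝒢.rc h h' g) γ).hom ≫
      (𝒢.res h').map ((conjMap ((𝒢.res h).map a)).app γ) =
      (conjMap ((𝒢.res (h'.trans h)).map a)).app ((𝒢.res h').obj γ) ≫
        (conjCompareApp (𝒢.res h') (𝒢.rc h h' g') γ).hom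
    apply whiskerRight_cancel ((𝒢.res (h'.trans h)).obj g')
    rw [← cancel_mono (mapConjIso (𝒢.res h') (𝒢.rc h h' g') γ).hom,
      ← cancel_epi ((conj ((𝒢.res (h'.trans h)).obj g)).obj ((𝒢.res h').obj γ) ◁
        (𝒢.res (h'.trans h)).map a)]
    rw [comp_whiskerRight_assoc, comp_whiskerRight_assoc, conjCompareApp_spec, conjMap_spec,
      whisker_exchange_assoc, k, reassoc_of% conjCompareApp_spec])

variable (𝒢 U) in
/-- The inner conjugation functor `j : 𝒢_U ⥤ 𝓔q(𝒢)_U`. -/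
noncomputable def j : 𝒢.fib U ⥤ SelfEq 𝒢 U where
  obj g := inner g
  map a := innerMap a
  map_id g := by
    ext W h γ
    change (conjMap ((𝒢.res h).map (𝟙 g))).app γ = 𝟙 _
    apply whiskerRight_cancel ((𝒢.res h).obj g)
    rw [← cancel_mono (conjIso _ γ).hom]
    have := conjMap_spec (𝟙 ((𝒢.res h).obj g)) γ
    simpa using this
  map_comp {g g' g''} a b := by
    ext W h γ
    change (conjMap ((𝒢.res h).map (a ≫ b))).app γ =
      (conjMap ((𝒢.res h).map a)).app γ ≫ (conjMap ((𝒢.res h).map b)).app γ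
    rw [CategoryTheory.Functor.map_comp]
    apply whiskerRight_cancel ((𝒢.res h).obj g'')
    rw [← cancel_mono (conjIso _ γ).hom, ← cancel_epi ((conj ((𝒢.res h).obj g)).obj γ ◁
      ((𝒢.res h).map a ≫ (𝒢.res h).map b)), conjMap_spec, MonoidalCategory.whiskerLeft_comp_assoc,
      comp_whiskerRight_assoc, whisker_exchange_assoc, conjMap_spec, reassoc_of% conjMap_spec,
      comp_whiskerRight]

end SelfEq

end

/-- A *2-category fibred in 2-groupoids* over the open sets of `X`, presented by its total
bicategory: every object `x` lies over an open set `base x`, an arrow `x ⟶ y` can exist only if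
`base x ≤ base y` (it is a path over `base x` from `x` to the restriction of `y`), every arrow is
cartesian, and every object can be restricted to the open subsets of its base. The fibre over `U`
is the 2-groupoid of the objects with base `U`. -/
structure FibredTwoGroupoid (X : Type w) [TopologicalSpace X] where
  Ob : Type u₁
  bicat : Bicategory.{w₁, v₁} Ob
  locallyGroupoid : Bicategory.IsLocallyGroupoid Ob
  base : Ob → Opens X
  base_le {x y : Ob} : (x ⟶ y) → base x ≤ base y
  cartesian {x y : Ob} (f : x ⟶ y) (z : Ob) (hz : base z ≤ base x) :
    (Bicategory.postcomp z f).IsEquivalence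
  /-- the restriction `x|_V` -/
  restr (x : Ob) (V : Opens X) (h : V ≤ base x) : Ob
  base_restr (x : Ob) (V : Opens X) (h : V ≤ base x) : base (restr x V h) = V
  /-- the cartesian arrow `x|_V ⟶ x` -/
  restrHom (x : Ob) (V : Opens X) (h : V ≤ base x) : restr x V h ⟶ x

namespace FibredTwoGroupoid

open Bicategory

variable {X : Type w} [TopologicalSpace X] (P : FibredTwoGroupoid.{w, w₁, v₁, u₁} X)

instance : Bicategory P.Ob := P.bicat

instance (x y : P.Ob) : IsGroupoid (x ⟶ y) := P.locallyGroupoid x y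

variable {P} {x y z : P.Ob}

/-- The two-arrow `a ⟶ b` determined by a two-arrow `a ≫ f ⟶ b ≫ f`. -/
noncomputable def cancel (f : x ⟶ y) {a b : z ⟶ x} (α : a ≫ f ⟶ b ≫ f) : a ⟶ b :=
  have := P.cartesian f z (P.base_le a)
  (postcomp z f).preimage α

lemma cancel_whiskerRight (f : x ⟶ y) {a b : z ⟶ x} (α : a ≫ f ⟶ b ≫ f) : cancel f α ▷ f = α :=
  have := P.cartesian f z (P.base_le a)
  (postcomp z f).map_preimage α

lemma whiskerRight_injective (f : x ⟶ y) {a b : z ⟶ x} {α β : a ⟶ b} (h : α ▷ f = β ▷ f) :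
    α = β :=
  have := P.cartesian f z (P.base_le a)
  (postcomp z f).map_injective h

/-- The factorization, up to a two-arrow, of `g : z ⟶ y` through `f : x ⟶ y`, for
`base z ≤ base x`. -/
noncomputable def lift (f : x ⟶ y) (g : z ⟶ y) (hz : P.base z ≤ P.base x) : z ⟶ x :=
  have := P.cartesian f z hz
  (postcomp z f).objPreimage g

/-- The two-arrow of the factorization `lift f g`. -/
noncomputable def liftIso (f : x ⟶ y) (g : z ⟶ y) (hz : P.base z ≤ P.base x) :
    lift f g hz ≫ f ≅ g :=
  have := P.cartesian f z hz
  (postcomp z f).objObjPreimageIso g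

lemma base_restr_le {V W : Opens X} (hV : V ≤ P.base x) (hW : W ≤ P.base y) (h : W ≤ V) :
    P.base (P.restr y W hW) ≤ P.base (P.restr x V hV) := by
  rw [P.base_restr, P.base_restr]; exact h

/-- The transition arrow `x|_W ⟶ x|_V`, for `W ⊆ V`. -/
noncomputable def tr (x : P.Ob) {W V : Opens X} (h' : W ≤ V) (h : V ≤ P.base x) :
    P.restr x W (h'.trans h) ⟶ P.restr x V h :=
  lift (P.restrHom x V h) (P.restrHom x W (h'.trans h)) (base_restr_le _ _ h')

/-- The transition arrow is compatible with the arrows to `x`. -/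
noncomputable def trIso (x : P.Ob) {W V : Opens X} (h' : W ≤ V) (h : V ≤ P.base x) :
    tr x h' h ≫ P.restrHom x V h ≅ P.restrHom x W (h'.trans h) :=
  liftIso _ _ _

/-- Transitivity of the transition arrows. -/
noncomputable def trComp (x : P.Ob) {Z W V : Opens X} (h'' : Z ≤ W) (h' : W ≤ V)
    (h : V ≤ P.base x) : tr x h'' (h'.trans h) ≫ tr x h' h ⟶ tr x (h''.trans h') h :=
  cancel (P.restrHom x V h) ((α_ _ _ _).hom ≫ tr x h'' (h'.trans h) ◁ (trIso x h' h).hom ≫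
    (trIso x h'' (h'.trans h)).hom ≫ (trIso x (h''.trans h') h).inv)

/-- The restriction to `W ⊆ V` of a path `φ : x|_V ⟶ y|_V`. -/
noncomputable def resPath {V : Opens X} {hx : V ≤ P.base x} {hy : V ≤ P.base y}
    (φ : P.restr x V hx ⟶ P.restr y V hy) {W : Opens X} (h : W ≤ V) :
    P.restr x W (h.trans hx) ⟶ P.restr y W (h.trans hy) :=
  lift (tr y h hy) (tr x h hx ≫ φ) (base_restr_le _ _ le_rfl)

/-- The defining two-arrow of the restriction of a path. -/
noncomputable def resPathIso {V : Opens X} {hx : V ≤ P.base x} {hy : V ≤ P.base y}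
    (φ : P.restr x V hx ⟶ P.restr y V hy) {W : Opens X} (h : W ≤ V) :
    resPath φ h ≫ tr y h hy ≅ tr x h hx ≫ φ :=
  liftIso _ _ _

/-- The compatibility of the restrictions to `Z ⊆ W ⊆ V` of a path `φ : x|_V ⟶ y|_V`. -/
noncomputable def resPathTr {V : Opens X} {hx : V ≤ P.base x} {hy : V ≤ P.base y}
    (φ : P.restr x V hx ⟶ P.restr y V hy) {Z W : Opens X} (h' : Z ≤ W) (h : W ≤ V) :
    resPath φ (h'.trans h) ≫ tr y h' (h.trans hy) ⟶ tr x h' (h.trans hx) ≫ resPath φ h :=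
  cancel (tr y h hy) ((α_ _ _ _).hom ≫ _ ◁ trComp y h' h hy ≫ (resPathIso φ (h'.trans h)).hom ≫
    inv (trComp x h' h hx) ▷ φ ≫ (α_ _ _ _).hom ≫ _ ◁ (resPathIso φ h).inv ≫ (α_ _ _ _).inv)

end FibredTwoGroupoid

/-- A covering sieve of `U`: a downward closed family of open sets with union `U`. -/
structure CoveringSieve {X : Type w} [TopologicalSpace X] (U : Opens X) where
  sets : Set (Opens X)
  down {V W : Opens X} : W ≤ V → V ∈ sets → W ∈ sets
  sSup_eq : sSup sets = U

namespace CoveringSieve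

variable {X : Type w} [TopologicalSpace X] {U : Opens X} (S : CoveringSieve U)

lemma le {V : Opens X} (hV : V ∈ S.sets) : V ≤ U :=
  (le_sSup hV).trans_eq S.sSup_eq

end CoveringSieve

namespace FibredTwoGroupoid

open Bicategory

variable {X : Type w} [TopologicalSpace X] (P : FibredTwoGroupoid.{w, w₁, v₁, u₁} X)

/-- A descent datum for arrows `x ⟶ y` along a covering sieve of the base of `x`. -/
structure ArrowDescent (x y : P.Ob) (S : CoveringSieve (P.base x)) where
  arr (V : Opens X) (hV : V ∈ S.sets) : P.restr x V (S.le hV) ⟶ y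
  glue {W V : Opens X} (h : W ≤ V) (hV : V ∈ S.sets) :
    tr x h (S.le hV) ≫ arr V hV ⟶ arr W (S.down h hV)
  glue_comp {Z W V : Opens X} (h' : Z ≤ W) (h : W ≤ V) (hV : V ∈ S.sets) :
    (α_ _ _ _).hom ≫ tr x h' (h.trans (S.le hV)) ◁ glue h hV ≫ glue h' (S.down h hV) =
      trComp x h' h (S.le hV) ▷ arr V hV ≫ glue (h'.trans h) hV

/-- A descent datum for objects along a covering sieve of `U`. -/
structure ObjectDescent {U : Opens X} (S : CoveringSieve U) where
  ob (V : Opens X) (hV : V ∈ S.sets) : P.Ob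
  base_ob (V : Opens X) (hV : V ∈ S.sets) : P.base (ob V hV) = V
  arr {W V : Opens X} (h : W ≤ V) (hV : V ∈ S.sets) : ob W (S.down h hV) ⟶ ob V hV
  glue {Z W V : Opens X} (h' : Z ≤ W) (h : W ≤ V) (hV : V ∈ S.sets) :
    arr h' (S.down h hV) ≫ arr h hV ⟶ arr (h'.trans h) hV
  glue_comp {Y Z W V : Opens X} (h'' : Y ≤ Z) (h' : Z ≤ W) (h : W ≤ V) (hV : V ∈ S.sets) :
    (α_ _ _ _).hom ≫ arr h'' (S.down (h'.trans h) hV) ◁ glue h' h hV ≫ glue h'' (h'.trans h) hV =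
      glue h'' h' (S.down h hV) ▷ arr h hV ≫ glue (h''.trans h') h hV

/-- The conditions for a 2-category fibred in 2-groupoids to be a 2-stack: two-arrows can be
glued, uniquely, along open coverings (that is, along covering sieves), and every descent datum
for arrows or for objects is effective. -/
structure IsTwoStack : Prop where
  glue_two_arrow (x y : P.Ob) (S : CoveringSieve (P.base x)) (f g : x ⟶ y)
    (a : ∀ V (hV : V ∈ S.sets), P.restrHom x V (S.le hV) ≫ f ⟶ P.restrHom x V (S.le hV) ≫ g)
    (ha : ∀ {W V : Opens X} (h : W ≤ V) (hV : V ∈ S.sets),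
      tr x h (S.le hV) ◁ a V hV ≫ (α_ _ _ _).inv ≫ (trIso x h (S.le hV)).hom ▷ g =
        (α_ _ _ _).inv ≫ (trIso x h (S.le hV)).hom ▷ f ≫ a W (S.down h hV)) :
    ∃! b : f ⟶ g, ∀ V (hV : V ∈ S.sets), P.restrHom x V (S.le hV) ◁ b = a V hV
  glue_arrow (x y : P.Ob) (S : CoveringSieve (P.base x)) (D : P.ArrowDescent x y S) :
    ∃ (f : x ⟶ y) (e : ∀ V (hV : V ∈ S.sets), P.restrHom x V (S.le hV) ≫ f ⟶ D.arr V hV),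
      ∀ {W V : Opens X} (h : W ≤ V) (hV : V ∈ S.sets),
        tr x h (S.le hV) ◁ e V hV ≫ D.glue h hV =
          (α_ _ _ _).inv ≫ (trIso x h (S.le hV)).hom ▷ f ≫ e W (S.down h hV)
  glue_object (U : Opens X) (S : CoveringSieve U) (D : P.ObjectDescent S) :
    ∃ (x : P.Ob) (_ : P.base x = U) (f : ∀ V (hV : V ∈ S.sets), D.ob V hV ⟶ x)
      (e : ∀ {W V : Opens X} (h : W ≤ V) (hV : V ∈ S.sets),
        D.arr h hV ≫ f V hV ⟶ f W (S.down h hV)),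
      ∀ {Z W V : Opens X} (h' : Z ≤ W) (h : W ≤ V) (hV : V ∈ S.sets),
        (α_ _ _ _).hom ≫ D.arr h' (S.down h hV) ◁ e h hV ≫ e h' (S.down h hV) =
          D.glue h' h hV ▷ f V hV ≫ e (h'.trans h) hV

/-- A *2-gerbe*: a 2-stack in 2-groupoids which is locally non-empty and locally connected. -/
structure IsTwoGerbe : Prop extends IsTwoStack P where
  locally_nonempty (p : X) : ∃ x : P.Ob, p ∈ P.base x
  locally_connected (x y : P.Ob) (p : X) : p ∈ P.base x → p ∈ P.base y →
    ∃ (V : Opens X) (hx : V ≤ P.base x) (hy : V ≤ P.base y), p ∈ V ∧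
      Nonempty (P.restr x V hx ⟶ P.restr y V hy)

end FibredTwoGroupoid

section EndTriv

section Act

open MonoidalCategory

variable {C : Type*} [Category C] [MonoidalCategory C] {B : Type*} [Bicategory B] {x : B}
  (F : C ⥤ (x ⟶ x)ᴹᵒᵖ) [F.Monoidal]

/-- The endomorphism of `x` attached to an object of `C` by a functor from `C` to the category of
endomorphisms of `x`. The monoidal structure on the target of the functor is the opposite of the
composition of arrows in diagrammatic order. -/
def actObj (γ : C) : x ⟶ x := (F.obj γ).unmop

/-- The two-arrow attached to an arrow of `C`. -/
def actMap {γ δ : C} (f : γ ⟶ δ) : actObj F γ ⟶ actObj F δ := (F.map f).unmop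

/-- The unit constraint. -/
def actUnit : 𝟙 x ⟶ actObj F (𝟙_ C) := (Functor.LaxMonoidal.ε F).unmop

/-- The tensor constraint: `γ ⊗ δ` acts as the composite of `δ` followed by `γ`. -/
def actMul (γ δ : C) : actObj F δ ≫ actObj F γ ⟶ actObj F (γ ⊗ δ) :=
  (Functor.LaxMonoidal.μ F γ δ).unmop

end Act

open Bicategory FibredTwoGroupoid

variable {X : Type w} [TopologicalSpace X]

/-- An equivalence between the restriction of the gr-stack `𝒢` to the base of `x` and the
gr-stack `𝒢_x` of self-paths of `x`, whose product is composition. It is given by monoidal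
equivalences `𝒢_W ≃ Ar(x|_W, x|_W)`, together with coherent monoidal two-arrows expressing
compatibility with restrictions. -/
structure EndTriv (𝒢 : GrStack.{v, u} X) (P : FibredTwoGroupoid.{w, w₁, v₁, u₁} X) (x : P.Ob) where
  fn (W : Opens X) (h : W ≤ P.base x) : 𝒢.fib W ⥤ (P.restr x W h ⟶ P.restr x W h)ᴹᵒᵖ
  monoidal (W : Opens X) (h : W ≤ P.base x) : (fn W h).Monoidal
  isEquivalence (W : Opens X) (h : W ≤ P.base x) : (fn W h).IsEquivalence
  cell {W' W : Opens X} (h' : W' ≤ W) (h : W ≤ P.base x) (γ : 𝒢.fib W) :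
    actObj (fn W' (h'.trans h)) ((𝒢.res h').obj γ) ≫ tr x h' h ⟶ tr x h' h ≫ actObj (fn W h) γ
  cell_naturality {W' W : Opens X} (h' : W' ≤ W) (h : W ≤ P.base x) {γ δ : 𝒢.fib W} (f : γ ⟶ δ) :
    actMap (fn W' (h'.trans h)) ((𝒢.res h').map f) ▷ tr x h' h ≫ cell h' h δ =
      cell h' h γ ≫ tr x h' h ◁ actMap (fn W h) f
  cell_unit {W' W : Opens X} (h' : W' ≤ W) (h : W ≤ P.base x) :
    (actUnit (fn W' (h'.trans h)) ≫
      actMap (fn W' (h'.trans h)) (Functor.LaxMonoidal.ε (𝒢.res h'))) ▷ tr x h' h ≫ cell h' h _ =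
        (λ_ _).hom ≫ (ρ_ _).inv ≫ tr x h' h ◁ actUnit (fn W h)
  cell_mul {W' W : Opens X} (h' : W' ≤ W) (h : W ≤ P.base x) (γ δ : 𝒢.fib W) :
    (actMul (fn W' (h'.trans h)) _ _ ≫
      actMap (fn W' (h'.trans h)) (Functor.LaxMonoidal.μ (𝒢.res h') γ δ)) ▷ tr x h' h ≫
        cell h' h _ =
      (α_ _ _ _).hom ≫ _ ◁ cell h' h γ ≫ (α_ _ _ _).inv ≫ cell h' h δ ▷ _ ≫ (α_ _ _ _).hom ≫
        tr x h' h ◁ actMul (fn W h) γ δ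
  cell_comp {W'' W' W : Opens X} (h'' : W'' ≤ W') (h' : W' ≤ W) (h : W ≤ P.base x)
      (γ : 𝒢.fib W) :
    actMap (fn W'' ((h''.trans h').trans h)) (𝒢.rc h' h'' γ).hom ▷ _ ≫ cell (h''.trans h') h γ =
      _ ◁ inv (trComp x h'' h' h) ≫ (α_ _ _ _).inv ≫ cell h'' (h'.trans h) _ ▷ _ ≫
        (α_ _ _ _).hom ≫ _ ◁ cell h' h γ ≫ (α_ _ _ _).inv ≫ trComp x h'' h' h ▷ _

namespace EndTriv

variable {𝒢 : GrStack.{v, u} X} {P : FibredTwoGroupoid.{w, w₁, v₁, u₁} X} {x y : P.Ob}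
  (T : EndTriv 𝒢 P x)

instance (W : Opens X) (h : W ≤ P.base x) : (T.fn W h).Monoidal := T.monoidal W h

instance (W : Opens X) (h : W ≤ P.base x) : (T.fn W h).IsEquivalence := T.isEquivalence W h

/-- The self-path of `x|_W` attached to an object of `𝒢_W`. -/
def obj {W : Opens X} (h : W ≤ P.base x) (γ : 𝒢.fib W) : P.restr x W h ⟶ P.restr x W h :=
  actObj (T.fn W h) γ

/-- The two-arrow attached to an arrow of `𝒢_W`. -/
def map {W : Opens X} (h : W ≤ P.base x) {γ δ : 𝒢.fib W} (f : γ ⟶ δ) : T.obj h γ ⟶ T.obj h δ :=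
  actMap (T.fn W h) f

/-- The unit constraint. -/
def unit {W : Opens X} (h : W ≤ P.base x) : 𝟙 (P.restr x W h) ⟶ T.obj h (𝒢.one W) :=
  actUnit (T.fn W h)

/-- The tensor constraint. -/
def mul {W : Opens X} (h : W ≤ P.base x) (γ δ : 𝒢.fib W) :
    T.obj h δ ≫ T.obj h γ ⟶ T.obj h (𝒢.mul γ δ) :=
  actMul (T.fn W h) γ δ

/-- Compatibility with restrictions. -/
def resCell {W' W : Opens X} (h' : W' ≤ W) (h : W ≤ P.base x) (γ : 𝒢.fib W) :
    T.obj (h'.trans h) ((𝒢.res h').obj γ) ≫ tr x h' h ⟶ tr x h' h ≫ T.obj h γ :=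
  T.cell h' h γ

end EndTriv

end EndTriv

section Triv

open Bicategory FibredTwoGroupoid

variable {X : Type w} [TopologicalSpace X] {𝒢 : GrStack.{v, u} X}
  {P : FibredTwoGroupoid.{w, w₁, v₁, u₁} X}

/-- Conjugation by a path `φ : y|_V ⟶ x|_V`: a self-equivalence `lam` of `𝒢` above `V`, together
with two-arrows `M γ : φ γ ⟹ lam(γ) φ` natural in `γ` and compatible with the monoidal structures
and with restrictions. -/
structure PathConj {x y : P.Ob} (Tx : EndTriv 𝒢 P x) (Ty : EndTriv 𝒢 P y) {V : Opens X}
    {hy : V ≤ P.base y} {hx : V ≤ P.base x} (φ : P.restr y V hy ⟶ P.restr x V hx) where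
  lam : SelfEq 𝒢 V
  M {W : Opens X} (h : W ≤ V) (γ : 𝒢.fib W) :
    Ty.obj (h.trans hy) γ ≫ resPath φ h ⟶
      resPath φ h ≫ Tx.obj (h.trans hx) ((lam.fn W h).obj γ)
  M_naturality {W : Opens X} (h : W ≤ V) {γ δ : 𝒢.fib W} (f : γ ⟶ δ) :
    Ty.map (h.trans hy) f ▷ resPath φ h ≫ M h δ =
      M h γ ≫ resPath φ h ◁ Tx.map (h.trans hx) ((lam.fn W h).map f)
  M_unit {W : Opens X} (h : W ≤ V) :
    Ty.unit (h.trans hy) ▷ resPath φ h ≫ M h (𝒢.one W) =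
      (λ_ _).hom ≫ (ρ_ _).inv ≫ resPath φ h ◁ (Tx.unit (h.trans hx) ≫
        Tx.map (h.trans hx) (Functor.LaxMonoidal.ε (lam.fn W h)))
  M_mul {W : Opens X} (h : W ≤ V) (γ δ : 𝒢.fib W) :
    Ty.mul (h.trans hy) γ δ ▷ resPath φ h ≫ M h (𝒢.mul γ δ) =
      (α_ _ _ _).hom ≫ _ ◁ M h γ ≫ (α_ _ _ _).inv ≫ M h δ ▷ _ ≫ (α_ _ _ _).hom ≫
        resPath φ h ◁ (Tx.mul (h.trans hx) _ _ ≫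
          Tx.map (h.trans hx) (Functor.LaxMonoidal.μ (lam.fn W h) γ δ))
  M_res {W' W : Opens X} (h' : W' ≤ W) (h : W ≤ V) (γ : 𝒢.fib W) :
    M (h'.trans h) ((𝒢.res h').obj γ) ▷ tr x h' (h.trans hx) ≫ (α_ _ _ _).hom ≫
      _ ◁ (Tx.map _ (lam.nt h' h γ).hom ▷ _ ≫ Tx.resCell h' (h.trans hx) _) ≫ (α_ _ _ _).inv ≫
        resPathTr φ h' h ▷ _ =
    (α_ _ _ _).hom ≫ _ ◁ resPathTr φ h' h ≫ (α_ _ _ _).inv ≫ Ty.resCell h' (h.trans hy) γ ▷ _ ≫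
      (α_ _ _ _).hom ≫ _ ◁ M h γ ≫ (α_ _ _ _).inv

/-- A local trivialization of `P`, with values in `𝒢`: objects `x i` of `P` over open sets `U i`
covering `X`, equivalences of the restriction of `𝒢` to `U i` with the gr-stack of self-paths of
`x i`, and paths `φ i j` from `x j` to `x i` above `U i ∩ U j`. -/
structure LocalTriv (𝒢 : GrStack.{v, u} X) (P : FibredTwoGroupoid.{w, w₁, v₁, u₁} X)
    (I : Type t) where
  x : I → P.Ob
  cover : ⨆ i, P.base (x i) = ⊤
  T (i : I) : EndTriv 𝒢 P (x i)
  φ (i j : I) : P.restr (x j) (P.base (x i) ⊓ P.base (x j)) inf_le_right ⟶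
    P.restr (x i) (P.base (x i) ⊓ P.base (x j)) inf_le_left

namespace LocalTriv

variable {I : Type t} (L : LocalTriv 𝒢 P I)

/-- The members of the open covering. -/
abbrev U (i : I) : Opens X := P.base (L.x i)

/-- The path `φ i j` above an open subset `W` of `U i ∩ U j`. -/
noncomputable def path {W : Opens X} {i j : I} (hi : W ≤ L.U i) (hj : W ≤ L.U j) :
    P.restr (L.x j) W hj ⟶ P.restr (L.x i) W hi :=
  resPath (L.φ i j) (le_inf hi hj)

/-- The self-path of `x i` above `W ⊆ U i` attached to an object of `𝒢_W`. -/
def obj {W : Opens X} {i : I} (hi : W ≤ L.U i) (γ : 𝒢.fib W) :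
    P.restr (L.x i) W hi ⟶ P.restr (L.x i) W hi := (L.T i).obj hi γ

/-- The two-arrow attached to an arrow of `𝒢_W`. -/
def map {W : Opens X} {i : I} (hi : W ≤ L.U i) {γ δ : 𝒢.fib W} (f : γ ⟶ δ) :
    L.obj hi γ ⟶ L.obj hi δ := (L.T i).map hi f

/-- The self-path attached to a product is the composite of self-paths. -/
def mul {W : Opens X} {i : I} (hi : W ≤ L.U i) (γ δ : 𝒢.fib W) :
    L.obj hi δ ≫ L.obj hi γ ⟶ L.obj hi (𝒢.mul γ δ) := (L.T i).mul hi γ δ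

end LocalTriv

end Triv

section Cocycles

open MonoidalCategory

variable {X : Type w} [TopologicalSpace X]

/-- The two families of objects underlying a quadruple: `lam i j` is an object of `𝓔q(𝒢)` above
`U i ∩ U j` and `g i j k` is an object of `𝒢` above `U i ∩ U j ∩ U k`. -/
structure ObjectFamilies (𝒢 : GrStack.{v, u} X) {I : Type t} (U : I → Opens X) where
  lam (i j : I) : SelfEq 𝒢 (U i ⊓ U j)
  g (i j k : I) : 𝒢.fib (U i ⊓ U j ⊓ U k)

namespace ObjectFamilies

variable {𝒢 : GrStack.{v, u} X} {I : Type t} {U : I → Opens X} (A : ObjectFamilies 𝒢 U)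

section

variable {W W' : Opens X} {i j k l : I}

/-- The self-equivalence `lam i j` of `𝒢_W`, for `W ⊆ U i ∩ U j`. -/
abbrev lamAt (hi : W ≤ U i) (hj : W ≤ U j) : 𝒢.fib W ⥤ 𝒢.fib W := (A.lam i j).fn W (le_inf hi hj)

/-- The restriction of `g i j k` to `W ⊆ U i ∩ U j ∩ U k`. -/
abbrev gAt (hi : W ≤ U i) (hj : W ≤ U j) (hk : W ≤ U k) : 𝒢.fib W :=
  (𝒢.res (le_inf (le_inf hi hj) hk)).obj (A.g i j k)

/-- The isomorphism between the two ways of restricting `g i j k` in two steps or in one step. -/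
abbrev gRes (h : W' ≤ W) (hi : W ≤ U i) (hj : W ≤ U j) (hk : W ≤ U k) :
    (𝒢.res h).obj (A.gAt hi hj hk) ≅ A.gAt (h.trans hi) (h.trans hj) (h.trans hk) :=
  𝒢.rc (le_inf (le_inf hi hj) hk) h (A.g i j k)

/-- The source `λ_ij(g_jkl) g_ijl` of `ν_ijkl`. -/
abbrev nuSrc (hi : W ≤ U i) (hj : W ≤ U j) (hk : W ≤ U k) (hl : W ≤ U l) : 𝒢.fib W :=
  (A.lamAt hi hj).obj (A.gAt hj hk hl) ⊗ A.gAt hi hj hl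

/-- The target `g_ijk g_ikl` of `ν_ijkl`. -/
abbrev nuTgt (hi : W ≤ U i) (hj : W ≤ U j) (hk : W ≤ U k) (hl : W ≤ U l) : 𝒢.fib W :=
  A.gAt hi hj hk ⊗ A.gAt hi hk hl

/-- Compatibility of `nuSrc` with restrictions. -/
def nuSrcRes (h : W' ≤ W) (hi : W ≤ U i) (hj : W ≤ U j) (hk : W ≤ U k) (hl : W ≤ U l) :
    (𝒢.res h).obj (A.nuSrc hi hj hk hl) ≅
      A.nuSrc (h.trans hi) (h.trans hj) (h.trans hk) (h.trans hl) :=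
  (Functor.Monoidal.μIso (𝒢.res h) _ _).symm ≪≫
    (((A.lam i j).nt h (le_inf hi hj) (A.gAt hj hk hl)).symm ≪≫
      (A.lamAt (h.trans hi) (h.trans hj)).mapIso (A.gRes h hj hk hl) ⊗ᵢ A.gRes h hi hj hl)

/-- Compatibility of `nuTgt` with restrictions. -/
def nuTgtRes (h : W' ≤ W) (hi : W ≤ U i) (hj : W ≤ U j) (hk : W ≤ U k) (hl : W ≤ U l) :
    (𝒢.res h).obj (A.nuTgt hi hj hk hl) ≅
      A.nuTgt (h.trans hi) (h.trans hj) (h.trans hk) (h.trans hl) :=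
  (Functor.Monoidal.μIso (𝒢.res h) _ _).symm ≪≫ (A.gRes h hi hj hk ⊗ᵢ A.gRes h hi hk hl)

end

/-- The open set `U i ∩ U j ∩ U k`. -/
abbrev U₃ (U : I → Opens X) (i j k : I) : Opens X := U i ⊓ U j ⊓ U k

/-- The open set `U i ∩ U j ∩ U k ∩ U l`. -/
abbrev U₄ (U : I → Opens X) (i j k l : I) : Opens X := U i ⊓ U j ⊓ U k ⊓ U l

lemma U₃_le {i j k : I} : U₃ U i j k ≤ U i ∧ U₃ U i j k ≤ U j ∧ U₃ U i j k ≤ U k :=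
  ⟨inf_le_left.trans inf_le_left, inf_le_left.trans inf_le_right, inf_le_right⟩

lemma U₄_le {i j k l : I} :
    U₄ U i j k l ≤ U i ∧ U₄ U i j k l ≤ U j ∧ U₄ U i j k l ≤ U k ∧ U₄ U i j k l ≤ U l :=
  ⟨inf_le_left.trans U₃_le.1, inf_le_left.trans U₃_le.2.1, inf_le_left.trans U₃_le.2.2,
    inf_le_right⟩

/-- The type of families `m̃_ijk : j(g_ijk) λ_ik ⟶ λ_ij λ_jk` of arrows of `𝓔q(𝒢)` above
`U i ∩ U j ∩ U k`. -/
noncomputable abbrev MtFamily : Type _ := ∀ i j k : I,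
  (SelfEq.j 𝒢 (U₃ U i j k)).obj (A.g i j k) ⊗
      (A.lam i k).restrict (le_inf U₃_le.1 U₃_le.2.2) ⟶
    (A.lam i j).restrict (le_inf U₃_le.1 U₃_le.2.1) ⊗
      (A.lam j k).restrict (le_inf U₃_le.2.1 U₃_le.2.2)

/-- The type of families `ν_ijkl : λ_ij(g_jkl) g_ijl ⟶ g_ijk g_ikl` of arrows of `𝒢` above
`U i ∩ U j ∩ U k ∩ U l`. -/
abbrev NuFamily : Type _ := ∀ i j k l : I,
  A.nuSrc (W := U₄ U i j k l) (i := i) (j := j) (k := k) (l := l) U₄_le.1 U₄_le.2.1 U₄_le.2.2.1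
      U₄_le.2.2.2 ⟶
    A.nuTgt U₄_le.1 U₄_le.2.1 U₄_le.2.2.1 U₄_le.2.2.2

variable {A}

section

variable {W : Opens X} {i j k l : I} (mt : A.MtFamily) (nu : A.NuFamily)

/-- The component of `m̃_ijk` at an object of `𝒢_W`. -/
noncomputable def mtAt (hi : W ≤ U i) (hj : W ≤ U j) (hk : W ≤ U k) (γ : 𝒢.fib W) :
    (conj (A.gAt hi hj hk)).obj ((A.lamAt hi hk).obj γ) ⟶
      (A.lamAt hi hj).obj ((A.lamAt hj hk).obj γ) :=
  SelfEq.ev (mt i j k) W (le_inf (le_inf hi hj) hk) γ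

/-- The restriction of `ν_ijkl` to `W ⊆ U i ∩ U j ∩ U k ∩ U l`. -/
def nuAt (hi : W ≤ U i) (hj : W ≤ U j) (hk : W ≤ U k) (hl : W ≤ U l) :
    A.nuSrc hi hj hk hl ⟶ A.nuTgt hi hj hk hl :=
  (A.nuSrcRes (le_inf (le_inf (le_inf hi hj) hk) hl) _ _ _ _).inv ≫
    (𝒢.res (le_inf (le_inf (le_inf hi hj) hk) hl)).map (nu i j k l) ≫
      (A.nuTgtRes (le_inf (le_inf (le_inf hi hj) hk) hl) _ _ _ _).hom

/-- The isomorphism `{m̃_ijk, γ} : g_ijk λ_ik(γ) ≅ λ_ij λ_jk(γ) g_ijk` determined by `m̃_ijk`: the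
canonical isomorphism `g_ijk λ_ik(γ) ≅ j(g_ijk)(λ_ik(γ)) g_ijk` followed by `m̃_ijk`. -/
noncomputable def brace (hi : W ≤ U i) (hj : W ≤ U j) (hk : W ≤ U k) (γ : 𝒢.fib W) :
    A.gAt hi hj hk ⊗ (A.lamAt hi hk).obj γ ≅
      (A.lamAt hi hj).obj ((A.lamAt hj hk).obj γ) ⊗ A.gAt hi hj hk :=
  (conjIso _ _).symm ≪≫ whiskerRightIso (asIso (mtAt mt hi hj hk γ)) (A.gAt hi hj hk)

/-- The equation `m̃_ijk ∘ (g_ijk ∗ m̃_ikl) ∘ j(ν_ijkl) = (λ_ij ∗ m̃_jkl) ∘ (λ_ij(g_jkl) ∗ m̃_ijl)`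
between arrows `j(λ_ij(g_jkl) g_ijl) λ_il ⟶ λ_ij λ_jk λ_kl` of `𝓔q(𝒢)`, at an object of `𝒢_W`. -/
def FirstEquationAt (hi : W ≤ U i) (hj : W ≤ U j) (hk : W ≤ U k) (hl : W ≤ U l)
    (γ : 𝒢.fib W) : Prop :=
  (conjMap (nuAt nu hi hj hk hl)).app ((A.lamAt hi hl).obj γ) ≫
      (conjTensor (A.gAt hi hj hk) (A.gAt hi hk hl) ((A.lamAt hi hl).obj γ)).inv ≫
        (conj (A.gAt hi hj hk)).map (mtAt mt hi hk hl γ) ≫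
          mtAt mt hi hj hk ((A.lamAt hk hl).obj γ) =
    (conjTensor ((A.lamAt hi hj).obj (A.gAt hj hk hl)) (A.gAt hi hj hl)
        ((A.lamAt hi hl).obj γ)).inv ≫
      (conj ((A.lamAt hi hj).obj (A.gAt hj hk hl))).map (mtAt mt hi hj hl γ) ≫
        (conjCompareApp (A.lamAt hi hj) (Iso.refl _) ((A.lamAt hj hl).obj γ)).hom ≫
          (A.lamAt hi hj).map (mtAt mt hj hk hl γ)

/-- The equation
`ν_ijkl ∘ (λ_ij(g_jkl) ∗ ν_ijlm) ∘ λ_ij(ν_jklm) =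
  (g_ijk ∗ ν_iklm) ∘ {m̃_ijk, g_klm}⁻¹ ∘ (λ_ij λ_jk(g_klm) ∗ ν_ijkm)`
between arrows `(λ_ij λ_jk(g_klm) λ_ij(g_jkm)) g_ijm ⟶ (g_ijk g_ikl) g_ilm` of `𝒢_W`. -/
def SecondEquationAt {m : I} (hi : W ≤ U i) (hj : W ≤ U j) (hk : W ≤ U k) (hl : W ≤ U l)
    (hm : W ≤ U m) : Prop :=
  (Functor.LaxMonoidal.μ (A.lamAt hi hj) ((A.lamAt hj hk).obj (A.gAt hk hl hm))
          (A.gAt hj hk hm) ≫ (A.lamAt hi hj).map (nuAt nu hj hk hl hm) ≫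
        Functor.OplaxMonoidal.δ (A.lamAt hi hj) _ _) ▷ A.gAt hi hj hm ≫
      (α_ _ _ _).hom ≫ (A.lamAt hi hj).obj (A.gAt hj hk hl) ◁ nuAt nu hi hj hl hm ≫
        (α_ _ _ _).inv ≫ nuAt nu hi hj hk hl ▷ A.gAt hi hl hm =
    (α_ _ _ _).hom ≫
      (A.lamAt hi hj).obj ((A.lamAt hj hk).obj (A.gAt hk hl hm)) ◁ nuAt nu hi hj hk hm ≫
        (α_ _ _ _).inv ≫ (brace mt hi hj hk (A.gAt hk hl hm)).inv ▷ A.gAt hi hk hm ≫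
          (α_ _ _ _).hom ≫ A.gAt hi hj hk ◁ nuAt nu hi hk hl hm ≫ (α_ _ _ _).inv

end

end ObjectFamilies

/-- A family of quadruples `(λ_ij, m̃_ijk, g_ijk, ν_ijkl)`. -/
structure Quadruple (𝒢 : GrStack.{v, u} X) {I : Type t} (U : I → Opens X) where
  obj : ObjectFamilies 𝒢 U
  mt : obj.MtFamily
  nu : obj.NuFamily

namespace Quadruple

variable {𝒢 : GrStack.{v, u} X} {I : Type t} {U : I → Opens X}

/-- A `𝒢`-valued Čech 1-cocycle quadruple. -/
structure IsCocycle (Q : Quadruple 𝒢 U) : Prop where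
  first {W : Opens X} {i j k l : I} (hi : W ≤ U i) (hj : W ≤ U j) (hk : W ≤ U k) (hl : W ≤ U l)
    (γ : 𝒢.fib W) : ObjectFamilies.FirstEquationAt Q.mt Q.nu hi hj hk hl γ
  second {W : Opens X} {i j k l m : I} (hi : W ≤ U i) (hj : W ≤ U j) (hk : W ≤ U k)
    (hl : W ≤ U l) (hm : W ≤ U m) : ObjectFamilies.SecondEquationAt Q.mt Q.nu hi hj hk hl hm

end Quadruple

/-- The objects of `Ar_I C`: the arrows of the monoidal category `C` with source the unit object.
The target map is `Under.right`. -/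
abbrev ArI (C : Type*) [Category C] [MonoidalCategory C] : Type _ := Under (𝟙_ C)

/-- For an arrow `a : Y ⟶ Z` of a group-like monoidal category, `b` is an arrow
`a Y⁻¹ : I ⟶ Z Y⁻¹`, where `Y⁻¹` is an inverse of `Y`. -/
def IsNormalization {C : Type*} [Category C] [MonoidalCategory C] {Y Z : C} (a : Y ⟶ Z)
    (b : ArI C) : Prop :=
  ∃ (Y' : C) (e : Y ⊗ Y' ≅ 𝟙_ C), b = Under.mk (e.inv ≫ a ▷ Y')

/-- A quadruple with values in the weak crossed square with vertical arrows the target maps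
`Ar_I 𝒢 ⟶ Ob 𝒢` and `Ar_I 𝓔q(𝒢) ⟶ Ob 𝓔q(𝒢)` and horizontal arrows given by inner conjugation. -/
structure SquareQuadruple (𝒢 : GrStack.{v, u} X) {I : Type t} (U : I → Opens X) where
  obj : ObjectFamilies 𝒢 U
  mt (i j k : I) : ArI (SelfEq 𝒢 (ObjectFamilies.U₃ U i j k))
  nu (i j k l : I) : ArI (𝒢.fib (ObjectFamilies.U₄ U i j k l))

namespace SquareQuadruple

variable {𝒢 : GrStack.{v, u} X} {I : Type t} {U : I → Opens X}

/-- `N` is obtained from the quadruple `Q` by replacing each arrow `a : Y ⟶ Z` among the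
`m̃_ijk` and the `ν_ijkl` by an arrow `a Y⁻¹ : I ⟶ Z Y⁻¹`. -/
structure IsNormalizationOf (N : SquareQuadruple 𝒢 U) (Q : Quadruple 𝒢 U) : Prop where
  obj_eq : N.obj = Q.obj
  mt (i j k : I) : IsNormalization (Q.mt i j k) (N.mt i j k)
  nu (i j k l : I) : IsNormalization (Q.nu i j k l) (N.nu i j k l)

/-- A Čech 1-cocycle with values in the weak crossed square: a quadruple obtained in this way from
a `𝒢`-valued Čech 1-cocycle quadruple. -/
def IsCocycle (N : SquareQuadruple 𝒢 U) : Prop :=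
  ∃ Q : Quadruple 𝒢 U, Q.IsCocycle ∧ N.IsNormalizationOf Q

end SquareQuadruple

end Cocycles

section Transition

open Bicategory FibredTwoGroupoid ObjectFamilies

variable {X : Type w} [TopologicalSpace X] {𝒢 : GrStack.{v, u} X}
  {P : FibredTwoGroupoid.{w, w₁, v₁, u₁} X} {I : Type t}

namespace LocalTriv

/-- Compatibility of the paths with restrictions. -/
noncomputable def pathTr (L : LocalTriv 𝒢 P I) {V W : Opens X} (h : W ≤ V) {i j : I}
    (hi : V ≤ L.U i) (hj : V ≤ L.U j) :
    L.path (h.trans hi) (h.trans hj) ≫ tr (L.x i) h hi ⟶ tr (L.x j) h hj ≫ L.path hi hj :=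
  resPathTr (L.φ i j) h (le_inf hi hj)

end LocalTriv

/-- The auxiliary choices in the construction of a quadruple: for each `i, j`, a self-equivalence
`λ_ij` of `𝒢` above `U i ∩ U j` with two-arrows `M_ij(γ) : φ_ij γ ⟹ λ_ij(γ) φ_ij`, and for
each `i, j, k` an object `g_ijk` of `𝒢` above `U i ∩ U j ∩ U k` with a two-arrow
`m_ijk : g_ijk φ_ik ⟹ φ_ij φ_jk`. -/
structure TransitionData (L : LocalTriv 𝒢 P I) where
  pathConj (i j : I) : PathConj (L.T i) (L.T j) (L.φ i j)
  g (i j k : I) : 𝒢.fib (U₃ L.U i j k)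
  m (i j k : I) : L.path (W := U₃ L.U i j k) (i := i) (j := k) U₃_le.1 U₃_le.2.2 ≫
      L.obj U₃_le.1 (g i j k) ⟶
    L.path (j := k) (i := j) U₃_le.2.1 U₃_le.2.2 ≫ L.path (i := i) U₃_le.1 U₃_le.2.1

namespace TransitionData

variable {L : LocalTriv 𝒢 P I} (D : TransitionData L)

/-- The objects `λ_ij` and `g_ijk`. -/
def families : ObjectFamilies 𝒢 L.U where
  lam i j := (D.pathConj i j).lam
  g := D.g

variable {W : Opens X} {i j k l : I}

/-- The two-arrow `M_ij(γ) : φ_ij γ ⟹ λ_ij(γ) φ_ij` above `W`. -/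
def MAt (hi : W ≤ L.U i) (hj : W ≤ L.U j) (γ : 𝒢.fib W) :
    L.obj hj γ ≫ L.path hi hj ⟶ L.path hi hj ≫ L.obj hi ((D.families.lamAt hi hj).obj γ) :=
  (D.pathConj i j).M (le_inf hi hj) γ

/-- The restriction of the two-arrow `m_ijk : g_ijk φ_ik ⟹ φ_ij φ_jk` to `W`. -/
noncomputable def mAt (hi : W ≤ L.U i) (hj : W ≤ L.U j) (hk : W ≤ L.U k) :
    L.path hi hk ≫ L.obj hi (D.families.gAt hi hj hk) ⟶ L.path hj hk ≫ L.path hi hj :=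
  have h : W ≤ U₃ L.U i j k := le_inf (le_inf hi hj) hk
  cancel (tr (L.x i) h U₃_le.1)
    ((α_ _ _ _).hom ≫ _ ◁ (L.T i).resCell h U₃_le.1 (D.g i j k) ≫ (α_ _ _ _).inv ≫
      L.pathTr h U₃_le.1 U₃_le.2.2 ▷ _ ≫ (α_ _ _ _).hom ≫ _ ◁ D.m i j k ≫ (α_ _ _ _).inv ≫
      inv (L.pathTr h U₃_le.2.1 U₃_le.2.2) ▷ _ ≫ (α_ _ _ _).hom ≫
      _ ◁ inv (L.pathTr h U₃_le.1 U₃_le.2.1) ≫ (α_ _ _ _).inv)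

/-- The families `m̃` and `ν` are those determined by the two-arrows `M` and `m`:
the arrow `m̃_ijk` is conjugation by the two-arrow `m_ijk`, which means that `{m̃_ijk, γ}` fills
the lower face of the commutative cube with the other faces `M_ik(γ)`, `M_jk(γ)`,
`M_ij(λ_jk(γ))` and `m_ijk` (twice), and `ν_ijkl` fills the remaining face of the commutative
cube with the other faces `m_ijk`, `m_ikl`, `m_ijl`, `m_jkl` and `M_ij(g_jkl)`. -/
structure Induces (mt : D.families.MtFamily) (nu : D.families.NuFamily) : Prop where
  mt_cube {W : Opens X} {i j k : I} (hi : W ≤ L.U i) (hj : W ≤ L.U j) (hk : W ≤ L.U k)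
    (γ : 𝒢.fib W) :
    D.MAt hi hk γ ▷ L.obj hi (D.families.gAt hi hj hk) ≫ (α_ _ _ _).hom ≫
        L.path hi hk ◁ (L.mul hi _ _ ≫ L.map hi (brace mt hi hj hk γ).hom ≫ inv (L.mul hi _ _)) ≫
          (α_ _ _ _).inv ≫ D.mAt hi hj hk ▷ _ =
      (α_ _ _ _).hom ≫ L.obj hk γ ◁ D.mAt hi hj hk ≫ (α_ _ _ _).inv ≫
        D.MAt hj hk γ ▷ L.path hi hj ≫ (α_ _ _ _).hom ≫
          L.path hj hk ◁ D.MAt hi hj ((D.families.lamAt hj hk).obj γ) ≫ (α_ _ _ _).inv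
  nu_cube {W : Opens X} {i j k l : I} (hi : W ≤ L.U i) (hj : W ≤ L.U j) (hk : W ≤ L.U k)
    (hl : W ≤ L.U l) :
    L.path hi hl ◁ (L.mul hi _ _ ≫ L.map hi (nuAt nu hi hj hk hl) ≫ inv (L.mul hi _ _)) ≫
        (α_ _ _ _).inv ≫ D.mAt hi hk hl ▷ L.obj hi (D.families.gAt hi hj hk) ≫ (α_ _ _ _).hom ≫
          L.path hk hl ◁ D.mAt hi hj hk =
      (α_ _ _ _).inv ≫ D.mAt hi hj hl ▷ _ ≫ (α_ _ _ _).hom ≫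
        L.path hj hl ◁ inv (D.MAt hi hj (D.families.gAt hj hk hl)) ≫ (α_ _ _ _).inv ≫
          D.mAt hj hk hl ▷ L.path hi hj ≫ (α_ _ _ _).hom

end TransitionData

end Transition

end Breen

set_option linter.unusedSimpArgs false

/-! ### Left actions of monoidal categories -/

namespace Breen

open CategoryTheory TopologicalSpace Opposite MonoidalCategory

/-! Fix an open set `W` and an object `z` of `P`. Composition with self-paths gives a left action of
`𝒢_W` on each category `Hom(z, x_i|_W)`, and composition with `φ_ij` gives a functor `Φ_ij` from
`Hom(z, x_j|_W)` to `Hom(z, x_i|_W)`. The two-arrows `M_ij` say that `Φ_ij` is semilinear along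
`λ_ij`, and `m_ijk` compares `g_ijk • Φ_ik` with `Φ_ij Φ_jk`. This is what a `TransitionSystem`
records. The associators of the bicategory are absorbed once and for all in its structure, so that
diagrams of two-arrows become diagrams in ordinary categories.

The decisive fact is that these categories are torsors. Every arrow of `P` is cartesian, so an arrow
`k : z ⟶ x_i|_W` with `W ≤ base z` is an equivalence, and `γ ↦ γ • k` is an equivalence from `𝒢_W`
to `Hom(z, x_i|_W)` (`EndTriv.orbit_isEquivalence`). Essential surjectivity provides `g_ijk`. A
quasi-inverse of this functor at `k = φ_ij` provides `λ_ij`. Fullness fills the missing face of a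
cube by an arrow of `𝒢_W`, and faithfulness makes that arrow unique. Faithfulness also allows every
identity between arrows of `𝒢_W` to be checked after acting on a single `k`, for instance on an
identity path.

The arrows `m̃_ijk` and `ν_ijkl` are therefore defined as solutions of their cubes. That `m̃_ijk` is
natural and monoidal follows by pasting its cubes with the corresponding properties of `M`
(`mt_naturality`, `mt_unit`, `mt_tensor`). Each cocycle equation compares two pastings of cubes with
the same boundary. The core of the first is `associativity_brace` (four braces, and the cube of `ν`
at two objects), and that of the second is `associativity_nu` (five cubes of `ν` and one brace).
What remains is to translate from the action back to `𝒢`, by `firstEquation` and `secondEquation`.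

Restriction from `W` to `W' ⊆ W` is handled by the same principle. Composition with the cartesian
arrow `x_i|_{W'} ⟶ x_i|_W` relates the two transition systems, and it is faithful when `base z ≤
W'`. So the cubes over `W` determine those over `W'` (`Restriction.mt_res`, `Restriction.nu_res`),
which makes `m̃` an arrow of `𝓔q(𝒢)` and gives the cube of every restriction of `ν`.

The existence of `λ_ij` as an object of `𝓔q(𝒢)` is a further instance. Its monoidal structure and
its compatibility with restrictions are solutions of equations in torsors, and their coherence
follows from faithfulness (`SemilinearMap.coreMonoidal`, `SemilinearMap.Square`). Finally,
normalizing an arrow `Y ⟶ Z` only requires an inverse of `Y`. In `𝒢` this is part of being a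
gr-category, and in `𝓔q(𝒢)` it is built from quasi-inverses of the component functors
(`SelfEq.compInverse`). -/

/-- A left action of a monoidal category `C` on a category `H`. -/
structure LeftAction (C H : Type*) [Category C] [MonoidalCategory C] [Category H] where
  act : C ⥤ H ⥤ H
  mul (γ δ : C) (h : H) : (act.obj γ).obj ((act.obj δ).obj h) ≅ (act.obj (γ ⊗ δ)).obj h
  unit (h : H) : h ≅ (act.obj (𝟙_ C)).obj h
  mul_left {γ γ' : C} (f : γ ⟶ γ') (δ : C) (h : H) :
    (act.map f).app _ ≫ (mul γ' δ h).hom = (mul γ δ h).hom ≫ (act.map (f ▷ δ)).app h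
  mul_right (γ : C) {δ δ' : C} (f : δ ⟶ δ') (h : H) :
    (act.obj γ).map ((act.map f).app h) ≫ (mul γ δ' h).hom =
      (mul γ δ h).hom ≫ (act.map (γ ◁ f)).app h
  mul_nat (γ δ : C) {h h' : H} (u : h ⟶ h') :
    (act.obj γ).map ((act.obj δ).map u) ≫ (mul γ δ h').hom =
      (mul γ δ h).hom ≫ (act.obj (γ ⊗ δ)).map u
  unit_nat {h h' : H} (u : h ⟶ h') : u ≫ (unit h').hom = (unit h).hom ≫ (act.obj _).map u
  assoc (γ δ ε : C) (h : H) :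
    (mul γ δ _).hom ≫ (mul (γ ⊗ δ) ε h).hom ≫ (act.map (α_ γ δ ε).hom).app h =
      (act.obj γ).map (mul δ ε h).hom ≫ (mul γ (δ ⊗ ε) h).hom
  left_unit (γ : C) (h : H) :
    (unit _).hom ≫ (mul (𝟙_ C) γ h).hom ≫ (act.map (λ_ γ).hom).app h = 𝟙 _
  right_unit (γ : C) (h : H) :
    (act.obj γ).map (unit h).hom ≫ (mul γ (𝟙_ C) h).hom ≫ (act.map (ρ_ γ).hom).app h = 𝟙 _

namespace LeftAction

variable {C H : Type*} [Category C] [MonoidalCategory C] [Category H] (A : LeftAction C H)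

/-- The functor `h ↦ γ • h`. -/
abbrev o (γ : C) : H ⥤ H := A.act.obj γ

/-- The action of an arrow of `C`. -/
def m {γ δ : C} (f : γ ⟶ δ) (h : H) : (A.o γ).obj h ⟶ (A.o δ).obj h := (A.act.map f).app h

variable {A}

@[simp] lemma m_id (γ : C) (h : H) : A.m (𝟙 γ) h = 𝟙 _ := by simp [m]

@[simp] lemma m_comp {γ δ ε : C} (f : γ ⟶ δ) (f' : δ ⟶ ε) (h : H) :
    A.m (f ≫ f') h = A.m f h ≫ A.m f' h := by simp [m]

instance {γ δ : C} (f : γ ⟶ δ) [IsIso f] (h : H) : IsIso (A.m f h) := by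
  unfold m; infer_instance

@[simp] lemma m_hom_inv {γ δ : C} (f : γ ≅ δ) (h : H) :
    A.m f.hom h ≫ A.m f.inv h = 𝟙 _ := by rw [← m_comp]; simp

lemma m_nat {γ δ : C} (f : γ ⟶ δ) {h h' : H} (u : h ⟶ h') :
    (A.o γ).map u ≫ A.m f h' = A.m f h ≫ (A.o δ).map u := (A.act.map f).naturality u

lemma m_whiskerRight {γ γ' : C} (f : γ ⟶ γ') (δ : C) (h : H) :
    A.m (f ▷ δ) h = (A.mul γ δ h).inv ≫ A.m f _ ≫ (A.mul γ' δ h).hom := by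
  rw [Iso.eq_inv_comp]; exact (A.mul_left f δ h).symm

lemma m_whiskerLeft (γ : C) {δ δ' : C} (f : δ ⟶ δ') (h : H) :
    A.m (γ ◁ f) h = (A.mul γ δ h).inv ≫ (A.o γ).map (A.m f h) ≫ (A.mul γ δ' h).hom := by
  rw [Iso.eq_inv_comp]; exact (A.mul_right γ f h).symm

lemma o_tensor_map (γ δ : C) {h h' : H} (u : h ⟶ h') :
    (A.o (γ ⊗ δ)).map u =
      (A.mul γ δ h).inv ≫ (A.o γ).map ((A.o δ).map u) ≫ (A.mul γ δ h').hom := by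
  rw [Iso.eq_inv_comp]; exact (A.mul_nat γ δ u).symm

lemma o_unit_map {h h' : H} (u : h ⟶ h') :
    (A.o (𝟙_ C)).map u = (A.unit h).inv ≫ u ≫ (A.unit h').hom := by
  rw [Iso.eq_inv_comp]; exact (A.unit_nat u).symm

lemma m_associator_hom (γ δ ε : C) (h : H) :
    A.m (α_ γ δ ε).hom h = (A.mul (γ ⊗ δ) ε h).inv ≫ (A.mul γ δ _).inv ≫
      (A.o γ).map (A.mul δ ε h).hom ≫ (A.mul γ (δ ⊗ ε) h).hom := by
  rw [Iso.eq_inv_comp, Iso.eq_inv_comp]; exact A.assoc γ δ ε h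

lemma m_associator_inv (γ δ ε : C) (h : H) :
    A.m (α_ γ δ ε).inv h = (A.mul γ (δ ⊗ ε) h).inv ≫ (A.o γ).map (A.mul δ ε h).inv ≫
      (A.mul γ δ _).hom ≫ (A.mul (γ ⊗ δ) ε h).hom := by
  have e := m_associator_hom (A := A) γ δ ε h
  rw [← cancel_epi (A.m (α_ γ δ ε).hom h), m_hom_inv, e]
  simp [← Functor.map_comp_assoc]

lemma m_leftUnitor_hom (γ : C) (h : H) :
    A.m (λ_ γ).hom h = (A.mul (𝟙_ C) γ h).inv ≫ (A.unit _).inv := by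
  rw [Iso.eq_inv_comp, ← cancel_epi (A.unit _).hom, Iso.hom_inv_id]
  exact A.left_unit γ h

lemma m_rightUnitor_hom (γ : C) (h : H) :
    A.m (ρ_ γ).hom h = (A.mul γ (𝟙_ C) h).inv ≫ (A.o γ).map (A.unit h).inv := by
  have : (A.o γ).map (A.unit h).hom ≫ (A.mul γ (𝟙_ C) h).hom ≫ A.m (ρ_ γ).hom h = 𝟙 _ :=
    A.right_unit γ h
  rw [Iso.eq_inv_comp, ← cancel_epi ((A.o γ).map (A.unit h).hom), this, ← Functor.map_comp]
  simp

lemma m_rightUnitor_inv (γ : C) (h : H) :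
    A.m (ρ_ γ).inv h = (A.o γ).map (A.unit h).hom ≫ (A.mul γ (𝟙_ C) h).hom := by
  have e := m_rightUnitor_hom (A := A) γ h
  rw [← cancel_epi (A.m (ρ_ γ).hom h), m_hom_inv, e]; simp [← Functor.map_comp_assoc]

@[simp] lemma map_mul_hom_inv_assoc {D : Type*} [Category D] (F : H ⥤ D) (γ δ : C) (h : H) {x : D}
    (u : F.obj ((A.o γ).obj ((A.o δ).obj h)) ⟶ x) :
    F.map (A.mul γ δ h).hom ≫ F.map (A.mul γ δ h).inv ≫ u = u := by
  simp [← Functor.map_comp_assoc]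

@[simp] lemma map_mul_inv_hom_assoc {D : Type*} [Category D] (F : H ⥤ D) (γ δ : C) (h : H) {x : D}
    (u : F.obj ((A.o (γ ⊗ δ)).obj h) ⟶ x) :
    F.map (A.mul γ δ h).inv ≫ F.map (A.mul γ δ h).hom ≫ u = u := by
  simp [← Functor.map_comp_assoc]

@[simp] lemma m_hom_inv_assoc {γ δ : C} (f : γ ≅ δ) (h : H) {x : H} (u : (A.o γ).obj h ⟶ x) :
    A.m f.hom h ≫ A.m f.inv h ≫ u = u := by
  rw [← Category.assoc, m_hom_inv, Category.id_comp]

/-- An arrow between products acts as an arrow between composites. -/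
def two {a b c d : C} (f : a ⊗ b ⟶ c ⊗ d) (h : H) :
    (A.o a).obj ((A.o b).obj h) ⟶ (A.o c).obj ((A.o d).obj h) :=
  (A.mul a b h).hom ≫ A.m f h ≫ (A.mul c d h).inv

lemma m_eq_two {a b c d : C} (f : a ⊗ b ⟶ c ⊗ d) (h : H) :
    A.m f h = (A.mul a b h).inv ≫ A.two f h ≫ (A.mul c d h).hom := by simp [two]

lemma two_comp {a b c d e k : C} (f : a ⊗ b ⟶ c ⊗ d) (f' : c ⊗ d ⟶ e ⊗ k) (h : H) :
    A.two (f ≫ f') h = A.two f h ≫ A.two f' h := by simp [two]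

@[simp] lemma two_id (a b : C) (h : H) : A.two (𝟙 (a ⊗ b)) h = 𝟙 _ := by simp [two]

@[simp] lemma two_hom_inv {a b c d : C} (f : a ⊗ b ≅ c ⊗ d) (h : H) :
    A.two f.hom h ≫ A.two f.inv h = 𝟙 _ := by rw [← two_comp]; simp

@[simp] lemma two_hom_inv_assoc {a b c d : C} (f : a ⊗ b ≅ c ⊗ d) (h : H) {x : H}
    (u : (A.o a).obj ((A.o b).obj h) ⟶ x) : A.two f.hom h ≫ A.two f.inv h ≫ u = u := by
  rw [← Category.assoc, two_hom_inv, Category.id_comp]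

instance {a b c d : C} (f : a ⊗ b ⟶ c ⊗ d) [IsIso f] (h : H) : IsIso (A.two f h) := by
  unfold two; infer_instance

lemma two_whiskerRight {a c : C} (f : a ⟶ c) (b : C) (h : H) :
    A.two (f ▷ b) h = A.m f _ := by simp [two, m_whiskerRight]

lemma two_whiskerLeft {b c : C} (a : C) (f : b ⟶ c) (h : H) :
    A.two (a ◁ f) h = (A.o a).map (A.m f h) := by simp [two, m_whiskerLeft]

lemma two_nat {a b c d : C} (f : a ⊗ b ⟶ c ⊗ d) {h h' : H} (u : h ⟶ h') :
    (A.o a).map ((A.o b).map u) ≫ A.two f h' =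
      A.two f h ≫ (A.o c).map ((A.o d).map u) := by
  have := A.m_nat f u
  rw [o_tensor_map, o_tensor_map] at this
  simp only [two, ← cancel_mono (A.mul c d h').hom, ← cancel_epi (A.mul a b h).inv] 
  simpa using this

variable (A) in
/-- The action of `C` on `h` is faithful. -/
def FaithfulAt (h : H) : Prop := ∀ ⦃γ δ : C⦄ (f f' : γ ⟶ δ), A.m f h = A.m f' h → f = f'

/-- Under the action, associators become composites of `mul` isomorphisms, and these cancel between
consecutive `two`s. What is left is an equation without associators, and faithfulness at one object
carries it back to `C`. -/
lemma tensor_eq_of_two_eq {h : H} (hf : A.FaithfulAt h) {a b c d e k l p q r s t : C}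
    {F₁ : a ⊗ b ⟶ c ⊗ d} {F₂ : d ⊗ e ⟶ k ⊗ l} {F₃ : c ⊗ k ⟶ p ⊗ q} {G₁ : b ⊗ e ⟶ r ⊗ s}
    {G₂ : a ⊗ r ⟶ p ⊗ t} {G₃ : t ⊗ s ⟶ q ⊗ l}
    (E : A.two F₁ _ ≫ (A.o c).map (A.two F₂ h) ≫ A.two F₃ _ =
      (A.o a).map (A.two G₁ h) ≫ A.two G₂ _ ≫ (A.o p).map (A.two G₃ h)) :
    F₁ ▷ e ≫ (α_ _ _ _).hom ≫ c ◁ F₂ ≫ (α_ _ _ _).inv ≫ F₃ ▷ l =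
      (α_ _ _ _).hom ≫ a ◁ G₁ ≫ (α_ _ _ _).inv ≫ G₂ ▷ s ≫ (α_ _ _ _).hom ≫ p ◁ G₃ ≫
        (α_ _ _ _).inv := by
  apply hf
  simp only [m_comp, m_whiskerRight, m_whiskerLeft, m_associator_hom, m_associator_inv,
    Category.assoc, Iso.hom_inv_id_assoc, map_mul_hom_inv_assoc, map_mul_inv_hom_assoc]
  simp only [m_eq_two, Functor.map_comp, Category.assoc, Iso.hom_inv_id_assoc,
    map_mul_hom_inv_assoc, map_mul_inv_hom_assoc]
  rw [reassoc_of% E]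

/-! ### Inner conjugation seen through an action -/

section Conj

variable [IsGrCategory C]

/-- The canonical arrow `(g γ g⁻¹) • g • h ⟶ g • γ • h`. -/
noncomputable def conjCell (A : LeftAction C H) (g γ : C) (h : H) :
    (A.o ((conj g).obj γ)).obj ((A.o g).obj h) ⟶ (A.o g).obj ((A.o γ).obj h) :=
  A.two (conjIso g γ).hom h

instance (g γ : C) (h : H) : IsIso (A.conjCell g γ h) := by
  unfold conjCell two m; infer_instance

lemma conjCell_map (g : C) {γ δ : C} (f : γ ⟶ δ) (h : H) :
    A.m ((conj g).map f) _ ≫ A.conjCell g δ h = A.conjCell g γ h ≫ (A.o g).map (A.m f h) := by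
  rw [conjCell, conjCell, ← two_whiskerRight, ← two_whiskerLeft, ← two_comp, ← two_comp,
    conjIso_naturality]

/-- The structure of `conj g` is defined by cancelling `g` on the right, so its characterizing
equations become usable after acting on an object `g • h`. Here this is done for `conjMap_spec`; the
neighbouring lemmas do it for the other constraints. -/
lemma conjCell_conjMap {g g' : C} (u : g ⟶ g') (γ : C) (h : H) :
    (A.o ((conj g).obj γ)).map (A.m u h) ≫ A.m ((conjMap u).app γ) _ ≫ A.conjCell g' γ h =
      A.conjCell g γ h ≫ A.m u _ := by
  rw [conjCell, conjCell, ← two_whiskerRight, ← two_whiskerLeft, ← two_whiskerRight, ← two_comp,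
    ← two_comp, ← two_comp, conjMap_spec]

lemma conjCell_ε (g : C) (h : H) :
    A.m (conjε g).hom _ ≫ A.conjCell g (𝟙_ C) h =
      (A.unit _).inv ≫ (A.o g).map (A.unit h).hom := by
  have := congrArg (fun f => A.m f h) (conjε_spec g)
  simp only [m_comp, m_whiskerRight, m_leftUnitor_hom, m_rightUnitor_inv] at this
  simp only [conjCell, two]
  rw [← cancel_epi (A.mul (𝟙_ C) g h).inv, ← cancel_mono (A.mul g (𝟙_ C) h).hom]
  simpa using this

lemma conjCell_μ (g γ δ : C) (h : H) :
    A.m (conjμ g γ δ).hom _ ≫ A.conjCell g (γ ⊗ δ) h =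
      (A.mul _ _ _).inv ≫ (A.o ((conj g).obj γ)).map (A.conjCell g δ h) ≫
        A.conjCell g γ _ ≫ (A.o g).map (A.mul γ δ h).hom := by
  have := congrArg (fun f => A.m f h) (conjμ_spec g γ δ)
  simp only [m_comp, m_whiskerRight, m_whiskerLeft, m_associator_hom, m_associator_inv,
    Functor.map_comp, o_tensor_map, Category.assoc, Iso.hom_inv_id_assoc, Iso.inv_hom_id_assoc,
    map_mul_hom_inv_assoc, map_mul_inv_hom_assoc] at this
  simp only [conjCell, two]
  rw [← cancel_epi (A.mul _ g h).inv, ← cancel_mono (A.mul g _ h).hom]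
  simpa using this

lemma conjCell_tensor (g k γ : C) (h : H) :
    (A.o _).map (A.mul g k h).hom ≫ A.m (conjTensor g k γ).hom _ ≫ A.conjCell (g ⊗ k) γ h =
      A.conjCell g _ _ ≫ (A.o g).map (A.conjCell k γ h) ≫ (A.mul g k _).hom := by
  have : (conjTensor g k γ).hom ▷ (g ⊗ k) ≫ (conjIso (g ⊗ k) γ).hom = (α_ _ _ _).inv ≫
      (conjIso g _).hom ▷ k ≫ (α_ _ _ _).hom ≫ g ◁ (conjIso k γ).hom ≫ (α_ _ _ _).inv := by
    rw [conjTensor, cancelIso_whiskerRight]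
    simp
  have := congrArg (fun f => A.m f h) this
  simp only [m_comp, m_whiskerRight, m_whiskerLeft, m_associator_hom, m_associator_inv,
    Functor.map_comp, o_tensor_map, Category.assoc, Iso.hom_inv_id_assoc, Iso.inv_hom_id_assoc,
    map_mul_hom_inv_assoc, map_mul_inv_hom_assoc] at this
  simp only [conjCell, two, Functor.map_comp, Category.assoc]
  rw [← cancel_mono (A.mul (g ⊗ k) γ h).hom,
    ← cancel_epi ((A.mul _ _ h).inv ≫ (A.o _).map (A.mul g k h).inv)]
  simpa using this

/-- Both sides of the first cocycle equation contain the inverse of `conjTensor` followed by a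
conjugate of an arrow `f`. Evaluated on `a • b • h`, this composite reduces to the factor `inv
(conjCell) ≫ f`, which is the brace when `f` is a component of `m̃`. -/
lemma conjTensor_map (A : LeftAction C H) (a b : C) {x y : C} (f : (conj b).obj x ⟶ y) (h : H) :
    A.m (conjTensor a b x).inv _ ≫ A.m ((conj a).map f) _ ≫ (A.o _).map (A.mul a b h).inv ≫
        A.conjCell a y _ =
      A.conjCell (a ⊗ b) x h ≫ (A.mul a b _).inv ≫
        (A.o a).map (inv (A.conjCell b x h) ≫ A.m f _) := by
  have e := conjCell_tensor (A := A) a b x h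
  rw [← cancel_epi (A.m (conjTensor a b x).hom _),
    ← cancel_epi ((A.o _).map (A.mul a b h).hom)]
  simp only [Functor.map_comp, reassoc_of% e, Functor.map_inv]
  rw [m_hom_inv_assoc, ← reassoc_of% m_nat, reassoc_of% map_mul_hom_inv_assoc,
    conjCell_map]
  simp

end Conj

end LeftAction

end Breen

/-! ### Transition systems and the pasting of cubes -/

namespace Breen

open CategoryTheory TopologicalSpace Opposite MonoidalCategory

section

open Functor.LaxMonoidal Functor.OplaxMonoidal

universe a b

/-- The data of a family of `C`-categories `H i`, of semilinear functors `Φ i j : H j ⥤ H i`, and of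
objects `g i j k` of `C` comparing `Φ i k` with the composite of `Φ i j` and `Φ j k`. -/
structure TransitionSystem (C : Type u) [Category.{v} C] [MonoidalCategory C] {I : Type t}
    (H : I → Type a) [∀ i, Category.{b} (H i)] where
  A (i : I) : LeftAction C (H i)
  Φ (i j : I) : H j ⥤ H i
  lam (i j : I) : C ⥤ C
  lamMonoidal (i j : I) : (lam i j).Monoidal
  M (i j : I) (γ : C) (h : H j) :
    (Φ i j).obj (((A j).o γ).obj h) ≅ ((A i).o ((lam i j).obj γ)).obj ((Φ i j).obj h)
  M_map (i j : I) {γ δ : C} (f : γ ⟶ δ) (h : H j) :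
    (Φ i j).map ((A j).m f h) ≫ (M i j δ h).hom =
      (M i j γ h).hom ≫ (A i).m ((lam i j).map f) _
  M_nat (i j : I) (γ : C) {h h' : H j} (u : h ⟶ h') :
    (Φ i j).map (((A j).o γ).map u) ≫ (M i j γ h').hom =
      (M i j γ h).hom ≫ ((A i).o _).map ((Φ i j).map u)
  M_unit (i j : I) (h : H j) :
    (Φ i j).map ((A j).unit h).hom ≫ (M i j _ h).hom =
      ((A i).unit _).hom ≫ (A i).m (ε (lam i j)) _
  M_mul (i j : I) (γ δ : C) (h : H j) :
    (Φ i j).map ((A j).mul γ δ h).hom ≫ (M i j _ h).hom =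
      (M i j γ _).hom ≫ ((A i).o _).map (M i j δ h).hom ≫
        ((A i).mul _ _ _).hom ≫ (A i).m (μ (lam i j) γ δ) _
  g (i j k : I) : C
  n (i j k : I) (h : H k) :
    ((A i).o (g i j k)).obj ((Φ i k).obj h) ≅ (Φ i j).obj ((Φ j k).obj h)
  n_nat (i j k : I) {h h' : H k} (u : h ⟶ h') :
    ((A i).o (g i j k)).map ((Φ i k).map u) ≫ (n i j k h').hom =
      (n i j k h).hom ≫ (Φ i j).map ((Φ j k).map u)

namespace TransitionSystem

variable {C : Type u} [Category.{v} C] [MonoidalCategory C] {I : Type t} {H : I → Type a}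
  [∀ i, Category.{b} (H i)] (S : TransitionSystem C H)

instance (i j : I) : (S.lam i j).Monoidal := S.lamMonoidal i j

/-- The cube determining the action of `X : g_ijk λ_ik(γ) ⟶ λ_ij λ_jk(γ) g_ijk`. -/
def BraceCube (i j k : I) (γ : C) (X : S.g i j k ⊗ (S.lam i k).obj γ ⟶
    (S.lam i j).obj ((S.lam j k).obj γ) ⊗ S.g i j k) (h : H k) : Prop :=
  ((S.A i).o _).map (S.M i k γ h).hom ≫ (S.A i).two X _ ≫ ((S.A i).o _).map (S.n i j k h).hom =
    (S.n i j k _).hom ≫ (S.Φ i j).map (S.M j k γ h).hom ≫ (S.M i j _ _).hom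

/-- The cube determining the action of `Y : λ_ij(g_jkl) g_ijl ⟶ g_ijk g_ikl`. -/
def NuCube (i j k l : I) (Y : (S.lam i j).obj (S.g j k l) ⊗ S.g i j l ⟶ S.g i j k ⊗ S.g i k l)
    (h : H l) : Prop :=
  (S.A i).two Y _ ≫ ((S.A i).o _).map (S.n i k l h).hom ≫ (S.n i j k _).hom =
    ((S.A i).o _).map (S.n i j l h).hom ≫ (S.M i j _ _).inv ≫ (S.Φ i j).map (S.n j k l h).hom

variable {S}

/-- Applying `M_mul` to the source product and to the target product trades `Φ` of an action for the
action of `λ_ij(f)`, conjugated by the tensor constraints of `λ_ij`. This is how a cube with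
vertices `j, k, l` enters a computation over `i` after applying `Φ_ij`. -/
lemma M_two (i j : I) {a b c d : C} (f : a ⊗ b ⟶ c ⊗ d) (h : H j) :
    (S.Φ i j).map ((S.A j).two f h) ≫ (S.M i j c _).hom ≫ ((S.A i).o _).map (S.M i j d h).hom =
      (S.M i j a _).hom ≫ ((S.A i).o _).map (S.M i j b h).hom ≫
        (S.A i).two (μ (S.lam i j) a b ≫ (S.lam i j).map f ≫ δ (S.lam i j) c d) _ := by
  have e := S.M_mul i j c d h
  have e' := S.M_mul i j a b h
  have n := S.M_map i j f h
  rw [LeftAction.m_eq_two, Functor.map_comp, Functor.map_comp, Category.assoc, Category.assoc, e]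
    at n
  simp only [LeftAction.two, LeftAction.m_comp]
  rw [← cancel_epi ((S.Φ i j).map ((S.A j).mul a b h).inv),
    ← cancel_mono ((S.A i).mul _ _ _).hom, ← cancel_mono ((S.A i).m (μ (S.lam i j) c d) _)]
  have k : (S.A i).m (δ (S.lam i j) c d) ((S.Φ i j).obj h) ≫ (S.A i).m (μ (S.lam i j) c d) _ =
      𝟙 _ := by
    rw [← LeftAction.m_comp, Functor.Monoidal.δ_μ, LeftAction.m_id]
  simp only [Category.assoc, Iso.inv_hom_id_assoc, k, Category.comp_id]
  simp only [LeftAction.two, Functor.map_comp, Category.assoc] at n ⊢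
  rw [n, ← reassoc_of% e', ← Functor.map_comp_assoc, Iso.inv_hom_id, CategoryTheory.Functor.map_id,
    Category.id_comp]

/-! ### The properties of `m̃` and the two cocycle equations -/

section Equations

variable [IsGrCategory C] {i j k l p : I}

/-- Two ways of carrying `γ` across the comparison of `Φ_il` with `Φ_ij Φ_jk Φ_kl`: the
decomposition `g_ijk g_ikl` gives one side, the decomposition `λ_ij(g_jkl) g_ijl` the other, and `Y`
links the two decompositions. All faces are invertible, so equality of the outer boundaries forces
equality of the remaining faces. -/
lemma associativity_brace {γ : C} {h : H l}
    {Y : (S.lam i j).obj (S.g j k l) ⊗ S.g i j l ⟶ S.g i j k ⊗ S.g i k l}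
    (hY : ∀ h, S.NuCube i j k l Y h)
    {Xijk : S.g i j k ⊗ (S.lam i k).obj ((S.lam k l).obj γ) ⟶
      (S.lam i j).obj ((S.lam j k).obj ((S.lam k l).obj γ)) ⊗ S.g i j k}
    (hijk : S.BraceCube i j k _ Xijk ((S.Φ k l).obj h))
    {Xikl} (hikl : S.BraceCube i k l γ Xikl h) {Xijl} (hijl : S.BraceCube i j l γ Xijl h)
    {Xjkl} (hjkl : S.BraceCube j k l γ Xjkl h) :
    (S.A i).two Y (((S.A i).o _).obj _) ≫ ((S.A i).o _).map ((S.A i).two Xikl _) ≫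
        (S.A i).two Xijk _ =
      ((S.A i).o _).map ((S.A i).two Xijl _) ≫
        (S.A i).two (μ (S.lam i j) _ _ ≫ (S.lam i j).map Xjkl ≫ δ (S.lam i j) _ _) _ ≫
        ((S.A i).o _).map ((S.A i).two Y ((S.Φ i l).obj h)) := by
  -- The cube of `Y` enters twice: at `γ • h` on the left-hand side of the equation and at `h` on
  -- the right-hand side.
  have hY1 := hY h
  have hY2 := hY (((S.A l).o γ).obj h)
  unfold NuCube BraceCube at *
  rw [← cancel_epi (((S.A i).o _).map (((S.A i).o _).map (S.M i l γ h).hom)),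
    ← cancel_mono (((S.A i).o _).map (((S.A i).o _).map (S.n i k l h).hom ≫ (S.n i j k _).hom))]
  have mt := M_two (S := S) i j Xjkl ((S.Φ j l).obj h)
  -- The common value of both pastings passes through the image under `Φ_ij` of the brace with
  -- indices `j, k, l`.
  trans ((S.A i).o _).map (S.n i j l _).hom ≫ (S.M i j _ _).inv ≫
    (S.Φ i j).map (((S.A j).o _).map (S.M j l γ h).hom) ≫ (S.Φ i j).map ((S.A j).two Xjkl _) ≫
    (S.M i j _ _).hom ≫ ((S.A i).o _).map ((S.Φ i j).map (S.n j k l h).hom)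
  · have e := congrArg (S.Φ i j).map hjkl
    have e' := congrArg ((S.A i).o (S.g i j k)).map hikl
    simp only [Functor.map_comp, Category.assoc] at e e' ⊢
    rw [← reassoc_of% LeftAction.two_nat, reassoc_of% LeftAction.two_nat, reassoc_of% e', hijk,
      reassoc_of% S.n_nat, reassoc_of% hY2, ← S.M_nat, reassoc_of% e]
  · have e := congrArg ((S.A i).o ((S.lam i j).obj (S.g j k l))).map hijl
    simp only [Functor.map_comp, Category.assoc] at e ⊢
    have hY1' := congrArg ((S.A i).o ((S.lam i j).obj ((S.lam j k).obj ((S.lam k l).obj γ)))).map hY1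
    simp only [Functor.map_comp, Category.assoc] at hY1'
    rw [hY1', ← reassoc_of% LeftAction.two_nat, reassoc_of% e]
    congr 1
    have n := S.M_nat i j (S.g j k l) (S.M j l γ h).hom
    have n' : (S.M i j _ _).inv ≫ (S.Φ i j).map (((S.A j).o (S.g j k l)).map (S.M j l γ h).hom) =
        ((S.A i).o _).map ((S.Φ i j).map (S.M j l γ h).hom) ≫ (S.M i j _ _).inv := by
      rw [Iso.inv_comp_eq, ← reassoc_of% n, Iso.hom_inv_id, Category.comp_id]
    have mt' : (S.Φ i j).map ((S.A j).two Xjkl ((S.Φ j l).obj h)) ≫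
        (S.M i j _ _).hom = (S.M i j _ _).hom ≫
        ((S.A i).o _).map (S.M i j _ _).hom ≫ (S.A i).two (μ (S.lam i j) _ _ ≫
        (S.lam i j).map Xjkl ≫ δ (S.lam i j) _ _) _ ≫ ((S.A i).o _).map (S.M i j _ _).inv := by
      rw [← reassoc_of% mt, ← Functor.map_comp, Iso.hom_inv_id]; simp
    rw [reassoc_of% n', reassoc_of% mt', Iso.inv_hom_id_assoc]

/-- The five cubes of `ν` belong to the five ways of omitting an index from `i, j, k, l, p`. The
omission of `i` appears inside `λ_ij`. The brace at `g_klp` is needed because on one side `g_klp`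
has to be moved across `g_ijk`. -/
lemma associativity_nu {h : H p}
    {Yijkl} (hijkl : S.NuCube i j k l Yijkl ((S.Φ l p).obj h))
    {Yijlp} (hijlp : S.NuCube i j l p Yijlp h)
    {Yjklp} (hjklp : S.NuCube j k l p Yjklp h)
    {Yijkp} (hijkp : S.NuCube i j k p Yijkp h)
    {Yiklp} (hiklp : S.NuCube i k l p Yiklp h)
    (X : S.g i j k ⊗ (S.lam i k).obj (S.g k l p) ≅
      (S.lam i j).obj ((S.lam j k).obj (S.g k l p)) ⊗ S.g i j k)
    (hX : S.BraceCube i j k _ X.hom ((S.Φ k p).obj h)) :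
    (S.A i).two (μ (S.lam i j) _ _ ≫ (S.lam i j).map Yjklp ≫ δ (S.lam i j) _ _) _ ≫
        ((S.A i).o _).map ((S.A i).two Yijlp _) ≫ (S.A i).two Yijkl _ =
      ((S.A i).o _).map ((S.A i).two Yijkp ((S.Φ i p).obj h)) ≫ (S.A i).two X.inv _ ≫
        ((S.A i).o _).map ((S.A i).two Yiklp _) := by
  have mt := M_two (S := S) i j Yjklp ((S.Φ j p).obj h)
  unfold NuCube BraceCube at *
  rw [← cancel_mono (((S.A i).o _).map (((S.A i).o _).map (S.n i l p h).hom) ≫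
    ((S.A i).o _).map (S.n i k l _).hom ≫ (S.n i j k _).hom)]
  -- Both sides, followed by `n_ilp`, `n_ikl` and `n_ijk`, equal the route that breaks `Φ_ip` up one
  -- index at a time, through `n_ijp`, `n_jkp` and `n_klp`.
  trans ((S.A i).o _).map (((S.A i).o _).map (S.n i j p h).hom) ≫
    ((S.A i).o _).map (S.M i j _ _).inv ≫ (S.M i j _ _).inv ≫
    (S.Φ i j).map (((S.A j).o _).map (S.n j k p h).hom) ≫
    (S.Φ i j).map (S.M j k _ _).inv ≫ (S.Φ i j).map ((S.Φ j k).map (S.n k l p h).hom)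
  · have e := congrArg ((S.A i).o ((S.lam i j).obj (S.g j k l))).map hijlp
    have e' := congrArg (S.Φ i j).map hjklp
    have n := S.M_nat i j (S.g j k l) (S.n j l p h).hom
    have mt' : (S.A i).two (μ (S.lam i j) _ _ ≫ (S.lam i j).map Yjklp ≫ δ (S.lam i j) _ _) _ ≫
        ((S.A i).o _).map (S.M i j _ _).inv = ((S.A i).o _).map (S.M i j _ _).inv ≫
        (S.M i j _ _).inv ≫ (S.Φ i j).map ((S.A j).two Yjklp ((S.Φ j p).obj h)) ≫
        (S.M i j _ _).hom := by
      rw [← cancel_epi ((S.M i j _ _).hom ≫ ((S.A i).o _).map (S.M i j _ _).hom), Category.assoc,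
        Category.assoc, ← reassoc_of% mt, ← Functor.map_comp, Iso.hom_inv_id,
        ← Functor.map_comp_assoc, Iso.hom_inv_id]
      simp
    simp only [Functor.map_comp, Category.assoc] at e e' ⊢
    rw [← reassoc_of% LeftAction.two_nat, hijkl, reassoc_of% e, ← reassoc_of% LeftAction.two_nat,
      reassoc_of% mt', ← reassoc_of% n, Iso.hom_inv_id_assoc, e']
  · have e := congrArg ((S.A i).o (S.g i j k)).map hiklp
    have e' := congrArg ((S.A i).o ((S.lam i j).obj ((S.lam j k).obj (S.g k l p)))).map hijkp
    -- The brace cube solved for the inverse of `X`, which is the direction in which the brace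
    -- occurs in the second equation.
    have hX' : (S.A i).two X.inv _ ≫ ((S.A i).o _).map (S.M i k _ _).inv ≫ (S.n i j k _).hom =
        ((S.A i).o _).map (S.n i j k ((S.Φ k p).obj h)).hom ≫ (S.M i j _ _).inv ≫
          (S.Φ i j).map (S.M j k _ _).inv := by
      rw [← cancel_epi ((S.A i).two X.hom _),
        ← cancel_epi (((S.A i).o _).map (S.M i k (S.g k l p) ((S.Φ k p).obj h)).hom),
        reassoc_of% hX, LeftAction.two_hom_inv_assoc, ← Functor.map_comp_assoc, Iso.hom_inv_id]
      simp [← Functor.map_comp]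
    have n := S.M_nat i j ((S.lam j k).obj (S.g k l p)) (S.n j k p h).hom
    have n' : (S.M i j _ _).inv ≫ (S.Φ i j).map (((S.A j).o ((S.lam j k).obj (S.g k l p))).map
        (S.n j k p h).hom) =
        ((S.A i).o _).map ((S.Φ i j).map (S.n j k p h).hom) ≫ (S.M i j _ _).inv := by
      rw [Iso.inv_comp_eq, ← reassoc_of% n, Iso.hom_inv_id, Category.comp_id]
    simp only [Functor.map_comp, Category.assoc] at e e' ⊢
    rw [reassoc_of% e, S.n_nat, ← reassoc_of% LeftAction.two_nat, reassoc_of% hX',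
      reassoc_of% e', reassoc_of% n']

variable {mt : ∀ γ, (conj (S.g i j k)).obj ((S.lam i k).obj γ) ⟶
  (S.lam i j).obj ((S.lam j k).obj γ)}

/-- The arrow `X` of a brace cube, attached to a component of `m̃`. -/
noncomputable abbrev braceOf (mt : ∀ γ, (conj (S.g i j k)).obj ((S.lam i k).obj γ) ⟶
    (S.lam i j).obj ((S.lam j k).obj γ)) (γ : C) : S.g i j k ⊗ (S.lam i k).obj γ ⟶
    (S.lam i j).obj ((S.lam j k).obj γ) ⊗ S.g i j k :=
  (conjIso (S.g i j k) _).inv ≫ mt γ ▷ S.g i j k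

/-- The bridge between `m̃` and the cubes: on objects of the form `g_ijk • h`, acting by `m̃` is
acting by the brace up to the invertible `conjCell`. -/
lemma m_mt (γ : C) (h : H i) :
    (S.A i).m (mt γ) (((S.A i).o (S.g i j k)).obj h) =
      (S.A i).conjCell (S.g i j k) _ h ≫ (S.A i).two (S.braceOf mt γ) h := by
  rw [LeftAction.conjCell, ← LeftAction.two_comp, Iso.hom_inv_id_assoc, LeftAction.two_whiskerRight]

/-- After `conjCell` is cancelled, the claim becomes naturality of the brace. The cubes of `γ` and
`δ` at the same `h` are connected by naturality of `M_ik`, `M_jk`, `M_ij` and `n_ijk`, and the brace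
is the only remaining face. -/
lemma mt_naturality {h : H k} (hf : (S.A i).FaithfulAt (((S.A i).o (S.g i j k)).obj ((S.Φ i k).obj h)))
    (hmt : ∀ γ, S.BraceCube i j k γ (S.braceOf mt γ) h) {γ δ : C} (f : γ ⟶ δ) :
    (conj (S.g i j k)).map ((S.lam i k).map f) ≫ mt δ =
      mt γ ≫ (S.lam i j).map ((S.lam j k).map f) := by
  have h1 := hmt γ
  have h2 := hmt δ
  unfold BraceCube at h1 h2
  apply hf
  rw [LeftAction.m_comp, LeftAction.m_comp, m_mt, m_mt,
    reassoc_of% LeftAction.conjCell_map, Category.assoc, cancel_epi,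
    ← cancel_epi (((S.A i).o _).map (S.M i k γ h).hom), ← cancel_mono (((S.A i).o _).map (S.n i j k h).hom)]
  have e1 := congrArg ((S.A i).o (S.g i j k)).map (S.M_map i k f h)
  have e2 := congrArg (S.Φ i j).map (S.M_map j k f h)
  simp only [Functor.map_comp, Category.assoc] at e1 e2 ⊢
  rw [← reassoc_of% e1, h2, reassoc_of% S.n_nat, reassoc_of% e2, S.M_map,
    ← LeftAction.m_nat, reassoc_of% h1]

/-- In the cube at the unit object, `M_unit` identifies the faces `M_ik`, `M_jk` and `M_ij` with the
unit constraints of the three self-equivalences. The cube then becomes the unit condition. -/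
lemma mt_unit {h : H k} (hf : (S.A i).FaithfulAt (((S.A i).o (S.g i j k)).obj ((S.Φ i k).obj h)))
    (hmt : ∀ γ, S.BraceCube i j k γ (S.braceOf mt γ) h) :
    (ε (conj (S.g i j k)) ≫ (conj (S.g i j k)).map (ε (S.lam i k))) ≫ mt (𝟙_ C) =
      ε (S.lam i j) ≫ (S.lam i j).map (ε (S.lam j k)) := by
  have h1 := hmt (𝟙_ C)
  unfold BraceCube at h1
  apply hf
  simp only [LeftAction.m_comp, m_mt, conj_ε, Category.assoc]
  rw [reassoc_of% LeftAction.conjCell_map, reassoc_of% LeftAction.conjCell_ε, Iso.inv_comp_eq]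
  have e1 := congrArg ((S.A i).o (S.g i j k)).map (S.M_unit i k h)
  have e2 := congrArg (S.Φ i j).map (S.M_unit j k h)
  have e3 := S.M_unit i j ((S.Φ j k).obj h)
  rw [← cancel_mono (((S.A i).o _).map (S.n i j k h).hom)]
  simp only [Functor.map_comp, Category.assoc] at e1 e2 ⊢
  rw [← reassoc_of% e1, h1, reassoc_of% S.n_nat, reassoc_of% e2, S.M_map, reassoc_of% e3,
    ← LeftAction.m_nat, ← reassoc_of% LeftAction.m_nat, LeftAction.o_unit_map]
  simp

/-- By `M_mul`, the cube of `γ ⊗ δ` at `h` is the pasting of the cube of `γ` at `δ • h` with the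
cube of `δ` at `h`. This is why the cubes are assumed at all objects although faithfulness is needed
only at one. -/
lemma mt_tensor (hf : ∃ h : H k, (S.A i).FaithfulAt (((S.A i).o (S.g i j k)).obj ((S.Φ i k).obj h)))
    (hmt : ∀ γ h, S.BraceCube i j k γ (S.braceOf mt γ) h) (γ δ : C) :
    (μ (conj (S.g i j k)) _ _ ≫ (conj (S.g i j k)).map (μ (S.lam i k) γ δ)) ≫ mt (γ ⊗ δ) =
      (mt γ ⊗ₘ mt δ) ≫ μ (S.lam i j) _ _ ≫ (S.lam i j).map (μ (S.lam j k) γ δ) := by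
  obtain ⟨h, hf⟩ := hf
  have h1 := hmt (γ ⊗ δ) h
  have h2 := hmt γ (((S.A k).o δ).obj h)
  have h3 := hmt δ h
  unfold BraceCube at h1 h2 h3
  apply hf
  simp only [MonoidalCategory.tensorHom_def, LeftAction.m_comp, m_mt, conj_μ, Category.assoc,
    LeftAction.m_whiskerRight, LeftAction.m_whiskerLeft, Iso.hom_inv_id_assoc]
  have e4 := LeftAction.m_nat (A := S.A i) (mt γ)
    ((S.A i).conjCell (S.g i j k) ((S.lam i k).obj δ) ((S.Φ i k).obj h))
  rw [m_mt] at e4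
  rw [reassoc_of% LeftAction.conjCell_map, reassoc_of% LeftAction.conjCell_μ, cancel_epi,
    Functor.map_comp, Category.assoc, ← reassoc_of% e4, cancel_epi, cancel_epi,
    ← cancel_epi (((S.A i).o _).map ((S.M i k γ _).hom ≫ ((S.A i).o _).map (S.M i k δ h).hom)),
    ← cancel_mono (((S.A i).o _).map (S.n i j k h).hom)]
  have e1 := congrArg ((S.A i).o (S.g i j k)).map (S.M_mul i k γ δ h)
  have e2 := congrArg (S.Φ i j).map (S.M_mul j k γ δ h)
  have e3 := S.M_mul i j ((S.lam j k).obj γ) ((S.lam j k).obj δ) ((S.Φ j k).obj h)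
  have e5 := congrArg ((S.A i).o ((S.lam i j).obj ((S.lam j k).obj γ))).map h3
  simp only [Functor.map_comp, Category.assoc] at e1 e2 e3 e5 ⊢
  rw [← reassoc_of% e1, h1, reassoc_of% S.n_nat, reassoc_of% e2, S.M_map, reassoc_of% e3,
    ← LeftAction.m_nat, ← reassoc_of% LeftAction.m_nat, LeftAction.o_tensor_map,
    reassoc_of% LeftAction.two_nat]
  simp only [Category.assoc, Iso.hom_inv_id_assoc]
  rw [reassoc_of% e5, reassoc_of% h2, reassoc_of% S.M_nat]

lemma two_inv_conjIso (γ : C) (h : H i) :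
    inv ((S.A i).conjCell (S.g i j k) _ h) ≫ (S.A i).m (mt γ) _ = (S.A i).two (S.braceOf mt γ) h := by
  rw [m_mt, IsIso.inv_hom_id_assoc]

/-- Each component of `m̃` is replaced by its brace through `m_mt`, and each conjugation through the
lemmas on `conjCell`. Both sides then have the same invertible prefix, and what follows it is
`associativity_brace`. -/
lemma firstEquation {γ : C} {h : H l}
    {mtijk : ∀ γ, (conj (S.g i j k)).obj ((S.lam i k).obj γ) ⟶ (S.lam i j).obj ((S.lam j k).obj γ)}
    {mtikl : ∀ γ, (conj (S.g i k l)).obj ((S.lam i l).obj γ) ⟶ (S.lam i k).obj ((S.lam k l).obj γ)}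
    {mtijl : ∀ γ, (conj (S.g i j l)).obj ((S.lam i l).obj γ) ⟶ (S.lam i j).obj ((S.lam j l).obj γ)}
    {mtjkl : ∀ γ, (conj (S.g j k l)).obj ((S.lam j l).obj γ) ⟶ (S.lam j k).obj ((S.lam k l).obj γ)}
    {Y : (S.lam i j).obj (S.g j k l) ⊗ S.g i j l ⟶ S.g i j k ⊗ S.g i k l}
    (hf : (S.A i).FaithfulAt (((S.A i).o (S.g i j k ⊗ S.g i k l)).obj ((S.Φ i l).obj h)))
    (hY : ∀ h, S.NuCube i j k l Y h)
    (hijk : S.BraceCube i j k _ (S.braceOf mtijk ((S.lam k l).obj γ)) ((S.Φ k l).obj h))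
    (hikl : S.BraceCube i k l γ (S.braceOf mtikl γ) h)
    (hijl : S.BraceCube i j l γ (S.braceOf mtijl γ) h)
    (hjkl : S.BraceCube j k l γ (S.braceOf mtjkl γ) h) :
    (conjMap Y).app ((S.lam i l).obj γ) ≫
      (conjTensor (S.g i j k) (S.g i k l) ((S.lam i l).obj γ)).inv ≫
        (conj (S.g i j k)).map (mtikl γ) ≫ mtijk ((S.lam k l).obj γ) =
    (conjTensor ((S.lam i j).obj (S.g j k l)) (S.g i j l) ((S.lam i l).obj γ)).inv ≫
      (conj ((S.lam i j).obj (S.g j k l))).map (mtijl γ) ≫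
        (conjCompareApp (S.lam i j) (Iso.refl _) ((S.lam j l).obj γ)).hom ≫
          (S.lam i j).map (mtjkl γ) := by
  have key := associativity_brace hY hijk hikl hijl hjkl
  apply hf
  have cY : IsIso Y := IsGroupoid.all_isIso Y
  -- The rule for `conjMap Y` reads it off after a change of the acted object along `Y`. Since `Y`
  -- is invertible, this change may be inserted on both sides.
  rw [← cancel_epi (((S.A i).o _).map ((S.A i).m Y _))]
  simp only [LeftAction.m_comp]
  have e1 := LeftAction.conjTensor_map (S.A i) (S.g i j k) (S.g i k l) (mtikl γ)
    ((S.Φ i l).obj h)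
  have e2 := LeftAction.conjTensor_map (S.A i) ((S.lam i j).obj (S.g j k l)) (S.g i j l) (mtijl γ)
    ((S.Φ i l).obj h)
  -- The comparison `j(λ_ij(g)) λ_ij ≅ λ_ij j(g)` turns the whiskering `λ_ij ∗ m̃_jkl` into the
  -- image of the brace under `λ_ij`, in the form that `M_two` produces.
  have e3 : (S.A i).m (conjCompareApp (S.lam i j) (Iso.refl _) ((S.lam j l).obj γ)).hom
      (((S.A i).o _).obj (((S.A i).o (S.g i j l)).obj ((S.Φ i l).obj h))) ≫
      (S.A i).m ((S.lam i j).map (mtjkl γ)) _ = (S.A i).conjCell _ _ _ ≫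
      (S.A i).two (μ (S.lam i j) _ _ ≫ (S.lam i j).map (S.braceOf mtjkl γ) ≫ δ (S.lam i j) _ _)
        _ := by
    have a := conjCompareApp_spec (S.lam i j) (Iso.refl _) (g := S.g j k l) ((S.lam j l).obj γ)
    have b : (mapConjIso (S.lam i j) (Iso.refl _) (g := S.g j k l) ((S.lam j l).obj γ)).hom =
        μ _ _ _ ≫ (S.lam i j).map (conjIso _ _).hom ≫ δ _ _ _ := by simp [mapConjIso]
    have c : (conjIso (S.g j k l) ((S.lam j l).obj γ)).hom ≫ S.braceOf mtjkl γ =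
        mtjkl γ ▷ S.g j k l := by simp
    have d : μ (S.lam i j) _ _ ≫ (S.lam i j).map (mtjkl γ ▷ S.g j k l) ≫ δ (S.lam i j) _ _ =
        (S.lam i j).map (mtjkl γ) ▷ _ := by
      rw [← μ_natural_left_assoc, Functor.Monoidal.μ_δ, Category.comp_id]
    rw [LeftAction.conjCell, ← LeftAction.two_comp, ← LeftAction.two_whiskerRight,
      ← LeftAction.two_whiskerRight, ← LeftAction.two_comp, ← a, b, ← d, ← c]
    simp
  rw [two_inv_conjIso] at e1 e2
  have n1 := LeftAction.m_nat (A := S.A i) (mtijk ((S.lam k l).obj γ))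
    ((S.A i).mul (S.g i j k) (S.g i k l) ((S.Φ i l).obj h)).inv
  rw [m_mt] at n1
  rw [← cancel_mono (((S.A i).o _).map
    ((S.A i).mul (S.g i j k) (S.g i k l) ((S.Φ i l).obj h)).inv)]
  have n2 := LeftAction.m_nat (A := S.A i) (conjTensor ((S.lam i j).obj (S.g j k l)) (S.g i j l)
    ((S.lam i l).obj γ)).inv ((S.A i).m Y ((S.Φ i l).obj h))
  have n3 := LeftAction.m_nat (A := S.A i) ((conj ((S.lam i j).obj (S.g j k l))).map (mtijl γ))
    ((S.A i).m Y ((S.Φ i l).obj h))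
  have n4 := LeftAction.m_nat (A := S.A i) ((conjCompareApp (S.lam i j) (Iso.refl _)
    ((S.lam j l).obj γ)).hom ≫ (S.lam i j).map (mtjkl γ)) ((S.A i).m Y ((S.Φ i l).obj h))
  have n5 := LeftAction.m_nat (A := S.A i) ((conjCompareApp (S.lam i j) (Iso.refl _)
    ((S.lam j l).obj γ)).hom ≫ (S.lam i j).map (mtjkl γ)) ((S.A i).mul ((S.lam i j).obj
    (S.g j k l)) (S.g i j l) ((S.Φ i l).obj h)).inv
  have n6 := congrArg ((S.A i).o ((S.lam i j).obj ((S.lam j k).obj ((S.lam k l).obj γ)))).map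
    (LeftAction.m_eq_two (A := S.A i) Y ((S.Φ i l).obj h))
  simp only [LeftAction.m_comp, Category.assoc] at n4 n5
  -- The tail of this middle term is the left-hand side of `associativity_brace`, up to one `mul`
  -- isomorphism.
  trans (S.A i).conjCell _ ((S.lam i l).obj γ) ((S.Φ i l).obj h) ≫ (S.A i).m Y _ ≫
    ((S.A i).mul _ _ _).inv ≫ ((S.A i).o _).map ((S.A i).two (S.braceOf mtikl γ) _) ≫
      (S.A i).two (S.braceOf mtijk _) _
  · simp only [Category.assoc]
    rw [← n1, reassoc_of% e1, reassoc_of% LeftAction.conjCell_conjMap]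
  · simp only [Category.assoc]
    rw [reassoc_of% n2, reassoc_of% n3, reassoc_of% n4, n6, Functor.map_comp, Functor.map_comp]
    simp only [Category.assoc]
    rw [← reassoc_of% n5, reassoc_of% e3, reassoc_of% e2, LeftAction.m_eq_two, Category.assoc, Category.assoc,
      Iso.hom_inv_id_assoc, key]
    simp only [← Functor.map_comp, Iso.hom_inv_id, Category.comp_id]
    

lemma secondEquation {h : H p}
    (hf : (S.A i).FaithfulAt ((S.Φ i p).obj h))
    {Yijkl} (hijkl : S.NuCube i j k l Yijkl ((S.Φ l p).obj h))
    {Yijlp} (hijlp : S.NuCube i j l p Yijlp h)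
    {Yjklp} (hjklp : S.NuCube j k l p Yjklp h)
    {Yijkp} (hijkp : S.NuCube i j k p Yijkp h)
    {Yiklp} (hiklp : S.NuCube i k l p Yiklp h)
    (X : S.g i j k ⊗ (S.lam i k).obj (S.g k l p) ≅
      (S.lam i j).obj ((S.lam j k).obj (S.g k l p)) ⊗ S.g i j k)
    (hX : S.BraceCube i j k _ X.hom ((S.Φ k p).obj h)) :
    (μ (S.lam i j) ((S.lam j k).obj (S.g k l p)) (S.g j k p) ≫ (S.lam i j).map Yjklp ≫
        δ (S.lam i j) _ _) ▷ S.g i j p ≫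
      (α_ _ _ _).hom ≫ (S.lam i j).obj (S.g j k l) ◁ Yijlp ≫ (α_ _ _ _).inv ≫
        Yijkl ▷ S.g i l p =
    (α_ _ _ _).hom ≫ (S.lam i j).obj ((S.lam j k).obj (S.g k l p)) ◁ Yijkp ≫ (α_ _ _ _).inv ≫
      X.inv ▷ S.g i k p ≫ (α_ _ _ _).hom ≫ S.g i j k ◁ Yiklp ≫ (α_ _ _ _).inv :=
  LeftAction.tensor_eq_of_two_eq hf (associativity_nu hijkl hijlp hjklp hijkp hiklp X hX)

end Equations

end TransitionSystem

end

end Breen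

/-! ### Restriction of transition systems -/

namespace Breen

open CategoryTheory TopologicalSpace Opposite MonoidalCategory

section

open Functor.LaxMonoidal Functor.OplaxMonoidal

universe a b v' u' a' b'

/-- A restriction from a transition system `S` over `C` to a transition system `S'` over `C'`. -/
structure Restriction {C : Type u} [Category.{v} C] [MonoidalCategory C] {I : Type t}
    {H : I → Type a} [∀ i, Category.{b} (H i)] (S : TransitionSystem C H)
    {C' : Type u'} [Category.{v'} C'] [MonoidalCategory C']
    {H' : I → Type a'} [∀ i, Category.{b'} (H' i)] (S' : TransitionSystem C' H')
    (R : C ⥤ C') [R.Monoidal] where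
  t (i : I) : H' i ⥤ H i
  ρ (i : I) (γ : C) (h : H' i) :
    (t i).obj (((S'.A i).o (R.obj γ)).obj h) ≅ ((S.A i).o γ).obj ((t i).obj h)
  ρ_map (i : I) {γ δ : C} (f : γ ⟶ δ) (h : H' i) :
    (t i).map ((S'.A i).m (R.map f) h) ≫ (ρ i δ h).hom = (ρ i γ h).hom ≫ (S.A i).m f _
  ρ_nat (i : I) (γ : C) {h h' : H' i} (u : h ⟶ h') :
    (t i).map (((S'.A i).o (R.obj γ)).map u) ≫ (ρ i γ h').hom =
      (ρ i γ h).hom ≫ ((S.A i).o γ).map ((t i).map u)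
  ρ_mul (i : I) (γ δ : C) (h : H' i) :
    (t i).map ((S'.A i).mul _ _ h).hom ≫ (t i).map ((S'.A i).m (μ R γ δ) h) ≫ (ρ i _ h).hom =
      (ρ i γ _).hom ≫ ((S.A i).o γ).map (ρ i δ h).hom ≫ ((S.A i).mul γ δ _).hom
  pt (i j : I) (h : H' j) : (t i).obj ((S'.Φ i j).obj h) ≅ (S.Φ i j).obj ((t j).obj h)
  pt_nat (i j : I) {h h' : H' j} (u : h ⟶ h') :
    (t i).map ((S'.Φ i j).map u) ≫ (pt i j h').hom = (pt i j h).hom ≫ (S.Φ i j).map ((t j).map u)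
  nt (i j : I) (γ : C) : (S'.lam i j).obj (R.obj γ) ≅ R.obj ((S.lam i j).obj γ)
  M_res (i j : I) (γ : C) (h : H' j) :
    (t i).map (S'.M i j _ h).hom ≫ (t i).map ((S'.A i).m (nt i j γ).hom _) ≫ (ρ i _ _).hom ≫
        ((S.A i).o _).map (pt i j h).hom =
      (pt i j _).hom ≫ (S.Φ i j).map (ρ j γ h).hom ≫ (S.M i j γ _).hom
  gR (i j k : I) : R.obj (S.g i j k) ≅ S'.g i j k
  n_res (i j k : I) (h : H' k) :
    (t i).map (S'.n i j k h).hom ≫ (pt i j _).hom ≫ (S.Φ i j).map (pt j k h).hom =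
      (t i).map ((S'.A i).m (gR i j k).inv _) ≫ (ρ i _ _).hom ≫
        ((S.A i).o _).map (pt i k h).hom ≫ (S.n i j k _).hom

namespace Restriction

variable {C : Type u} [Category.{v} C] [MonoidalCategory C] {I : Type t}
    {H : I → Type a} [∀ i, Category.{b} (H i)] {S : TransitionSystem C H}
    {C' : Type u'} [Category.{v'} C'] [MonoidalCategory C']
    {H' : I → Type a'} [∀ i, Category.{b'} (H' i)] {S' : TransitionSystem C' H'}
    {R : C ⥤ C'} [R.Monoidal] (T : Restriction S S' R)

/-- The counterpart of `M_two` for restrictions: `ρ_mul` on source and target leaves exactly the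
conjugate of `R.map f` by the tensor constraints of `R`. -/
lemma ρ_two (i : I) {a b c d : C} (f : a ⊗ b ⟶ c ⊗ d) (h : H' i) :
    (T.t i).map ((S'.A i).two (μ R a b ≫ R.map f ≫ δ R c d) h) ≫ (T.ρ i c _).hom ≫
        ((S.A i).o c).map (T.ρ i d h).hom =
      (T.ρ i a _).hom ≫ ((S.A i).o a).map (T.ρ i b h).hom ≫ (S.A i).two f _ := by
  have e := T.ρ_mul i a b h
  have e' := T.ρ_mul i c d h
  have n := T.ρ_map i f h
  have k : (S'.A i).m (δ R c d) h ≫ (S'.A i).m (μ R c d) h = 𝟙 _ := by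
    rw [← LeftAction.m_comp, Functor.Monoidal.δ_μ, LeftAction.m_id]
  have e'' : (T.t i).map ((S'.A i).m (δ R c d) h) ≫ (T.t i).map ((S'.A i).mul _ _ h).inv ≫
      (T.ρ i c _).hom ≫ ((S.A i).o c).map (T.ρ i d h).hom =
      (T.ρ i _ h).hom ≫ ((S.A i).mul c d _).inv := by
    rw [Iso.eq_comp_inv, Category.assoc, Category.assoc, Category.assoc, ← e',
      LeftAction.map_mul_inv_hom_assoc, ← Functor.map_comp_assoc, k]
    simp
  simp only [LeftAction.two, LeftAction.m_comp, Functor.map_comp, Category.assoc]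
  rw [e'', reassoc_of% n, reassoc_of% e]

variable {i j k l : I}

/-- Through the faithful functor `t`, the cubes in `S` and in `S'` become opposite faces of one
diagram. Its side faces are the compatibilities `M_res` and `n_res`, so the braces of the two
systems must correspond. -/
lemma brace_res {γ : C} {X X'} {h : H' k} (ht : (T.t i).Faithful)
    (hX : S.BraceCube i j k γ X ((T.t k).obj h)) (hX' : S'.BraceCube i j k (R.obj γ) X' h) :
    (S'.A i).two X' _ ≫ (S'.A i).m ((S'.lam i j).map (T.nt j k γ).hom ≫ (T.nt i j _).hom) _ ≫
        ((S'.A i).o _).map ((S'.A i).m (T.gR i j k).inv ((S'.Φ i k).obj h)) =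
      ((S'.A i).o _).map ((S'.A i).m (T.nt i k γ).hom _) ≫ (S'.A i).m (T.gR i j k).inv _ ≫
        (S'.A i).two (μ R _ _ ≫ R.map X ≫ δ R _ _) _ := by
  unfold TransitionSystem.BraceCube at hX hX'
  apply (T.t i).map_injective
  rw [← cancel_epi ((T.t i).map (((S'.A i).o _).map (S'.M i k _ h).hom)),
    ← cancel_mono ((T.ρ i _ _).hom ≫ ((S.A i).o _).map (T.ρ i _ _).hom ≫
      ((S.A i).o _).map (((S.A i).o _).map (T.pt i k h).hom ≫ (S.n i j k _).hom))]
  -- The middle term is one side of the cube of `X` in `S`, preceded only by restriction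
  -- comparisons. The first half uses both cubes; the second needs only `ρ_two` and naturality.
  trans (T.t i).map ((S'.A i).m (T.gR i j k).inv _) ≫ (T.ρ i _ _).hom ≫
    ((S.A i).o _).map ((T.pt i k _).hom ≫ (S.Φ i k).map (T.ρ k γ h).hom ≫ (S.M i k γ _).hom) ≫
      (S.A i).two X _ ≫ ((S.A i).o _).map (S.n i j k _).hom
  · have hX'' := congrArg (T.t i).map hX'
    have n1 := T.n_res i j k h
    have n2 := T.n_res i j k (((S'.A k).o (R.obj γ)).obj h)
    have n1' := congrArg ((S.A i).o ((S.lam i j).obj ((S.lam j k).obj γ))).map n1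
    have m1 := T.M_res i j ((S.lam j k).obj γ) ((S'.Φ j k).obj h)
    have m2 := congrArg (S.Φ i j).map (T.M_res j k γ h)
    have m3 := congrArg (T.t i).map (S'.M_map i j (T.nt j k γ).hom ((S'.Φ j k).obj h))
    have m4 := congrArg (T.t i).map (LeftAction.m_nat (A := S'.A i) ((S'.lam i j).map
      (T.nt j k γ).hom ≫ (T.nt i j _).hom) (S'.n i j k h).hom)
    have p1 := T.pt_nat i j (S'.M j k (R.obj γ) h).hom
    have p2 := T.pt_nat i j ((S'.A j).m (T.nt j k γ).hom ((S'.Φ j k).obj h))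
    have r1 := S.M_nat i j ((S.lam j k).obj γ) (T.pt j k h).hom
    have r2 := S.n_nat i j k (T.ρ k γ h).hom
    simp only [Functor.map_comp, Category.assoc, LeftAction.m_comp] at hX hX'' n1' m2 m3 m4 ⊢
    rw [reassoc_of% T.ρ_nat, ← n1', ← reassoc_of% T.ρ_nat, ← reassoc_of% m4, reassoc_of% hX'',
      ← reassoc_of% m3, reassoc_of% m1, reassoc_of% p2, reassoc_of% p1, ← r1, reassoc_of% m2,
      reassoc_of% n2, ← reassoc_of% r2, hX]
  · have m1 := congrArg ((S.A i).o (S.g i j k)).map (T.M_res i k γ h)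
    simp only [Functor.map_comp, Category.assoc] at m1 ⊢
    have r := T.ρ_two i X ((S'.Φ i k).obj h)
    have m2 := T.ρ_nat i (S.g i j k) (S'.M i k (R.obj γ) h).hom
    have m3 := T.ρ_nat i (S.g i j k) ((S'.A i).m (T.nt i k γ).hom ((S'.Φ i k).obj h))
    have m4 := congrArg (T.t i).map (LeftAction.m_nat (A := S'.A i) (T.gR i j k).inv
      (S'.M i k (R.obj γ) h).hom)
    have m5 := congrArg (T.t i).map (LeftAction.m_nat (A := S'.A i) (T.gR i j k).inv
      ((S'.A i).m (T.nt i k γ).hom ((S'.Φ i k).obj h)))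
    simp only [Functor.map_comp, Category.assoc] at m4 m5
    rw [reassoc_of% r, reassoc_of% m5, reassoc_of% m3, reassoc_of% m4, reassoc_of% m2,
      ← reassoc_of% LeftAction.two_nat, reassoc_of% m1]

/-- This is the condition on `m̃` to be compatible with restrictions as an arrow of `𝓔q(𝒢)`. It is
obtained from `brace_res` by cancelling the canonical arrows `conjCell`, which are themselves
related by `conjCompareApp`. -/
lemma mt_res [IsGrCategory C] [IsGrCategory C'] {γ : C} {h : H' k} (ht : (T.t i).Faithful)
    (hf : (S'.A i).FaithfulAt (((S'.A i).o (S'.g i j k)).obj ((S'.Φ i k).obj h)))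
    {mt : ∀ γ, (conj (S.g i j k)).obj ((S.lam i k).obj γ) ⟶ (S.lam i j).obj ((S.lam j k).obj γ)}
    {mt' : ∀ γ, (conj (S'.g i j k)).obj ((S'.lam i k).obj γ) ⟶
      (S'.lam i j).obj ((S'.lam j k).obj γ)}
    (hmt : S.BraceCube i j k γ (S.braceOf mt γ) ((T.t k).obj h))
    (hmt' : S'.BraceCube i j k (R.obj γ) (S'.braceOf mt' _) h) :
    ((conj (S'.g i j k)).map (T.nt i k γ).hom ≫
        (conjCompareApp R (T.gR i j k) ((S.lam i k).obj γ)).hom) ≫ R.map (mt γ) =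
      mt' (R.obj γ) ≫ (S'.lam i j).map (T.nt j k γ).hom ≫ (T.nt i j _).hom := by
  have key := T.brace_res ht hmt hmt'
  apply hf
  rw [← cancel_mono (((S'.A i).o _).map ((S'.A i).m (T.gR i j k).inv ((S'.Φ i k).obj h)))]
  rw [LeftAction.m_comp (mt' _), TransitionSystem.m_mt]
  simp only [Category.assoc]
  rw [key]
  have a := conjCompareApp_spec R (T.gR i j k) ((S.lam i k).obj γ)
  have c : (conjIso (S.g i j k) ((S.lam i k).obj γ)).hom ≫ S.braceOf mt γ =
      mt γ ▷ S.g i j k := by simp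
  have d : μ R _ _ ≫ R.map (mt γ ▷ S.g i j k) ≫ δ R _ _ = R.map (mt γ) ▷ _ := by
    rw [← μ_natural_left_assoc, Functor.Monoidal.μ_δ, Category.comp_id]
  rw [mapConjIso_hom] at a
  -- The action form of `conjCompareApp_spec`: the canonical cell of the smaller open set factors
  -- through the image under `R` of that of the larger one.
  have a' : (S'.A i).conjCell (S'.g i j k) (R.obj ((S.lam i k).obj γ)) ((S'.Φ i k).obj h) =
      (S'.A i).m (conjCompareApp R (T.gR i j k) ((S.lam i k).obj γ)).hom _ ≫
      ((S'.A i).o _).map ((S'.A i).m (T.gR i j k).inv _) ≫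
      (S'.A i).two (μ R _ _ ≫ R.map (conjIso _ _).hom ≫ δ R _ _) _ ≫
      (S'.A i).m (T.gR i j k).hom _ := by
    rw [← LeftAction.two_whiskerRight, ← LeftAction.two_whiskerRight, ← LeftAction.two_whiskerLeft,
      ← LeftAction.two_comp, ← LeftAction.two_comp, ← LeftAction.two_comp, LeftAction.conjCell, ← a]
    simp
  have b : (S'.A i).two (μ R _ _ ≫ R.map (conjIso _ _).hom ≫ δ R _ _) ((S'.Φ i k).obj h) ≫
      (S'.A i).two (μ R _ _ ≫ R.map (S.braceOf mt γ) ≫ δ R _ _) ((S'.Φ i k).obj h) =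
      (S'.A i).m (R.map (mt γ)) _ := by
    rw [← LeftAction.two_comp, ← LeftAction.two_whiskerRight, ← d, ← c]
    simp
  simp only [LeftAction.m_comp, Category.assoc]
  rw [← reassoc_of% LeftAction.conjCell_map, a', ← LeftAction.m_nat]
  simp only [Category.assoc]
  rw [LeftAction.m_hom_inv_assoc, b]

/-- The arrow in the conclusion is the restriction of `Y` along `R`, corrected on both sides by the
comparisons of the `g`'s and of `λ_ij`. Only the target functor of `S'` has to be faithful into `S`:
the cube is pushed forward by `t`, where it becomes the given cube of `Y`. -/
lemma nu_res {h : H' l} (ht : (T.t i).Faithful)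
    {Y : (S.lam i j).obj (S.g j k l) ⊗ S.g i j l ⟶ S.g i j k ⊗ S.g i k l}
    (hY : S.NuCube i j k l Y ((T.t l).obj h)) :
    S'.NuCube i j k l
      (((S'.lam i j).map (T.gR j k l).inv ≫ (T.nt i j _).hom ⊗ₘ (T.gR i j l).inv) ≫
        μ R _ _ ≫ R.map Y ≫ δ R _ _ ≫ ((T.gR i j k).hom ⊗ₘ (T.gR i k l).hom)) h := by
  unfold TransitionSystem.NuCube at *
  apply (T.t i).map_injective
  rw [← cancel_mono ((T.pt i j _).hom ≫ (S.Φ i j).map (T.pt j k _).hom ≫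
    (S.Φ i j).map ((S.Φ j k).map (T.pt k l h).hom))]
  -- Both sides reduce to restriction comparisons followed by the right-hand side of the cube of `Y`
  -- in `S`.
  trans (T.t i).map ((S'.A i).m ((S'.lam i j).map (T.gR j k l).inv ≫ (T.nt i j _).hom) _) ≫
    (T.t i).map (((S'.A i).o _).map ((S'.A i).m (T.gR i j l).inv ((S'.Φ i l).obj h))) ≫
    (T.ρ i _ _).hom ≫ ((S.A i).o _).map (T.ρ i _ _).hom ≫
    ((S.A i).o _).map (((S.A i).o _).map (T.pt i l h).hom) ≫
    ((S.A i).o _).map (S.n i j l _).hom ≫ (S.M i j _ _).inv ≫ (S.Φ i j).map (S.n j k l _).hom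
  · have n1 := T.n_res i j k ((S'.Φ k l).obj h)
    have n2 := congrArg ((S.A i).o (S.g i j k)).map (T.n_res i k l h)
    have n3 := S.n_nat i j k (T.pt k l h).hom
    have r1 := T.ρ_nat i (S.g i j k) (S'.n i k l h).hom
    have r2 := T.ρ_nat i (S.g i j k) ((S'.A i).m (T.gR i k l).inv ((S'.Φ i l).obj h))
    have r3 := congrArg (T.t i).map (LeftAction.m_nat (A := S'.A i) (T.gR i j k).inv
      (S'.n i k l h).hom)
    have r4 := T.ρ_two i Y ((S'.Φ i l).obj h)
    have k1 : (S'.A i).two ((T.gR i j k).hom ⊗ₘ (T.gR i k l).hom) ((S'.Φ i l).obj h) ≫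
        (S'.A i).m (T.gR i j k).inv _ ≫
        ((S'.A i).o _).map ((S'.A i).m (T.gR i k l).inv ((S'.Φ i l).obj h)) = 𝟙 _ := by
      rw [← LeftAction.two_whiskerLeft, ← LeftAction.two_whiskerRight, ← LeftAction.two_comp,
        ← LeftAction.two_comp, ← MonoidalCategory.tensorHom_def]
      simp
    have k1' := congrArg (T.t i).map k1
    have k2 : (S'.A i).two ((S'.lam i j).map (T.gR j k l).inv ≫ (T.nt i j _).hom ⊗ₘ
        (T.gR i j l).inv) ((S'.Φ i l).obj h) = (S'.A i).m ((S'.lam i j).map (T.gR j k l).inv ≫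
        (T.nt i j _).hom) _ ≫ ((S'.A i).o _).map ((S'.A i).m (T.gR i j l).inv _) := by
      rw [← LeftAction.two_whiskerLeft, ← LeftAction.two_whiskerRight, ← LeftAction.two_comp,
        ← MonoidalCategory.tensorHom_def]
    have k3 : (S'.A i).two (((S'.lam i j).map (T.gR j k l).inv ≫ (T.nt i j _).hom ⊗ₘ
        (T.gR i j l).inv) ≫
        μ R _ _ ≫ R.map Y ≫ δ R _ _ ≫ ((T.gR i j k).hom ⊗ₘ (T.gR i k l).hom)) ((S'.Φ i l).obj h) =
        (S'.A i).m ((S'.lam i j).map (T.gR j k l).inv ≫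
        (T.nt i j _).hom) _ ≫ ((S'.A i).o _).map ((S'.A i).m (T.gR i j l).inv _) ≫
        (S'.A i).two (μ R _ _ ≫ R.map Y ≫ δ R _ _) _ ≫
        (S'.A i).two ((T.gR i j k).hom ⊗ₘ (T.gR i k l).hom) _ := by
      rw [LeftAction.two_comp, k2, ← LeftAction.two_comp]
      simp
    simp only [Functor.map_comp, Category.assoc, CategoryTheory.Functor.map_id] at n2 r3 k1' ⊢
    rw [reassoc_of% n1, ← n3, reassoc_of% r3, reassoc_of% r1, reassoc_of% n2, ← reassoc_of% r2,
      k3]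
    simp only [Functor.map_comp, Category.assoc]
    rw [reassoc_of% k1', reassoc_of% r4, ← reassoc_of% LeftAction.two_nat, hY]
  · have n1 := congrArg (S.Φ i j).map (T.n_res j k l h)
    have n2 := congrArg ((S.A i).o ((S.lam i j).obj (S.g j k l))).map (T.n_res i j l h)
    have p1 := T.pt_nat i j (S'.n j k l h).hom
    have p2 := T.pt_nat i j ((S'.A j).m (T.gR j k l).inv ((S'.Φ j l).obj h))
    have m1 : (T.pt i j _).hom ≫ (S.Φ i j).map (T.ρ j (S.g j k l) ((S'.Φ j l).obj h)).hom =
        (T.t i).map (S'.M i j _ _).hom ≫ (T.t i).map ((S'.A i).m (T.nt i j _).hom _) ≫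
        (T.ρ i _ _).hom ≫ ((S.A i).o _).map (T.pt i j _).hom ≫ (S.M i j _ _).inv := by
      have := T.M_res i j (S.g j k l) ((S'.Φ j l).obj h)
      rw [← cancel_mono (S.M i j _ _).hom]
      simpa using this.symm
    have m2 : (S.M i j _ _).inv ≫ (S.Φ i j).map (((S.A j).o (S.g j k l)).map (T.pt j l h).hom) =
        ((S.A i).o _).map ((S.Φ i j).map (T.pt j l h).hom) ≫ (S.M i j _ _).inv := by
      rw [Iso.inv_comp_eq, ← reassoc_of% S.M_nat, Iso.hom_inv_id, Category.comp_id]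
    have m3 : (S'.M i j _ _).inv ≫ (S'.Φ i j).map ((S'.A j).m (T.gR j k l).inv
        ((S'.Φ j l).obj h)) ≫ (S'.M i j _ _).hom = (S'.A i).m ((S'.lam i j).map (T.gR j k l).inv) _ := by
      rw [Iso.inv_comp_eq, S'.M_map]
    have m3' := congrArg (T.t i).map m3
    have r1 := T.ρ_nat i ((S.lam i j).obj (S.g j k l)) (S'.n i j l h).hom
    have r2 := T.ρ_nat i ((S.lam i j).obj (S.g j k l)) ((S'.A i).m (T.gR i j l).inv
      ((S'.Φ i l).obj h))
    have r3 := congrArg (T.t i).map (LeftAction.m_nat (A := S'.A i) ((S'.lam i j).map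
      (T.gR j k l).inv ≫ (T.nt i j _).hom) (S'.n i j l h).hom)
    simp only [Functor.map_comp, Category.assoc, LeftAction.m_comp] at n1 n2 r3 m3' ⊢
    rw [reassoc_of% p1, n1, ← reassoc_of% p2, reassoc_of% m1, reassoc_of% m2, reassoc_of% m3',
      reassoc_of% r3, reassoc_of% r1, reassoc_of% n2, ← reassoc_of% r2]

end Restriction

end

end Breen

/-! ### Two-arrows acting on arrows by whiskering -/

namespace Breen

open CategoryTheory

section Cells

open Bicategory

variable {B : Type*} [Bicategory B] {a b b' c d e z : B}

/-- The action of a two-arrow `f ≫ g ⟶ k` on an arrow `h`. -/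
def cell₁ {f : a ⟶ b} {g : b ⟶ c} {k : a ⟶ c} (α : f ≫ g ⟶ k) (h : z ⟶ a) :
    (h ≫ f) ≫ g ⟶ h ≫ k := (α_ h f g).hom ≫ h ◁ α

/-- The action of a two-arrow `f ≫ g ⟶ f' ≫ g'` on an arrow `h`. -/
def cell₂ {f : a ⟶ b} {g : b ⟶ c} {f' : a ⟶ b'} {g' : b' ⟶ c} (α : f ≫ g ⟶ f' ≫ g')
    (h : z ⟶ a) : (h ≫ f) ≫ g ⟶ (h ≫ f') ≫ g' := (α_ h f g).hom ≫ h ◁ α ≫ (α_ h f' g').inv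

/-- The action of a two-arrow `𝟙 a ⟶ f` on an arrow `h`. -/
def cell₀ {f : a ⟶ a} (α : 𝟙 a ⟶ f) (h : z ⟶ a) : h ⟶ h ≫ f := (ρ_ h).inv ≫ h ◁ α

/-- This is what allows a cube tested only at the identity arrow to give back an equation of
two-arrows. -/
lemma whiskerLeft_id_injective {f g : a ⟶ b} {η θ : f ⟶ g} (h : 𝟙 a ◁ η = 𝟙 a ◁ θ) : η = θ :=
  (whiskerLeft_iff η θ).1 h

/-- Interchange. Together with its analogues it supplies every naturality needed for pasting, since
all arrows are kept bracketed to the left. -/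
lemma cell₂_nat {f : a ⟶ b} {g : b ⟶ c} {f' : a ⟶ b'} {g' : b' ⟶ c} (α : f ≫ g ⟶ f' ≫ g')
    {h h' : z ⟶ a} (u : h ⟶ h') : u ▷ f ▷ g ≫ cell₂ α h' = cell₂ α h ≫ u ▷ f' ▷ g' := by
  simp only [cell₂, Category.assoc]
  rw [associator_naturality_left_assoc, ← whisker_exchange_assoc, associator_inv_naturality_left]

lemma cell₁_nat {f : a ⟶ b} {g : b ⟶ c} {k : a ⟶ c} (α : f ≫ g ⟶ k)
    {h h' : z ⟶ a} (u : h ⟶ h') : u ▷ f ▷ g ≫ cell₁ α h' = cell₁ α h ≫ u ▷ k := by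
  simp only [cell₁, Category.assoc]
  rw [associator_naturality_left_assoc, ← whisker_exchange]

lemma cell₀_nat {f : a ⟶ a} (α : 𝟙 a ⟶ f)
    {h h' : z ⟶ a} (u : h ⟶ h') : u ≫ cell₀ α h' = cell₀ α h ≫ u ▷ f := by
  simp only [cell₀, Category.assoc]
  rw [whisker_exchange, rightUnitor_inv_naturality_assoc]

lemma cell₁_comp {f : a ⟶ b} {g : b ⟶ c} {k k' : a ⟶ c} (α : f ≫ g ⟶ k) (β : k ⟶ k')
    (h : z ⟶ a) : cell₁ (α ≫ β) h = cell₁ α h ≫ h ◁ β := by simp [cell₁]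

lemma cell₀_comp {f f' : a ⟶ a} (α : 𝟙 a ⟶ f) (β : f ⟶ f') (h : z ⟶ a) :
    cell₀ (α ≫ β) h = cell₀ α h ≫ h ◁ β := by simp [cell₀]

/-- Compatibility with units, in terms of the action on arrows. -/
lemma cell_unit_iff {f : a ⟶ a} {g : b ⟶ b} {φ : a ⟶ b} (m : 𝟙 a ⟶ f) (m' : 𝟙 b ⟶ g)
    (M : f ≫ φ ⟶ φ ≫ g) (h : z ⟶ a) :
    cell₀ m h ▷ φ ≫ cell₂ M h = cell₀ m' (h ≫ φ) ↔
      h ◁ (m ▷ φ ≫ M) = h ◁ ((λ_ _).hom ≫ (ρ_ _).inv ≫ φ ◁ m') := by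
  have e1 : cell₀ m h ▷ φ ≫ cell₂ M h =
      (h ◁ (λ_ φ).inv ≫ h ◁ (m ▷ φ ≫ M)) ≫ (α_ _ _ _).inv := by
    simp only [cell₀, cell₁, cell₂]; bicategory
  have e2 : cell₀ m' (h ≫ φ) = (h ◁ (λ_ φ).inv ≫ h ◁ ((λ_ _).hom ≫ (ρ_ _).inv ≫ φ ◁ m')) ≫
      (α_ _ _ _).inv := by
    simp only [cell₀, cell₁, cell₂]; bicategory
  rw [e1, e2, cancel_mono, cancel_epi]

/-- Compatibility with products, in terms of the action on arrows. -/
lemma cell_mul_iff {f₁ f₂ f : a ⟶ a} {g₁ g₂ g : b ⟶ b} {φ : a ⟶ b} (m : f₂ ≫ f₁ ⟶ f)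
    (m' : g₂ ≫ g₁ ⟶ g) (M₁ : f₁ ≫ φ ⟶ φ ≫ g₁) (M₂ : f₂ ≫ φ ⟶ φ ≫ g₂) (M : f ≫ φ ⟶ φ ≫ g)
    (h : z ⟶ a) :
    cell₁ m h ▷ φ ≫ cell₂ M h = cell₂ M₁ (h ≫ f₂) ≫ cell₂ M₂ h ▷ g₁ ≫ cell₁ m' (h ≫ φ) ↔
      h ◁ (m ▷ φ ≫ M) = h ◁ ((α_ _ _ _).hom ≫ _ ◁ M₁ ≫ (α_ _ _ _).inv ≫ M₂ ▷ _ ≫ (α_ _ _ _).hom ≫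
        φ ◁ m') := by
  have e1 : cell₁ m h ▷ φ ≫ cell₂ M h =
      (((α_ h f₂ f₁).hom ▷ φ ≫ (α_ _ _ _).hom) ≫ h ◁ (m ▷ φ ≫ M)) ≫ (α_ _ _ _).inv := by
    simp only [cell₀, cell₁, cell₂]; bicategory
  have e2 : cell₂ M₁ (h ≫ f₂) ≫ cell₂ M₂ h ▷ g₁ ≫ cell₁ m' (h ≫ φ) =
      (((α_ h f₂ f₁).hom ▷ φ ≫ (α_ _ _ _).hom) ≫ h ◁ ((α_ _ _ _).hom ≫ _ ◁ M₁ ≫ (α_ _ _ _).inv ≫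
        M₂ ▷ _ ≫ (α_ _ _ _).hom ≫ φ ◁ m')) ≫ (α_ _ _ _).inv := by
    simp only [cell₀, cell₁, cell₂]; bicategory
  rw [e1, e2, cancel_mono, cancel_epi]

/-- Compatibility with restrictions, in terms of the action on arrows. -/
lemma cell_res_iff {a' b' : B} {f : a ⟶ a} {f' : a' ⟶ a'} {g : b ⟶ b} {g'' g' : b' ⟶ b'}
    {φ : a ⟶ b} {φ' : a' ⟶ b'} {s : a' ⟶ a} {t : b' ⟶ b} (M' : f' ≫ φ' ⟶ φ' ≫ g'')
    (n : g'' ⟶ g') (r : g' ≫ t ⟶ t ≫ g) (p : φ' ≫ t ⟶ s ≫ φ) (r' : f' ≫ s ⟶ s ≫ f)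
    (M : f ≫ φ ⟶ φ ≫ g) (h : z ⟶ a') :
    cell₂ M' h ▷ t ≫ ((h ≫ φ') ◁ n) ▷ t ≫ cell₂ r (h ≫ φ') ≫ cell₂ p h ▷ g =
        cell₂ p (h ≫ f') ≫ cell₂ r' h ▷ φ ≫ cell₂ M (h ≫ s) ↔
      h ◁ (M' ▷ t ≫ (α_ _ _ _).hom ≫ _ ◁ (n ▷ _ ≫ r) ≫ (α_ _ _ _).inv ≫ p ▷ _) =
        h ◁ ((α_ _ _ _).hom ≫ _ ◁ p ≫ (α_ _ _ _).inv ≫ r' ▷ _ ≫ (α_ _ _ _).hom ≫ _ ◁ M ≫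
          (α_ _ _ _).inv) := by
  have e1 : cell₂ M' h ▷ t ≫ ((h ≫ φ') ◁ n) ▷ t ≫ cell₂ r (h ≫ φ') ≫ cell₂ p h ▷ g =
      (((α_ h f' φ').hom ▷ t ≫ (α_ _ _ _).hom) ≫ h ◁ (M' ▷ t ≫ (α_ _ _ _).hom ≫ _ ◁ (n ▷ _ ≫ r) ≫
        (α_ _ _ _).inv ≫ p ▷ _)) ≫ (α_ _ _ _).inv ≫ (α_ h s φ).inv ▷ g := by
    simp only [cell₀, cell₁, cell₂]; bicategory
  have e2 : cell₂ p (h ≫ f') ≫ cell₂ r' h ▷ φ ≫ cell₂ M (h ≫ s) =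
      (((α_ h f' φ').hom ▷ t ≫ (α_ _ _ _).hom) ≫ h ◁ ((α_ _ _ _).hom ≫ _ ◁ p ≫ (α_ _ _ _).inv ≫
        r' ▷ _ ≫ (α_ _ _ _).hom ≫ _ ◁ M ≫ (α_ _ _ _).inv)) ≫ (α_ _ _ _).inv ≫
        (α_ h s φ).inv ▷ g := by
    simp only [cell₀, cell₁, cell₂]; bicategory
  rw [e1, e2, cancel_mono, cancel_epi]

/-- The cube of a brace, in terms of the action on arrows. -/
lemma cell_brace_iff {p q r : B} {γ : r ⟶ r} {lγ g ll : p ⟶ p} {ql : q ⟶ q} {φpr : r ⟶ p}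
    {φqr : r ⟶ q} {φpq : q ⟶ p} (Mpr : γ ≫ φpr ⟶ φpr ≫ lγ) (X : lγ ≫ g ⟶ g ≫ ll)
    (m : φpr ≫ g ⟶ φqr ≫ φpq) (Mqr : γ ≫ φqr ⟶ φqr ≫ ql) (Mpq : ql ≫ φpq ⟶ φpq ≫ ll)
    (h : z ⟶ r) :
    cell₂ Mpr h ▷ g ≫ cell₂ X (h ≫ φpr) ≫ cell₂ m h ▷ ll =
        cell₂ m (h ≫ γ) ≫ cell₂ Mqr h ▷ φpq ≫ cell₂ Mpq (h ≫ φqr) ↔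
      h ◁ (Mpr ▷ g ≫ (α_ _ _ _).hom ≫ φpr ◁ X ≫ (α_ _ _ _).inv ≫ m ▷ _) =
        h ◁ ((α_ _ _ _).hom ≫ γ ◁ m ≫ (α_ _ _ _).inv ≫ Mqr ▷ φpq ≫ (α_ _ _ _).hom ≫
          φqr ◁ Mpq ≫ (α_ _ _ _).inv) := by
  have e1 : cell₂ Mpr h ▷ g ≫ cell₂ X (h ≫ φpr) ≫ cell₂ m h ▷ ll =
      (((α_ h γ φpr).hom ▷ g ≫ (α_ _ _ _).hom) ≫ h ◁ (Mpr ▷ g ≫ (α_ _ _ _).hom ≫ φpr ◁ X ≫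
        (α_ _ _ _).inv ≫ m ▷ _)) ≫ (α_ _ _ _).inv ≫ (α_ h φqr φpq).inv ▷ ll := by
    simp only [cell₀, cell₁, cell₂]; bicategory
  have e2 : cell₂ m (h ≫ γ) ≫ cell₂ Mqr h ▷ φpq ≫ cell₂ Mpq (h ≫ φqr) =
      (((α_ h γ φpr).hom ▷ g ≫ (α_ _ _ _).hom) ≫ h ◁ ((α_ _ _ _).hom ≫ γ ◁ m ≫ (α_ _ _ _).inv ≫
        Mqr ▷ φpq ≫ (α_ _ _ _).hom ≫ φqr ◁ Mpq ≫ (α_ _ _ _).inv)) ≫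
        (α_ _ _ _).inv ≫ (α_ h φqr φpq).inv ▷ ll := by
    simp only [cell₀, cell₁, cell₂]; bicategory
  rw [e1, e2, cancel_mono, cancel_epi]

/-- The cube of an arrow `ν`, in terms of the action on arrows. -/
lemma cell_nu_iff {i j k l : B} {gijl lg gijk gikl : i ⟶ i} {gjkl : j ⟶ j} {φil : l ⟶ i}
    {φkl : l ⟶ k} {φik : k ⟶ i} {φij : j ⟶ i} {φjl : l ⟶ j} {φjk : k ⟶ j}
    (Y : gijl ≫ lg ⟶ gikl ≫ gijk) (mikl : φil ≫ gikl ⟶ φkl ≫ φik) (mijk : φik ≫ gijk ⟶ φjk ≫ φij)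
    (mijl : φil ≫ gijl ⟶ φjl ≫ φij) (M : φij ≫ lg ⟶ gjkl ≫ φij) (mjkl : φjl ≫ gjkl ⟶ φkl ≫ φjk)
    (h : z ⟶ l) :
    cell₂ Y (h ≫ φil) ≫ cell₂ mikl h ▷ gijk ≫ cell₂ mijk (h ≫ φkl) =
        cell₂ mijl h ▷ lg ≫ cell₂ M (h ≫ φjl) ≫ cell₂ mjkl h ▷ φij ↔
      h ◁ (φil ◁ Y ≫ (α_ _ _ _).inv ≫ mikl ▷ gijk ≫ (α_ _ _ _).hom ≫ φkl ◁ mijk) =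
        h ◁ ((α_ _ _ _).inv ≫ mijl ▷ _ ≫ (α_ _ _ _).hom ≫ φjl ◁ M ≫ (α_ _ _ _).inv ≫
          mjkl ▷ φij ≫ (α_ _ _ _).hom) := by
  have e1 : cell₂ Y (h ≫ φil) ≫ cell₂ mikl h ▷ gijk ≫ cell₂ mijk (h ≫ φkl) =
      (((α_ _ _ _).hom ≫ (α_ h φil _).hom) ≫ h ◁ (φil ◁ Y ≫ (α_ _ _ _).inv ≫ mikl ▷ gijk ≫
        (α_ _ _ _).hom ≫ φkl ◁ mijk)) ≫ (α_ h φkl _).inv ≫ (α_ _ _ _).inv := by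
    simp only [cell₀, cell₁, cell₂]; bicategory
  have e2 : cell₂ mijl h ▷ lg ≫ cell₂ M (h ≫ φjl) ≫ cell₂ mjkl h ▷ φij =
      (((α_ _ _ _).hom ≫ (α_ h φil _).hom) ≫ h ◁ ((α_ _ _ _).inv ≫ mijl ▷ _ ≫ (α_ _ _ _).hom ≫
        φjl ◁ M ≫ (α_ _ _ _).inv ≫ mjkl ▷ φij ≫ (α_ _ _ _).hom)) ≫
        (α_ h φkl _).inv ≫ (α_ _ _ _).inv := by
    simp only [cell₀, cell₁, cell₂]; bicategory
  rw [e1, e2, cancel_mono, cancel_epi]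

/-- Transitivity of the cells of restriction, in terms of the action on arrows. -/
lemma cell_comp_of {x₁ x₂ x₃ : B} {f₁ f₁' : x₁ ⟶ x₁} {f₂ : x₂ ⟶ x₂} {f₃ : x₃ ⟶ x₃} {s : x₁ ⟶ x₂}
    {t : x₂ ⟶ x₃} {r : x₁ ⟶ x₃} (n : f₁ ⟶ f₁') (c₁₃ : f₁' ≫ r ⟶ r ≫ f₃) (c₁₂ : f₁ ≫ s ⟶ s ≫ f₂)
    (c₂₃ : f₂ ≫ t ⟶ t ≫ f₃) (T : s ≫ t ⟶ r) [IsIso T]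
    (H : n ▷ _ ≫ c₁₃ = _ ◁ inv T ≫ (α_ _ _ _).inv ≫ c₁₂ ▷ _ ≫ (α_ _ _ _).hom ≫ _ ◁ c₂₃ ≫
      (α_ _ _ _).inv ≫ T ▷ _) (h : z ⟶ x₁) :
    cell₁ T (h ≫ f₁) ≫ (h ◁ n) ▷ r ≫ cell₂ c₁₃ h =
      cell₂ c₁₂ h ▷ t ≫ cell₂ c₂₃ (h ≫ s) ≫ cell₁ T h ▷ f₃ := by
  have e1 : cell₁ T (h ≫ f₁) ≫ (h ◁ n) ▷ r ≫ cell₂ c₁₃ h = ((α_ _ _ _).hom ≫ (α_ _ _ _).hom) ≫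
      h ◁ (f₁ ◁ T ≫ n ▷ _ ≫ c₁₃) ≫ (α_ _ _ _).inv := by
    simp only [cell₀, cell₁, cell₂]; bicategory
  rw [e1, H, ← whiskerLeft_comp_assoc, IsIso.hom_inv_id]
  simp only [cell₀, cell₁, cell₂]
  bicategory

/-- Transitivity of two-arrows, in terms of the action on arrows. -/
lemma cell_triangle_of {x₁ x₂ x₃ x₄ : B} {s : x₁ ⟶ x₂} {t : x₂ ⟶ x₃} {st : x₁ ⟶ x₃} {r₁ : x₁ ⟶ x₄}
    {r₂ : x₂ ⟶ x₄} {r₃ : x₃ ⟶ x₄} (T : s ≫ t ⟶ st) (c₂₃ : t ≫ r₃ ⟶ r₂) (c₁₂ : s ≫ r₂ ⟶ r₁)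
    (c₁₃ : st ≫ r₃ ⟶ r₁) (H : T ▷ r₃ ≫ c₁₃ = (α_ _ _ _).hom ≫ s ◁ c₂₃ ≫ c₁₂) (h : z ⟶ x₁) :
    cell₁ T h ▷ r₃ ≫ cell₁ c₁₃ h = cell₁ c₂₃ (h ≫ s) ≫ cell₁ c₁₂ h := by
  have e1 : cell₁ T h ▷ r₃ ≫ cell₁ c₁₃ h = (α_ h s t).hom ▷ r₃ ≫ (α_ _ _ _).hom ≫
      h ◁ (T ▷ r₃ ≫ c₁₃) := by
    simp only [cell₀, cell₁, cell₂]; bicategory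
  rw [e1, H]
  simp only [cell₀, cell₁, cell₂]
  bicategory

/-- The two-arrow comparing the restrictions of a path, in terms of the action on arrows. -/
lemma cell_path_of {x₁ x₂ x₃ y₁ y₂ y₃ : B} {s : x₁ ⟶ x₂} {t : x₂ ⟶ x₃} {st : x₁ ⟶ x₃}
    {s' : y₁ ⟶ y₂} {t' : y₂ ⟶ y₃} {st' : y₁ ⟶ y₃} {φ₁ : x₁ ⟶ y₁} {φ₂ : x₂ ⟶ y₂} {φ₃ : x₃ ⟶ y₃}
    (T : s ≫ t ⟶ st) [IsIso T] (T' : s' ≫ t' ⟶ st') (p₁₂ : φ₁ ≫ s' ⟶ s ≫ φ₂)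
    (p₂₃ : φ₂ ≫ t' ≅ t ≫ φ₃) (p₁₃ : φ₁ ≫ st' ⟶ st ≫ φ₃)
    (H : p₁₂ ▷ t' = (α_ _ _ _).hom ≫ _ ◁ T' ≫ p₁₃ ≫ inv T ▷ φ₃ ≫ (α_ _ _ _).hom ≫ _ ◁ p₂₃.inv ≫
      (α_ _ _ _).inv) (h : z ⟶ x₁) :
    cell₂ p₁₂ h ▷ t' ≫ cell₂ p₂₃.hom (h ≫ s) ≫ cell₁ T h ▷ φ₃ = cell₁ T' (h ≫ φ₁) ≫ cell₂ p₁₃ h := by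
  have e1 : cell₂ p₁₂ h ▷ t' ≫ cell₂ p₂₃.hom (h ≫ s) ≫ cell₁ T h ▷ φ₃ = (α_ h φ₁ s').hom ▷ t' ≫
      (α_ _ _ _).hom ≫ h ◁ (p₁₂ ▷ t' ≫ (α_ _ _ _).hom ≫ s ◁ p₂₃.hom ≫ (α_ _ _ _).inv ≫ T ▷ φ₃) ≫
      (α_ _ _ _).inv := by
    simp only [cell₀, cell₁, cell₂]; bicategory
  rw [e1, H]
  simp only [Category.assoc, Iso.inv_hom_id_assoc, whiskerLeft_inv_hom_assoc, Iso.hom_inv_id_assoc,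
    ← comp_whiskerRight, IsIso.inv_hom_id, id_whiskerRight, Category.comp_id]
  simp only [cell₀, cell₁, cell₂]
  bicategory

/-- The restriction of a triangle of paths, in terms of the action on arrows. -/
lemma cell_triangle_res_of {i j k i' j' k' : B} {g : i ⟶ i} {g' : i' ⟶ i'} {ti : i' ⟶ i}
    {tj : j' ⟶ j} {tk : k' ⟶ k} {φik : k ⟶ i} {φjk : k ⟶ j} {φij : j ⟶ i} {φik' : k' ⟶ i'}
    {φjk' : k' ⟶ j'} {φij' : j' ⟶ i'} (m' : φik' ≫ g' ⟶ φjk' ≫ φij') (m : φik ≫ g ⟶ φjk ≫ φij)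
    (r : g' ≫ ti ⟶ ti ≫ g) (pik : φik' ≫ ti ⟶ tk ≫ φik) (pij : φij' ≫ ti ⟶ tj ≫ φij)
    (pjk : φjk' ≫ tj ⟶ tk ≫ φjk) [IsIso pij] [IsIso pjk]
    (H : m' ▷ ti = (α_ _ _ _).hom ≫ _ ◁ r ≫ (α_ _ _ _).inv ≫ pik ▷ _ ≫ (α_ _ _ _).hom ≫ _ ◁ m ≫
      (α_ _ _ _).inv ≫ inv pjk ▷ _ ≫ (α_ _ _ _).hom ≫ _ ◁ inv pij ≫ (α_ _ _ _).inv) (h : z ⟶ k') :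
    cell₂ m' h ▷ ti ≫ cell₂ pij (h ≫ φjk') ≫ cell₂ pjk h ▷ φij =
      cell₂ r (h ≫ φik') ≫ cell₂ pik h ▷ g ≫ cell₂ m (h ≫ tk) := by
  have e1 : cell₂ m' h ▷ ti ≫ cell₂ pij (h ≫ φjk') ≫ cell₂ pjk h ▷ φij =
      (α_ h φik' g').hom ▷ ti ≫ (α_ _ _ _).hom ≫ h ◁ (m' ▷ ti ≫ (α_ _ _ _).hom ≫ _ ◁ pij ≫
      (α_ _ _ _).inv ≫ pjk ▷ _ ≫ (α_ _ _ _).hom) ≫ (α_ _ _ _).inv ≫ (α_ _ _ _).inv := by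
    simp only [cell₀, cell₁, cell₂]; bicategory
  rw [e1, H]
  simp only [Category.assoc, Iso.inv_hom_id_assoc, Iso.hom_inv_id_assoc, IsIso.inv_hom_id,
    whiskerLeft_inv_hom_assoc, ← whiskerLeft_comp_assoc φjk', ← comp_whiskerRight_assoc,
    id_whiskerRight, Category.id_comp, Bicategory.whiskerLeft_id]
  simp only [cell₀, cell₁, cell₂]
  bicategory

/-! ### The action of `C` on the arrows with target `x` -/

section Action

open MonoidalCategory

variable {C : Type*} [Category C] [MonoidalCategory C] {x : B} (F : C ⥤ (x ⟶ x)ᴹᵒᵖ) [F.Monoidal]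

lemma actMap_id (γ : C) : actMap F (𝟙 γ) = 𝟙 _ := by simp [actMap, actObj]

lemma actMap_comp {γ δ κ : C} (f : γ ⟶ δ) (f' : δ ⟶ κ) :
    actMap F (f ≫ f') = actMap F f ≫ actMap F f' := congrArg Quiver.Hom.unmop (F.map_comp f f')

lemma actMul_left {γ γ' : C} (f : γ ⟶ γ') (δ : C) :
    Bicategory.whiskerLeft (actObj F δ) (actMap F f) ≫ actMul F γ' δ =
      actMul F γ δ ≫ actMap F (MonoidalCategory.whiskerRight f δ) :=
  congrArg Quiver.Hom.unmop (Functor.LaxMonoidal.μ_natural_left (F := F) f δ)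

lemma actMul_right (γ : C) {δ δ' : C} (f : δ ⟶ δ') :
    Bicategory.whiskerRight (actMap F f) (actObj F γ) ≫ actMul F γ δ' =
      actMul F γ δ ≫ actMap F (MonoidalCategory.whiskerLeft γ f) :=
  congrArg Quiver.Hom.unmop (Functor.LaxMonoidal.μ_natural_right (F := F) γ f)

lemma actMul_assoc (γ δ κ : C) :
    Bicategory.whiskerLeft (actObj F κ) (actMul F γ δ) ≫ actMul F (γ ⊗ δ) κ ≫
        actMap F (MonoidalCategory.associator γ δ κ).hom =
      (Bicategory.associator _ _ _).inv ≫
        Bicategory.whiskerRight (actMul F δ κ) (actObj F γ) ≫ actMul F γ (δ ⊗ κ) :=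
  congrArg Quiver.Hom.unmop (Functor.LaxMonoidal.associativity F γ δ κ)

lemma actUnit_left (γ : C) : (Bicategory.rightUnitor _).hom =
    Bicategory.whiskerLeft (actObj F γ) (actUnit F) ≫ actMul F (𝟙_ C) γ ≫
      actMap F (MonoidalCategory.leftUnitor γ).hom :=
  congrArg Quiver.Hom.unmop (Functor.LaxMonoidal.left_unitality F γ)

lemma actUnit_right (γ : C) : (Bicategory.leftUnitor _).hom =
    Bicategory.whiskerRight (actUnit F) (actObj F γ) ≫ actMul F γ (𝟙_ C) ≫
      actMap F (MonoidalCategory.rightUnitor γ).hom :=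
  congrArg Quiver.Hom.unmop (Functor.LaxMonoidal.right_unitality F γ)

/-- The action of `C` on the arrows with target `x` attached to a monoidal functor from `C` to the
endomorphisms of `x`. -/
noncomputable def arrowAction [∀ a b : B, IsGroupoid (a ⟶ b)] (z : B) : LeftAction C (z ⟶ x) where
  act :=
    { obj := fun γ => postcomp z (actObj F γ)
      map := fun f =>
        { app := fun h => Bicategory.whiskerLeft h (actMap F f)
          naturality := fun h h' u => (Bicategory.whisker_exchange u (actMap F f)).symm }
      map_id := fun γ => by ext h; simp [actMap_id]; rfl
      map_comp := fun f f' => by ext h; simp [actMap_comp]; rfl }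
  mul γ δ h := @asIso (z ⟶ x) _ _ _ (cell₁ (actMul F γ δ) h) (IsGroupoid.all_isIso _)
  unit h := @asIso (z ⟶ x) _ _ _ (cell₀ (actUnit F) h) (IsGroupoid.all_isIso _)
  mul_left {γ γ'} f δ h := by
    change Bicategory.whiskerLeft (h ≫ actObj F δ) (actMap F f) ≫ cell₁ (actMul F γ' δ) h =
      cell₁ (actMul F γ δ) h ≫ Bicategory.whiskerLeft h (actMap F _)
    have e := congrArg (fun t => Bicategory.whiskerLeft h t) (actMul_left F f δ)
    simp only [Bicategory.whiskerLeft_comp] at e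
    simp only [cell₀, cell₁]; simpa using e
  mul_right γ δ δ' f h := by
    change Bicategory.whiskerRight (Bicategory.whiskerLeft h (actMap F f)) _ ≫
      cell₁ (actMul F γ δ') h = cell₁ (actMul F γ δ) h ≫ Bicategory.whiskerLeft h (actMap F _)
    have e := congrArg (fun t => Bicategory.whiskerLeft h t) (actMul_right F γ f)
    simp only [Bicategory.whiskerLeft_comp] at e
    simp only [cell₀, cell₁]; simpa using e
  mul_nat γ δ h h' u := cell₁_nat _ u
  unit_nat u := cell₀_nat _ u
  assoc γ δ κ h := by
    change cell₁ (actMul F γ δ) (h ≫ actObj F κ) ≫ cell₁ (actMul F _ κ) h ≫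
      Bicategory.whiskerLeft h (actMap F _) =
        Bicategory.whiskerRight (cell₁ (actMul F δ κ) h) _ ≫ cell₁ (actMul F γ _) h
    have e := congrArg (fun t => Bicategory.whiskerLeft h t) (actMul_assoc F γ δ κ)
    simp only [Bicategory.whiskerLeft_comp] at e
    simp only [cell₀, cell₁]; simp [e]
  left_unit γ h := by
    change cell₀ (actUnit F) (h ≫ actObj F γ) ≫ cell₁ (actMul F _ γ) h ≫
      Bicategory.whiskerLeft h (actMap F _) = 𝟙 (h ≫ actObj F γ)
    have e := congrArg (fun t => Bicategory.whiskerLeft h t) (actUnit_left F γ)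
    simp only [Bicategory.whiskerLeft_comp] at e
    simp only [cell₀, cell₁]; simp [← e]
  right_unit γ h := by
    change Bicategory.whiskerRight (cell₀ (actUnit F) h) _ ≫ cell₁ (actMul F γ _) h ≫
      Bicategory.whiskerLeft h (actMap F _) = 𝟙 (h ≫ actObj F γ)
    have e := congrArg (fun t => Bicategory.whiskerLeft h t) (actUnit_right F γ)
    simp only [Bicategory.whiskerLeft_comp] at e
    simp only [cell₀, cell₁]; simp [← e]

variable [∀ a b : B, IsGroupoid (a ⟶ b)]

lemma arrowAction_mul_inv (γ δ : C) (h : z ⟶ x) :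
    ((arrowAction F z).mul γ δ h).inv =
      Bicategory.whiskerLeft h (inv (actMul F γ δ)) ≫ (Bicategory.associator _ _ _).inv := by
  have e : cell₁ (actMul F γ δ) h ≫ Bicategory.whiskerLeft h (inv (actMul F γ δ)) ≫
      (Bicategory.associator _ _ _).inv = 𝟙 _ := by
    simp [cell₁, ← Bicategory.whiskerLeft_comp_assoc]
  exact @IsIso.inv_eq_of_hom_inv_id _ _ _ _ _ (IsGroupoid.all_isIso _) _ e

/-- Identifies `two` with the whiskering of the two-arrow between composites that occurs in the
cubes of `Induces`. With the `cell_…_iff` lemmas, it makes those cubes the same as the cubes of a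
transition system. -/
lemma arrowAction_two {γ δ γ' δ' : C} (f : γ ⊗ δ ⟶ γ' ⊗ δ') (h : z ⟶ x) :
    (arrowAction F z).two f h =
      cell₂ (actMul F γ δ ≫ actMap F f ≫ inv (actMul F γ' δ')) h := by
  rw [LeftAction.two, arrowAction_mul_inv]
  change ((Bicategory.associator _ _ _).hom ≫ Bicategory.whiskerLeft h (actMul F γ δ)) ≫
    Bicategory.whiskerLeft h (actMap F f) ≫ _ = _
  simp [cell₂]
  rfl

end Action

end Cells

end Breen

/-! ### Coherence of restriction of paths, and cartesian arrows -/

namespace Breen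

open CategoryTheory TopologicalSpace

section Cells

open Bicategory

variable {B : Type*} [Bicategory B] [∀ a b : B, IsGroupoid (a ⟶ b)]

instance {a b c z : B} {f : a ⟶ b} {g : b ⟶ c} {k : a ⟶ c} (α : f ≫ g ⟶ k) (h : z ⟶ a) :
    IsIso (cell₁ α h) := IsGroupoid.all_isIso _

instance {a b b' c z : B} {f : a ⟶ b} {g : b ⟶ c} {f' : a ⟶ b'} {g' : b' ⟶ c}
    (α : f ≫ g ⟶ f' ≫ g') (h : z ⟶ a) : IsIso (cell₂ α h) := IsGroupoid.all_isIso _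

/-- The action of a two-arrow `f ≫ g ⟶ f' ≫ g'` on an arrow `h`, as an isomorphism. -/
noncomputable abbrev cell₂Iso {a b b' c z : B} {f : a ⟶ b} {g : b ⟶ c} {f' : a ⟶ b'} {g' : b' ⟶ c}
    (α : f ≫ g ⟶ f' ≫ g') (h : z ⟶ a) : (h ≫ f) ≫ g ≅ (h ≫ f') ≫ g' := asIso (cell₂ α h)

/-- Transitivity of the comparison of the restrictions of a triangle of paths. -/
lemma cell_triangle_trans {z i j k i' j' k' i'' j'' k'' : B}
    {ti : i' ⟶ i} {tj : j' ⟶ j} {tk : k' ⟶ k} {si : i'' ⟶ i'} {sj : j'' ⟶ j'} {sk : k'' ⟶ k'}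
    {ri : i'' ⟶ i} {rj : j'' ⟶ j} {rk : k'' ⟶ k} (Ti : si ≫ ti ⟶ ri) (Tj : sj ≫ tj ⟶ rj)
    (Tk : sk ≫ tk ⟶ rk)
    {φik : k ⟶ i} {φjk : k ⟶ j} {φij : j ⟶ i} {φik' : k' ⟶ i'} {φjk' : k' ⟶ j'} {φij' : j' ⟶ i'}
    {φik'' : k'' ⟶ i''} {φjk'' : k'' ⟶ j''} {φij'' : j'' ⟶ i''}
    {g : i ⟶ i} {g' : i' ⟶ i'} {f g'' : i'' ⟶ i''} (n : f ≅ g'')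
    (m : φik ≫ g ⟶ φjk ≫ φij) (m' : φik' ≫ g' ⟶ φjk' ≫ φij') (m'' : φik'' ≫ g'' ⟶ φjk'' ≫ φij'')
    (r : g' ≫ ti ⟶ ti ≫ g) (r' : f ≫ si ⟶ si ≫ g') (r'' : g'' ≫ ri ⟶ ri ≫ g)
    (pik : φik' ≫ ti ⟶ tk ≫ φik) (pij : φij' ≫ ti ⟶ tj ≫ φij) (pjk : φjk' ≫ tj ⟶ tk ≫ φjk)
    (pik' : φik'' ≫ si ⟶ sk ≫ φik') (pij' : φij'' ≫ si ⟶ sj ≫ φij')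
    (pjk' : φjk'' ≫ sj ⟶ sk ≫ φjk')
    (pik'' : φik'' ≫ ri ⟶ rk ≫ φik) (pij'' : φij'' ≫ ri ⟶ rj ≫ φij)
    (pjk'' : φjk'' ≫ rj ⟶ rk ≫ φjk)
    (Hr : ∀ h : z ⟶ i'', cell₁ Ti (h ≫ f) ≫ (h ◁ n.hom) ▷ ri ≫ cell₂ r'' h =
      cell₂ r' h ▷ ti ≫ cell₂ r (h ≫ si) ≫ cell₁ Ti h ▷ g)
    (Hik : ∀ h : z ⟶ k'', cell₂ pik' h ▷ ti ≫ cell₂ pik (h ≫ sk) ≫ cell₁ Tk h ▷ φik =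
      cell₁ Ti (h ≫ φik'') ≫ cell₂ pik'' h)
    (Hjk : ∀ h : z ⟶ k'', cell₂ pjk' h ▷ tj ≫ cell₂ pjk (h ≫ sk) ≫ cell₁ Tk h ▷ φjk =
      cell₁ Tj (h ≫ φjk'') ≫ cell₂ pjk'' h)
    (Hij : ∀ h : z ⟶ j'', cell₂ pij' h ▷ ti ≫ cell₂ pij (h ≫ sj) ≫ cell₁ Tj h ▷ φij =
      cell₁ Ti (h ≫ φij'') ≫ cell₂ pij'' h)
    (H'' : ∀ h : z ⟶ k'', cell₂ m'' h ▷ ri ≫ cell₂ pij'' (h ≫ φjk'') ≫ cell₂ pjk'' h ▷ φij =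
      cell₂ r'' (h ≫ φik'') ≫ cell₂ pik'' h ▷ g ≫ cell₂ m (h ≫ rk))
    (H : ∀ h : z ⟶ k', cell₂ m' h ▷ ti ≫ cell₂ pij (h ≫ φjk') ≫ cell₂ pjk h ▷ φij =
      cell₂ r (h ≫ φik') ≫ cell₂ pik h ▷ g ≫ cell₂ m (h ≫ tk))
    (hinj : ∀ {a b : z ⟶ i'} (α β : a ⟶ b), α ▷ ti = β ▷ ti → α = β) (h : z ⟶ k'') :
    cell₂ m'' h ▷ si ≫ cell₂ pij' (h ≫ φjk'') ≫ cell₂ pjk' h ▷ φij' =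
      ((h ≫ φik'') ◁ n.inv) ▷ si ≫ cell₂ r' (h ≫ φik'') ≫ cell₂ pik' h ▷ g' ≫
        cell₂ m' (h ≫ sk) := by
  apply hinj
  rw [← cancel_mono (cell₂ pij ((h ≫ sk) ≫ φjk') ≫ cell₂ pjk (h ≫ sk) ▷ φij ≫
    cell₁ Tk h ▷ φjk ▷ φij)]
  -- After composition with `ti`, both sides are compared with the restriction of `m` itself,
  -- through `H''` on one side and `H` on the other.
  trans cell₁ Ti _ ≫ cell₂ r'' (h ≫ φik'') ≫ cell₂ pik'' h ▷ g ≫ cell₂ m (h ≫ rk)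
  · have a1 := cell₂_nat pij (cell₂ pjk' h)
    have a2 := congrArg (fun α => α ▷ φij) (Hjk h)
    have a3 := Hij (h ≫ φjk'')
    have a4 := cell₁_nat Ti (cell₂ m'' h)
    simp only [comp_whiskerRight, Category.assoc] at a2 ⊢
    rw [reassoc_of% a1, a2, reassoc_of% a3, reassoc_of% a4, H'']
  · have a1 := H (h ≫ sk)
    have a2 := cell₂_nat r (cell₂ pik' h)
    have a3 := cell₂_nat m (cell₁ Tk h)
    have a4 := congrArg (fun α => α ▷ g) (Hik h)
    have a5 := Hr (h ≫ φik'')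
    have a6 := cell₁_nat Ti ((h ≫ φik'') ◁ n.inv)
    simp only [comp_whiskerRight, Category.assoc] at a4 ⊢
    rw [reassoc_of% a1, reassoc_of% a2, ← a3, reassoc_of% a4, ← reassoc_of% a5, reassoc_of% a6,
      ← comp_whiskerRight_assoc, ← whiskerLeft_comp, Iso.inv_hom_id]
    simp

/-- Associativity of the transitivity of restrictions, from its compatibility with arrows to an
object. -/
lemma cell_assoc_of {z x₁ x₂ x₃ x₄ x : B} {a : x₁ ⟶ x₂} {b : x₂ ⟶ x₃} {c : x₃ ⟶ x₄} {ab : x₁ ⟶ x₃}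
    {bc : x₂ ⟶ x₄} {abc : x₁ ⟶ x₄} (T₁ : a ≫ b ⟶ ab) (T₂ : b ≫ c ⟶ bc) (T₃ : ab ≫ c ⟶ abc)
    (T₄ : a ≫ bc ⟶ abc) {e₁ : x₁ ⟶ x} {e₂ : x₂ ⟶ x} {e₃ : x₃ ⟶ x} {e₄ : x₄ ⟶ x}
    (ca : a ≫ e₂ ⟶ e₁) (cb : b ≫ e₃ ⟶ e₂) (cc : c ≫ e₄ ⟶ e₃) (cab : ab ≫ e₃ ⟶ e₁)
    (cbc : bc ≫ e₄ ⟶ e₂) (cabc : abc ≫ e₄ ⟶ e₁)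
    (H₁ : ∀ h : z ⟶ x₁, cell₁ T₁ h ▷ e₃ ≫ cell₁ cab h = cell₁ cb (h ≫ a) ≫ cell₁ ca h)
    (H₂ : ∀ h : z ⟶ x₂, cell₁ T₂ h ▷ e₄ ≫ cell₁ cbc h = cell₁ cc (h ≫ b) ≫ cell₁ cb h)
    (H₃ : ∀ h : z ⟶ x₁, cell₁ T₃ h ▷ e₄ ≫ cell₁ cabc h = cell₁ cc (h ≫ ab) ≫ cell₁ cab h)
    (H₄ : ∀ h : z ⟶ x₁, cell₁ T₄ h ▷ e₄ ≫ cell₁ cabc h = cell₁ cbc (h ≫ a) ≫ cell₁ ca h)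
    (hinj : ∀ {p q : z ⟶ x₄} (α β : p ⟶ q), α ▷ e₄ = β ▷ e₄ → α = β) (h : z ⟶ x₁) :
    cell₁ T₁ h ▷ c ≫ cell₁ T₃ h = cell₁ T₂ (h ≫ a) ≫ cell₁ T₄ h := by
  apply hinj
  rw [← cancel_mono (cell₁ cabc h)]
  have n := cell₁_nat cc (cell₁ T₁ h)
  have a2 := H₂ (h ≫ a)
  simp only [comp_whiskerRight, Category.assoc]
  rw [H₃, reassoc_of% n, H₁, H₄, reassoc_of% a2]

/-- Transitivity of the comparison of the restrictions of a path. -/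
lemma cell_path_trans {z x₁ x₂ x₃ x y₁ y₂ y₃ y : B} {a : x₁ ⟶ x₂} {b : x₂ ⟶ x₃} {ab : x₁ ⟶ x₃}
    {e₁ : x₁ ⟶ x} {e₂ : x₂ ⟶ x} {e₃ : x₃ ⟶ x} {a' : y₁ ⟶ y₂} {b' : y₂ ⟶ y₃} {ab' : y₁ ⟶ y₃}
    {e₁' : y₁ ⟶ y} {e₂' : y₂ ⟶ y} {e₃' : y₃ ⟶ y} {φ₁ : x₁ ⟶ y₁} {φ₂ : x₂ ⟶ y₂} {φ₃ : x₃ ⟶ y₃}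
    {φ : x ⟶ y} (T : a ≫ b ⟶ ab) (ca : a ≫ e₂ ⟶ e₁) (cb : b ≫ e₃ ⟶ e₂) (cab : ab ≫ e₃ ⟶ e₁)
    (T' : a' ≫ b' ⟶ ab') (ca' : a' ≫ e₂' ⟶ e₁') (cb' : b' ≫ e₃' ⟶ e₂') (cab' : ab' ≫ e₃' ⟶ e₁')
    (pa : φ₁ ≫ a' ⟶ a ≫ φ₂) (pb : φ₂ ≫ b' ⟶ b ≫ φ₃) (pab : φ₁ ≫ ab' ⟶ ab ≫ φ₃)
    (q₁ : φ₁ ≫ e₁' ⟶ e₁ ≫ φ) (q₂ : φ₂ ≫ e₂' ⟶ e₂ ≫ φ) (q₃ : φ₃ ≫ e₃' ⟶ e₃ ≫ φ)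
    (H : ∀ h : z ⟶ x₁, cell₁ T h ▷ e₃ ≫ cell₁ cab h = cell₁ cb (h ≫ a) ≫ cell₁ ca h)
    (H' : ∀ h : z ⟶ y₁, cell₁ T' h ▷ e₃' ≫ cell₁ cab' h = cell₁ cb' (h ≫ a') ≫ cell₁ ca' h)
    (Ha : ∀ h : z ⟶ x₁, cell₂ pa h ▷ e₂' ≫ cell₂ q₂ (h ≫ a) ≫ cell₁ ca h ▷ φ =
      cell₁ ca' (h ≫ φ₁) ≫ cell₂ q₁ h)
    (Hb : ∀ h : z ⟶ x₂, cell₂ pb h ▷ e₃' ≫ cell₂ q₃ (h ≫ b) ≫ cell₁ cb h ▷ φ =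
      cell₁ cb' (h ≫ φ₂) ≫ cell₂ q₂ h)
    (Hab : ∀ h : z ⟶ x₁, cell₂ pab h ▷ e₃' ≫ cell₂ q₃ (h ≫ ab) ≫ cell₁ cab h ▷ φ =
      cell₁ cab' (h ≫ φ₁) ≫ cell₂ q₁ h)
    (hinj : ∀ {p q : z ⟶ y₃} (α β : p ⟶ q), α ▷ e₃' = β ▷ e₃' → α = β) (h : z ⟶ x₁) :
    cell₂ pa h ▷ b' ≫ cell₂ pb (h ≫ a) ≫ cell₁ T h ▷ φ₃ = cell₁ T' (h ≫ φ₁) ≫ cell₂ pab h := by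
  apply hinj
  rw [← cancel_mono (cell₂ q₃ (h ≫ ab) ≫ cell₁ cab h ▷ φ)]
  have n := cell₂_nat q₃ (cell₁ T h)
  have n' := cell₁_nat cb' (cell₂ pa h)
  have a1 := congrArg (fun α => α ▷ φ) (H h)
  have a2 := Hb (h ≫ a)
  have a3 := H' (h ≫ φ₁)
  simp only [comp_whiskerRight, Category.assoc] at a1 ⊢
  rw [reassoc_of% n, a1, reassoc_of% a2, reassoc_of% n', Ha, Hab, reassoc_of% a3]

end Cells

namespace FibredTwoGroupoid

open Bicategory

variable {X : Type w} [TopologicalSpace X] {P : FibredTwoGroupoid.{w, w₁, v₁, u₁} X}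
  {x y z : P.Ob}

/-- `trComp` was obtained by cancelling the arrow to `x`; this is its defining equation in whiskered
form. -/
lemma cell_trComp_restrHom (x : P.Ob) {Z W V : Opens X} (h'' : Z ≤ W) (h' : W ≤ V)
    (h : V ≤ P.base x) (k : z ⟶ _) :
    cell₁ (trComp x h'' h' h) k ▷ P.restrHom x V h ≫ cell₁ (trIso x (h''.trans h') h).hom k =
      cell₁ (trIso x h' h).hom (k ≫ tr x h'' (h'.trans h)) ≫
        cell₁ (trIso x h'' (h'.trans h)).hom k :=
  cell_triangle_of _ _ _ _ (by rw [trComp, cancel_whiskerRight]; simp) k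

/-- Composition with the cartesian arrow to `x` is faithful, and after it every comparison of
transition arrows is forced by its compatibility with the arrows to `x`. -/
lemma cell_trComp_assoc (x : P.Ob) {Z Y W V : Opens X} (h₃ : Z ≤ Y) (h₂ : Y ≤ W) (h₁ : W ≤ V)
    (h : V ≤ P.base x) (k : z ⟶ _) :
    cell₁ (trComp x h₃ h₂ (h₁.trans h)) k ▷ tr x h₁ h ≫ cell₁ (trComp x (h₃.trans h₂) h₁ h) k =
      cell₁ (trComp x h₂ h₁ h) (k ≫ tr x h₃ (h₂.trans (h₁.trans h))) ≫
        cell₁ (trComp x h₃ (h₂.trans h₁) h) k :=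
  cell_assoc_of _ _ _ _ _ _ _ _ _ _ (cell_trComp_restrHom x h₃ h₂ (h₁.trans h))
    (cell_trComp_restrHom x h₂ h₁ h) (cell_trComp_restrHom x (h₃.trans h₂) h₁ h)
    (cell_trComp_restrHom x h₃ (h₂.trans h₁) h) (fun _ _ => whiskerRight_injective _) k

lemma cell_resPathTr_resPathIso {V : Opens X} {hx : V ≤ P.base x} {hy : V ≤ P.base y}
    (φ : P.restr x V hx ⟶ P.restr y V hy) {Z W : Opens X} (h' : Z ≤ W) (h : W ≤ V) (k : z ⟶ _) :
    cell₂ (resPathTr φ h' h) k ▷ tr y h hy ≫ cell₂ (resPathIso φ h).hom (k ≫ tr x h' (h.trans hx)) ≫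
        cell₁ (trComp x h' h hx) k ▷ φ =
      cell₁ (trComp y h' h hy) (k ≫ resPath φ (h'.trans h)) ≫
        cell₂ (resPathIso φ (h'.trans h)).hom k :=
  cell_path_of _ _ _ _ _ (by rw [resPathTr, cancel_whiskerRight]) k

/-- The same cancellation argument for paths: each `resPathTr` is determined by the two-arrows
`resPathIso` into the unrestricted path, so successive comparisons compose. -/
lemma cell_resPathTr_comp {V : Opens X} {hx : V ≤ P.base x} {hy : V ≤ P.base y}
    (φ : P.restr x V hx ⟶ P.restr y V hy) {Z Y W : Opens X} (h'' : Z ≤ Y) (h' : Y ≤ W) (h : W ≤ V)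
    (k : z ⟶ _) :
    cell₂ (resPathTr φ h'' (h'.trans h)) k ▷ tr y h' (h.trans hy) ≫
        cell₂ (resPathTr φ h' h) (k ≫ tr x h'' ((h'.trans h).trans hx)) ≫
          cell₁ (trComp x h'' h' (h.trans hx)) k ▷ resPath φ h =
      cell₁ (trComp y h'' h' (h.trans hy)) (k ≫ resPath φ (h''.trans (h'.trans h))) ≫
        cell₂ (resPathTr φ (h''.trans h') h) k :=
  cell_path_trans _ _ _ _ _ _ _ _ _ _ _ _ _ _
    (cell_trComp_assoc x h'' h' h hx) (cell_trComp_assoc y h'' h' h hy)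
    (cell_resPathTr_resPathIso φ h'' (h'.trans h)) (cell_resPathTr_resPathIso φ h' h)
    (cell_resPathTr_resPathIso φ (h''.trans h') h) (fun _ _ => whiskerRight_injective _) k

/-- An arrow `f : x ⟶ y` with `base y ≤ base x` is an equivalence; hence so is precomposition
with `f`. -/
lemma precomp_isEquivalence (f : x ⟶ y) (h : P.base y ≤ P.base x) (c : P.Ob) :
    (precomp c f).IsEquivalence := by
  -- The lift of the identity is an inverse on one side by construction. The isomorphism for the
  -- other side is found by cancelling the cartesian arrow `f`.
  let q := lift f (𝟙 y) h
  let e : q ≫ f ≅ 𝟙 y := liftIso f (𝟙 y) h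
  let e' : f ≫ q ≅ 𝟙 x :=
    have : IsIso (cancel f ((α_ f q f).hom ≫ f ◁ e.hom ≫ (ρ_ f).hom ≫ (λ_ f).inv)) :=
      IsGroupoid.all_isIso _
    asIso (cancel f ((α_ f q f).hom ≫ f ◁ e.hom ≫ (ρ_ f).hom ≫ (λ_ f).inv))
  exact (CategoryTheory.Equivalence.mk (precomp c f) (precomp c q)
    (NatIso.ofComponents (fun k => (λ_ k).symm ≪≫ whiskerRightIso e.symm k ≪≫ α_ q f k)
      (fun {k k'} u => by
        change u ≫ (λ_ k').inv ≫ e.inv ▷ k' ≫ (α_ q f k').hom =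
          ((λ_ k).inv ≫ e.inv ▷ k ≫ (α_ q f k).hom) ≫ q ◁ f ◁ u
        rw [Category.assoc, Category.assoc, ← associator_naturality_right,
          ← whisker_exchange_assoc]
        simp))
    (NatIso.ofComponents (fun k => (α_ f q k).symm ≪≫ whiskerRightIso e' k ≪≫ λ_ k)
      (fun {k k'} u => by
        change f ◁ q ◁ u ≫ (α_ f q k').inv ≫ e'.hom ▷ k' ≫ (λ_ k').hom =
          ((α_ f q k).inv ≫ e'.hom ▷ k ≫ (λ_ k).hom) ≫ u
        simp only [Category.assoc, ← leftUnitor_naturality, ← whisker_exchange_assoc]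
        simp))).isEquivalence_functor

end FibredTwoGroupoid

/-! ### The categories of arrows are torsors -/

section Orbit

open Bicategory MonoidalCategory

variable {C : Type*} [Category C] [MonoidalCategory C] {B : Type*} [Bicategory B] {x z : B}
  (F : C ⥤ (x ⟶ x)ᴹᵒᵖ) [F.Monoidal]

/-- The functor `γ ↦ h ≫ F γ`. -/
def orbit (h : z ⟶ x) : C ⥤ (z ⟶ x) where
  obj γ := h ≫ actObj F γ
  map f := Bicategory.whiskerLeft h (actMap F f)
  map_id γ := by simp [actMap_id]
  map_comp f f' := by simp [actMap_comp]

lemma orbit_isEquivalence [F.IsEquivalence] (h : z ⟶ x) (hh : (precomp x h).IsEquivalence) :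
    (orbit F h).IsEquivalence :=
  have : (unmopFunctor (x ⟶ x)).IsEquivalence :=
    (MonoidalOpposite.mopEquiv (x ⟶ x)).isEquivalence_inverse
  inferInstanceAs (F ⋙ unmopFunctor (x ⟶ x) ⋙ precomp x h).IsEquivalence

lemma faithfulAt_of_orbit [∀ a b : B, IsGroupoid (a ⟶ b)] (h : z ⟶ x)
    (hh : (orbit F h).IsEquivalence) : (arrowAction F z).FaithfulAt h :=
  fun _ _ _ _ e => (orbit F h).map_injective e

end Orbit

namespace EndTriv

open Bicategory FibredTwoGroupoid

variable {X : Type w} [TopologicalSpace X] {𝒢 : GrStack.{v, u} X}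
  {P : FibredTwoGroupoid.{w, w₁, v₁, u₁} X} {x z : P.Ob} (T : EndTriv 𝒢 P x)

/-- The base of `x|_W` is `W ≤ base z`, so `k` is an equivalence. Precomposition with it carries the
self-paths of `x|_W`, and hence `𝒢_W`, onto all arrows `z ⟶ x|_W`. -/
lemma orbit_isEquivalence {W : Opens X} (h : W ≤ P.base x) (hz : W ≤ P.base z)
    (k : z ⟶ P.restr x W h) : (orbit (T.fn W h) k).IsEquivalence :=
  Breen.orbit_isEquivalence _ _ (precomp_isEquivalence k ((P.base_restr _ _ _).trans_le hz) _)

/-- The action of `𝒢_W` on the arrows from `z` to `x|_W`. -/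
noncomputable abbrev action (W : Opens X) (h : W ≤ P.base x) (z : P.Ob) :
    LeftAction (𝒢.fib W) (z ⟶ P.restr x W h) := arrowAction (T.fn W h) z

lemma faithfulAt {W : Opens X} (h : W ≤ P.base x) (hz : W ≤ P.base z) (k : z ⟶ P.restr x W h) :
    (T.action W h z).FaithfulAt k :=
  faithfulAt_of_orbit _ _ (T.orbit_isEquivalence h hz k)

end EndTriv

/-! ### The transition system of a local trivialization -/

namespace TransitionData

open Bicategory FibredTwoGroupoid ObjectFamilies

variable {X : Type w} [TopologicalSpace X] {𝒢 : GrStack.{v, u} X}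
  {P : FibredTwoGroupoid.{w, w₁, v₁, u₁} X} {I : Type t} {L : LocalTriv 𝒢 P I}
  (D : TransitionData L) {J : Type t} (s : J → I)

/-- The transition system attached to an object `z` of `P`: its categories are those of arrows from
`z` to the objects `x_i|_W`. -/
noncomputable def system {W : Opens X} (hW : ∀ a, W ≤ L.U (s a)) (z : P.Ob) :
    TransitionSystem (𝒢.fib W) (fun a => z ⟶ P.restr (L.x (s a)) W (hW a)) where
  A a := (L.T (s a)).action W (hW a) z
  Φ a b := postcomp z (L.path (hW a) (hW b))
  lam a b := D.families.lamAt (hW a) (hW b)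
  lamMonoidal a b := inferInstance
  M a b γ h := cell₂Iso (D.MAt (hW a) (hW b) γ) h
  M_map a b γ δ f h := by
    have e := (D.pathConj (s a) (s b)).M_naturality (le_inf (hW a) (hW b)) f
    change (h ◁ L.map (hW b) f) ▷ L.path (hW a) (hW b) ≫ cell₂ (D.MAt (hW a) (hW b) δ) h =
      cell₂ (D.MAt (hW a) (hW b) γ) h ≫ (h ≫ L.path (hW a) (hW b)) ◁
        L.map (hW a) ((D.families.lamAt (hW a) (hW b)).map f)
    change L.map (hW b) f ▷ L.path (hW a) (hW b) ≫ D.MAt (hW a) (hW b) δ =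
      D.MAt (hW a) (hW b) γ ≫ L.path (hW a) (hW b) ◁
        L.map (hW a) ((D.families.lamAt (hW a) (hW b)).map f) at e
    have e' := congrArg (fun α => h ◁ α) e
    simp only [whiskerLeft_comp] at e'
    simp only [cell₂]
    simp [reassoc_of% e']
  M_nat a b γ h h' u := cell₂_nat _ u
  M_unit a b h := by
    have e := (D.pathConj (s a) (s b)).M_unit (le_inf (hW a) (hW b))
    have e' := (cell_unit_iff ((L.T (s b)).unit (hW b)) _ (D.MAt (hW a) (hW b) _) h).2
      (congrArg (fun α => h ◁ α) e)
    exact e'.trans (cell₀_comp _ _ _)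
  M_mul a b γ δ h := by
    have e := (D.pathConj (s a) (s b)).M_mul (le_inf (hW a) (hW b)) γ δ
    have e' := (cell_mul_iff ((L.T (s b)).mul (hW b) γ δ) _ (D.MAt (hW a) (hW b) γ)
      (D.MAt (hW a) (hW b) δ) (D.MAt (hW a) (hW b) _) h).2 (congrArg (fun α => h ◁ α) e)
    exact e'.trans (congrArg (fun α => cell₂ _ _ ≫ cell₂ _ h ▷ _ ≫ α) (cell₁_comp _ _ _))
  g a b c := D.families.gAt (hW a) (hW b) (hW c)
  n a b c h := cell₂Iso (D.mAt (hW a) (hW b) (hW c)) h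
  n_nat a b c h h' u := cell₂_nat _ u


/-- `mAt` was defined by cancelling the transition arrow of `x_i`; this equation, in whiskered form,
characterizes it as the restriction of `m_ijk`. -/
lemma cell_mAt {i j k : I} {W : Opens X} (h : W ≤ U₃ L.U i j k) {z : P.Ob} (a : z ⟶ _) :
    cell₂ (D.mAt (h.trans U₃_le.1) (h.trans U₃_le.2.1) (h.trans U₃_le.2.2)) a ▷
        tr (L.x i) h U₃_le.1 ≫ cell₂ (L.pathTr h U₃_le.1 U₃_le.2.1) (a ≫ L.path _ _) ≫
          cell₂ (L.pathTr h U₃_le.2.1 U₃_le.2.2) a ▷ L.path _ _ =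
      cell₂ ((L.T i).resCell h U₃_le.1 (D.g i j k)) (a ≫ L.path _ _) ≫
        cell₂ (L.pathTr h U₃_le.1 U₃_le.2.2) a ▷ L.obj U₃_le.1 (D.g i j k) ≫
          cell₂ (D.m i j k) (a ≫ tr (L.x k) h U₃_le.2.2) :=
  cell_triangle_res_of _ _ _ _ _ _ (cancel_whiskerRight _ _) a

lemma cell_pathTr_comp {i j : I} {Z Y W : Opens X} (h'' : Z ≤ Y) (h' : Y ≤ W) (hi : W ≤ L.U i)
    (hj : W ≤ L.U j) {z : P.Ob} (a : z ⟶ _) :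
    cell₂ (L.pathTr h'' (h'.trans hi) (h'.trans hj)) a ▷ tr (L.x i) h' hi ≫
        cell₂ (L.pathTr h' hi hj) (a ≫ tr (L.x j) h'' (h'.trans hj)) ≫
          cell₁ (trComp (L.x j) h'' h' hj) a ▷ L.path hi hj =
      cell₁ (trComp (L.x i) h'' h' hi) (a ≫ L.path (h''.trans (h'.trans hi)) _) ≫
        cell₂ (L.pathTr (h''.trans h') hi hj) a :=
  cell_resPathTr_comp (L.φ i j) h'' h' (le_inf hi hj) a

lemma cell_resCell_comp {i : I} {Z Y W : Opens X} (h'' : Z ≤ Y) (h' : Y ≤ W) (h : W ≤ L.U i)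
    (γ : 𝒢.fib W) {z : P.Ob} (a : z ⟶ _) :
    cell₁ (trComp (L.x i) h'' h' h) (a ≫ L.obj ((h''.trans h').trans h) _) ≫
        (a ◁ L.map _ (𝒢.rc h' h'' γ).hom) ▷ _ ≫ cell₂ ((L.T i).resCell (h''.trans h') h γ) a =
      cell₂ ((L.T i).resCell h'' (h'.trans h) _) a ▷ tr (L.x i) h' h ≫
        cell₂ ((L.T i).resCell h' h γ) (a ≫ tr (L.x i) h'' _) ≫
          cell₁ (trComp (L.x i) h'' h' h) a ▷ L.obj h γ :=
  cell_comp_of _ _ _ _ _ ((L.T i).cell_comp h'' h' h γ) a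

/-- The isomorphism of self-paths attached to an isomorphism. -/
def _root_.Breen.LocalTriv.mapIso (L : LocalTriv 𝒢 P I) {W : Opens X} {i : I} (hi : W ≤ L.U i)
    {γ δ : 𝒢.fib W} (f : γ ≅ δ) : L.obj hi γ ≅ L.obj hi δ where
  hom := L.map hi f.hom
  inv := L.map hi f.inv
  hom_inv_id := by
    refine (actMap_comp ((L.T i).fn W hi) f.hom f.inv).symm.trans ?_
    rw [Iso.hom_inv_id]
    exact actMap_id _ _
  inv_hom_id := by
    refine (actMap_comp ((L.T i).fn W hi) f.inv f.hom).symm.trans ?_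
    rw [Iso.inv_hom_id]
    exact actMap_id _ _

/-- The two-arrow on `W'` is defined directly from `U_ijk`, not through `W`. Transitivity of
restrictions for paths and self-paths shows that it is nevertheless the restriction of the one on
`W`; this is the `n_res` condition of `restriction`. -/
lemma cell_mAt_res {i j k : I} {W W' : Opens X} (h' : W' ≤ W) (h : W ≤ U₃ L.U i j k) {z : P.Ob}
    (a : z ⟶ _) :
    cell₂ (D.mAt ((h'.trans h).trans U₃_le.1) ((h'.trans h).trans U₃_le.2.1)
        ((h'.trans h).trans U₃_le.2.2)) a ▷ tr (L.x i) h' (h.trans U₃_le.1) ≫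
        cell₂ (L.pathTr h' (h.trans U₃_le.1) (h.trans U₃_le.2.1)) (a ≫ L.path _ _) ≫
          cell₂ (L.pathTr h' (h.trans U₃_le.2.1) (h.trans U₃_le.2.2)) a ▷ L.path _ _ =
      ((a ≫ L.path _ _) ◁ (L.mapIso _ (𝒢.rc h h' (D.g i j k))).inv) ▷ tr (L.x i) h' _ ≫
      cell₂ ((L.T i).resCell h' (h.trans U₃_le.1) ((𝒢.res h).obj (D.g i j k)))
          (a ≫ L.path _ _) ≫
        cell₂ (L.pathTr h' (h.trans U₃_le.1) (h.trans U₃_le.2.2)) a ▷ L.obj _ _ ≫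
          cell₂ (D.mAt (h.trans U₃_le.1) (h.trans U₃_le.2.1) (h.trans U₃_le.2.2))
            (a ≫ tr (L.x k) h' (h.trans U₃_le.2.2)) :=
  cell_triangle_trans (trComp (L.x i) h' h U₃_le.1) (trComp (L.x j) h' h U₃_le.2.1)
    (trComp (L.x k) h' h U₃_le.2.2) _ (D.m i j k) _ _ _ _ _ _ _ _ _ _ _ _ _ _
    (cell_resCell_comp h' h U₃_le.1 (D.g i j k)) (cell_pathTr_comp h' h _ _)
    (cell_pathTr_comp h' h _ _) (cell_pathTr_comp h' h _ _) (D.cell_mAt (h'.trans h))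
    (D.cell_mAt h) (fun _ _ => whiskerRight_injective _) a

/-- The restriction of transition systems to a smaller open set. -/
noncomputable def restriction {W W' : Opens X} (h : W' ≤ W) (hW : ∀ a, W ≤ L.U (s a)) (z : P.Ob) :
    Restriction (D.system s hW z) (D.system s (fun a => h.trans (hW a)) z) (𝒢.res h) where
  t a := postcomp z (tr (L.x (s a)) h (hW a))
  ρ a γ k := cell₂Iso ((L.T (s a)).resCell h (hW a) γ) k
  ρ_map a γ δ f k := by
    have e := congrArg (fun α => k ◁ α) ((L.T (s a)).cell_naturality h (hW a) f)
    change (k ◁ actMap _ _) ▷ tr (L.x (s a)) h (hW a) ≫ cell₂ ((L.T (s a)).cell h (hW a) δ) k =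
      cell₂ ((L.T (s a)).cell h (hW a) γ) k ≫ (k ≫ tr (L.x (s a)) h (hW a)) ◁ actMap _ f
    simp only [whiskerLeft_comp] at e
    simp only [cell₂]
    simp [reassoc_of% e]
  ρ_nat a γ k k' u := cell₂_nat _ u
  ρ_mul a γ δ k := by
    have e := (L.T (s a)).cell_mul h (hW a) γ δ
    have e' := (cell_mul_iff _ ((L.T (s a)).mul (hW a) γ δ) ((L.T (s a)).cell h (hW a) γ)
      ((L.T (s a)).cell h (hW a) δ) ((L.T (s a)).cell h (hW a) _) k).2 (congrArg (fun α => k ◁ α) e)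
    refine Eq.trans ?_ e'
    rw [cell₁_comp, comp_whiskerRight, Category.assoc]
    rfl
  pt a b k := cell₂Iso (L.pathTr h (hW a) (hW b)) k
  pt_nat a b k k' u := cell₂_nat _ u
  nt a b γ := (D.families.lam (s a) (s b)).nt h (le_inf (hW a) (hW b)) γ
  M_res a b γ k :=
    (cell_res_iff _ _ _ _ _ _ k).2 (congrArg (fun α => k ◁ α)
      ((D.pathConj (s a) (s b)).M_res h (le_inf (hW a) (hW b)) γ))
  gR a b c := D.families.gRes h (hW a) (hW b) (hW c)
  n_res a b c k := D.cell_mAt_res h (le_inf (le_inf (hW a) (hW b)) (hW c)) k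

end TransitionData

end Breen

/-! ### Filling the cubes: existence and uniqueness -/

namespace Breen

open CategoryTheory TopologicalSpace

section

universe a b

variable {C : Type u} [Category.{v} C] [MonoidalCategory C]

open MonoidalCategory

/-- The action of `C` on `h` is full. -/
def LeftAction.FullAt {H : Type*} [Category H] (A : LeftAction C H) (h : H) : Prop :=
  ∀ ⦃γ δ : C⦄ (u : (A.o γ).obj h ⟶ (A.o δ).obj h), ∃ f : γ ⟶ δ, A.m f h = u

lemma LeftAction.FullAt.exists_two {H : Type*} [Category H] {A : LeftAction C H} {h : H}
    (hA : A.FullAt h) {a b c d : C}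
    (u : (A.o a).obj ((A.o b).obj h) ⟶ (A.o c).obj ((A.o d).obj h)) :
    ∃ f : a ⊗ b ⟶ c ⊗ d, A.two f h = u := by
  obtain ⟨f, hf⟩ := hA ((A.mul a b h).inv ≫ u ≫ (A.mul c d h).hom)
  exact ⟨f, by simp [two, hf]⟩

lemma LeftAction.FaithfulAt.two_injective {H : Type*} [Category H] {A : LeftAction C H} {h : H}
    (hA : A.FaithfulAt h) {a b c d : C} {f f' : a ⊗ b ⟶ c ⊗ d} (e : A.two f h = A.two f' h) :
    f = f' := by
  apply hA
  rw [m_eq_two, e, ← m_eq_two]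

namespace TransitionSystem

variable {I : Type t} {H : I → Type a} [∀ i, Category.{b} (H i)] {S : TransitionSystem C H}
  {i j k l : I}

/-- All faces except the brace are invertible, so the cube prescribes the action of `X` on one
object, and fullness realizes it. -/
lemma exists_braceCube {h : H k} (hA : (S.A i).FullAt ((S.Φ i k).obj h)) (γ : C) :
    ∃ X, S.BraceCube i j k γ X h := by
  obtain ⟨X, hX⟩ := hA.exists_two (((S.A i).o _).map (S.M i k γ h).inv ≫
    (S.n i j k _).hom ≫ (S.Φ i j).map (S.M j k γ h).hom ≫ (S.M i j _ _).hom ≫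
      ((S.A i).o _).map (S.n i j k h).inv)
  refine ⟨X, ?_⟩
  simp [BraceCube, hX, ← Functor.map_comp, ← Functor.map_comp_assoc]

lemma BraceCube.eq {h : H k} (hA : (S.A i).FaithfulAt ((S.Φ i k).obj h)) {γ : C} {X X'}
    (hX : S.BraceCube i j k γ X h) (hX' : S.BraceCube i j k γ X' h) : X = X' := by
  apply hA.two_injective
  have e := hX.trans hX'.symm
  rwa [cancel_epi, cancel_mono] at e

/-- The cube is solved for the action of `Y` in the same way, by inverting the two faces `n_ikl` and
`n_ijk` that follow it. -/
lemma exists_nuCube {h : H l} (hA : (S.A i).FullAt ((S.Φ i l).obj h)) :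
    ∃ Y, S.NuCube i j k l Y h := by
  obtain ⟨Y, hY⟩ := hA.exists_two (((S.A i).o _).map (S.n i j l h).hom ≫ (S.M i j _ _).inv ≫
    (S.Φ i j).map (S.n j k l h).hom ≫ (S.n i j k _).inv ≫ ((S.A i).o _).map (S.n i k l h).inv)
  refine ⟨Y, ?_⟩
  simp [NuCube, hY, ← Functor.map_comp, ← Functor.map_comp_assoc]

lemma NuCube.eq {h : H l} (hA : (S.A i).FaithfulAt ((S.Φ i l).obj h)) {Y Y'}
    (hY : S.NuCube i j k l Y h) (hY' : S.NuCube i j k l Y' h) : Y = Y' := by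
  apply hA.two_injective
  have e := hY.trans hY'.symm
  rwa [cancel_mono] at e

end TransitionSystem

end

namespace TransitionData

open Bicategory FibredTwoGroupoid ObjectFamilies

variable {X : Type w} [TopologicalSpace X] {𝒢 : GrStack.{v, u} X}
  {P : FibredTwoGroupoid.{w, w₁, v₁, u₁} X} {I : Type t} {L : LocalTriv 𝒢 P I}
  (D : TransitionData L) {W : Opens X} {i j k l : I}

/-- The transition system of all the objects `x_i|_W`. -/
noncomputable abbrev sys (W : Opens X) (z : P.Ob) :
    TransitionSystem (𝒢.fib W) (fun a : {a : I // W ≤ L.U a} => z ⟶ P.restr (L.x a.1) W a.2) :=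
  D.system (fun a : {a : I // W ≤ L.U a} => a.1) (fun a => a.2) z

/-- Fullness of the orbit functor of `h`, which is an equivalence because `W ≤ base z`. -/
lemma fullAt {z : P.Ob} (hz : W ≤ P.base z) (a : {a : I // W ≤ L.U a})
    (h : z ⟶ P.restr (L.x a.1) W a.2) : ((D.sys W z).A a).FullAt h := fun γ δ u =>
  have := (L.T a.1).orbit_isEquivalence a.2 hz h
  ⟨(orbit ((L.T a.1).fn W a.2) h).preimage u, (orbit ((L.T a.1).fn W a.2) h).map_preimage u⟩

lemma faithfulAt {z : P.Ob} (hz : W ≤ P.base z) (a : {a : I // W ≤ L.U a})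
    (h : z ⟶ P.restr (L.x a.1) W a.2) : ((D.sys W z).A a).FaithfulAt h :=
  (L.T a.1).faithfulAt a.2 hz h

/-- The cube of a brace, as an equation between two-arrows. -/
def BraceEq (hi : W ≤ L.U i) (hj : W ≤ L.U j) (hk : W ≤ L.U k) (γ : 𝒢.fib W)
    (x : 𝒢.mul (D.families.gAt hi hj hk) ((D.families.lamAt hi hk).obj γ) ⟶
      𝒢.mul ((D.families.lamAt hi hj).obj ((D.families.lamAt hj hk).obj γ))
        (D.families.gAt hi hj hk)) : Prop :=
  D.MAt hi hk γ ▷ L.obj hi (D.families.gAt hi hj hk) ≫ (α_ _ _ _).hom ≫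
        L.path hi hk ◁ (L.mul hi _ _ ≫ L.map hi x ≫ inv (L.mul hi _ _)) ≫
          (α_ _ _ _).inv ≫ D.mAt hi hj hk ▷ _ =
      (α_ _ _ _).hom ≫ L.obj hk γ ◁ D.mAt hi hj hk ≫ (α_ _ _ _).inv ≫
        D.MAt hj hk γ ▷ L.path hi hj ≫ (α_ _ _ _).hom ≫
          L.path hj hk ◁ D.MAt hi hj ((D.families.lamAt hj hk).obj γ) ≫ (α_ _ _ _).inv

/-- The cube of an arrow `ν`, as an equation between two-arrows. -/
def NuEq (hi : W ≤ L.U i) (hj : W ≤ L.U j) (hk : W ≤ L.U k) (hl : W ≤ L.U l)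
    (y : D.families.nuSrc hi hj hk hl ⟶ D.families.nuTgt hi hj hk hl) : Prop :=
  L.path hi hl ◁ (L.mul hi _ _ ≫ L.map hi y ≫ inv (L.mul hi _ _)) ≫
        (α_ _ _ _).inv ≫ D.mAt hi hk hl ▷ L.obj hi (D.families.gAt hi hj hk) ≫ (α_ _ _ _).hom ≫
          L.path hk hl ◁ D.mAt hi hj hk =
      (α_ _ _ _).inv ≫ D.mAt hi hj hl ▷ _ ≫ (α_ _ _ _).hom ≫
        L.path hj hl ◁ inv (D.MAt hi hj (D.families.gAt hj hk hl)) ≫ (α_ _ _ _).inv ≫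
          D.mAt hj hk hl ▷ L.path hi hj ≫ (α_ _ _ _).hom

variable {D} in
-- Whiskering one equation of two-arrows with `h` yields the cube at every object `h` of every
-- category `Hom(z, x_k|_W)`. Cubes solved at an identity arrow thereby become available everywhere.
lemma BraceEq.cube {hi : W ≤ L.U i} {hj : W ≤ L.U j} {hk : W ≤ L.U k} {γ : 𝒢.fib W} {x}
    (e : D.BraceEq hi hj hk γ x) {z : P.Ob} (h : z ⟶ P.restr (L.x k) W hk) :
    (D.sys W z).BraceCube ⟨i, hi⟩ ⟨j, hj⟩ ⟨k, hk⟩ γ x h := by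
  have e' := (cell_brace_iff _ _ _ _ _ h).2 (congrArg (fun α => h ◁ α) e)
  refine Eq.trans ?_ e'
  exact congrArg (fun α => _ ≫ α ≫ _) (arrowAction_two ((L.T i).fn W hi) x _)

variable {D} in
lemma BraceEq.of_cube {hi : W ≤ L.U i} {hj : W ≤ L.U j} {hk : W ≤ L.U k} {γ : 𝒢.fib W} {x}
    (e : (D.sys W _).BraceCube ⟨i, hi⟩ ⟨j, hj⟩ ⟨k, hk⟩ γ x (𝟙 (P.restr (L.x k) W hk))) :
    D.BraceEq hi hj hk γ x := by
  refine whiskerLeft_id_injective ((cell_brace_iff _ _ _ _ _ _).1 (Eq.trans ?_ e))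
  exact congrArg (fun α => _ ≫ α ≫ _) (arrowAction_two ((L.T i).fn W hi) x _).symm

lemma cell₂_inv {B : Type*} [Bicategory B] [∀ a b : B, IsGroupoid (a ⟶ b)] {a b b' c z : B}
    {f : a ⟶ b} {g : b ⟶ c} {f' : a ⟶ b'} {g' : b' ⟶ c} (α : f ≫ g ⟶ f' ≫ g') (h : z ⟶ a) :
    cell₂ (inv α) h = (cell₂Iso α h).inv := by
  rw [← cancel_epi (cell₂Iso α h).hom, Iso.hom_inv_id]
  simp [cell₂, ← whiskerLeft_comp_assoc]

variable {D} in
lemma NuEq.cube {hi : W ≤ L.U i} {hj : W ≤ L.U j} {hk : W ≤ L.U k} {hl : W ≤ L.U l} {y}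
    (e : D.NuEq hi hj hk hl y) {z : P.Ob} (h : z ⟶ P.restr (L.x l) W hl) :
    (D.sys W z).NuCube ⟨i, hi⟩ ⟨j, hj⟩ ⟨k, hk⟩ ⟨l, hl⟩ y h := by
  have e' := (cell_nu_iff _ _ _ _ _ _ h).2 (congrArg (fun α => h ◁ α) e)
  refine Eq.trans ?_ (e'.trans ?_)
  · exact congrArg (fun α => α ≫ _) (arrowAction_two ((L.T i).fn W hi) y _)
  · exact congrArg (fun α => _ ≫ α ≫ _) (cell₂_inv _ _)

variable {D} in
lemma NuEq.of_cube {hi : W ≤ L.U i} {hj : W ≤ L.U j} {hk : W ≤ L.U k} {hl : W ≤ L.U l} {y}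
    (e : (D.sys W _).NuCube ⟨i, hi⟩ ⟨j, hj⟩ ⟨k, hk⟩ ⟨l, hl⟩ y (𝟙 (P.restr (L.x l) W hl))) :
    D.NuEq hi hj hk hl y := by
  refine whiskerLeft_id_injective ((cell_nu_iff _ _ _ _ _ _ _).1 (Eq.trans ?_ (e.trans ?_)))
  · exact congrArg (fun α => α ≫ _) (arrowAction_two ((L.T i).fn W hi) y _).symm
  · exact congrArg (fun α => _ ≫ α ≫ _) (cell₂_inv _ _).symm

/-- The test object is `z = x_k|_W` with its identity arrow. Its base is `W`, so the torsor property
applies, and a cube at the identity already is the full equation. -/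
lemma exists_braceEq (hi : W ≤ L.U i) (hj : W ≤ L.U j) (hk : W ≤ L.U k) (γ : 𝒢.fib W) :
    ∃ x, D.BraceEq hi hj hk γ x :=
  have hz := (P.base_restr (L.x k) W hk).ge
  have ⟨x, hx⟩ := TransitionSystem.exists_braceCube (S := D.sys W _) (i := ⟨i, hi⟩) (j := ⟨j, hj⟩)
    (k := ⟨k, hk⟩) (h := 𝟙 _) (D.fullAt hz _ _) γ
  ⟨x, .of_cube hx⟩

lemma exists_nuEq (hi : W ≤ L.U i) (hj : W ≤ L.U j) (hk : W ≤ L.U k) (hl : W ≤ L.U l) :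
    ∃ y, D.NuEq hi hj hk hl y :=
  have hz := (P.base_restr (L.x l) W hl).ge
  have ⟨y, hy⟩ := TransitionSystem.exists_nuCube (S := D.sys W _) (i := ⟨i, hi⟩) (j := ⟨j, hj⟩)
    (k := ⟨k, hk⟩) (l := ⟨l, hl⟩) (h := 𝟙 _) (D.fullAt hz _ _)
  ⟨y, .of_cube hy⟩

variable {D} in
lemma BraceEq.eq {hi : W ≤ L.U i} {hj : W ≤ L.U j} {hk : W ≤ L.U k} {γ : 𝒢.fib W} {x x'}
    (e : D.BraceEq hi hj hk γ x) (e' : D.BraceEq hi hj hk γ x') : x = x' :=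
  (e.cube (𝟙 _)).eq (D.faithfulAt (P.base_restr (L.x k) W hk).ge _ _) (e'.cube (𝟙 _))

variable {D} in
lemma NuEq.eq {hi : W ≤ L.U i} {hj : W ≤ L.U j} {hk : W ≤ L.U k} {hl : W ≤ L.U l} {y y'}
    (e : D.NuEq hi hj hk hl y) (e' : D.NuEq hi hj hk hl y') : y = y' :=
  (e.cube (𝟙 _)).eq (D.faithfulAt (P.base_restr (L.x l) W hl).ge _ _) (e'.cube (𝟙 _))

end TransitionData

end Breen

/-! ### The arrows `m̃` and `ν`, and the cocycle conditions -/

namespace Breen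

open CategoryTheory TopologicalSpace

namespace TransitionData

open FibredTwoGroupoid ObjectFamilies MonoidalCategory

variable {X : Type w} [TopologicalSpace X] {𝒢 : GrStack.{v, u} X}
  {P : FibredTwoGroupoid.{w, w₁, v₁, u₁} X} {I : Type t} {L : LocalTriv 𝒢 P I}
  (D : TransitionData L) {W W' : Opens X} {i j k l : I}

/-- The filling of the cube is an arbitrary arrow `x`. Since right multiplication by `g_ijk` is
full, `x` comes from an arrow out of the conjugate after composing with `conjIso`. -/
lemma exists_component (hi : W ≤ L.U i) (hj : W ≤ L.U j) (hk : W ≤ L.U k) (γ : 𝒢.fib W) :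
    ∃ f : (conj (D.families.gAt hi hj hk)).obj ((D.families.lamAt hi hk).obj γ) ⟶
        (D.families.lamAt hi hj).obj ((D.families.lamAt hj hk).obj γ),
      D.BraceEq hi hj hk γ ((conjIso _ _).inv ≫ f ▷ _) := by
  obtain ⟨x, hx⟩ := D.exists_braceEq hi hj hk γ
  refine ⟨(tensorRight (D.families.gAt hi hj hk)).preimage ((conjIso _ _).hom ≫ x), ?_⟩
  have e : (tensorRight (D.families.gAt hi hj hk)).preimage ((conjIso _ _).hom ≫ x) ▷ _ = _ :=
    (tensorRight (D.families.gAt hi hj hk)).map_preimage ((conjIso _ _).hom ≫ x)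
  rwa [e, Iso.inv_hom_id_assoc]

/-- The component at `γ` of the arrow `m̃_ijk`. -/
noncomputable def component (hi : W ≤ L.U i) (hj : W ≤ L.U j) (hk : W ≤ L.U k) (γ : 𝒢.fib W) :
    (conj (D.families.gAt hi hj hk)).obj ((D.families.lamAt hi hk).obj γ) ⟶
      (D.families.lamAt hi hj).obj ((D.families.lamAt hj hk).obj γ) :=
  (D.exists_component hi hj hk γ).choose

lemma component_eq (hi : W ≤ L.U i) (hj : W ≤ L.U j) (hk : W ≤ L.U k) (γ : 𝒢.fib W) :
    D.BraceEq hi hj hk γ ((conjIso _ _).inv ≫ D.component hi hj hk γ ▷ _) :=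
  (D.exists_component hi hj hk γ).choose_spec

lemma component_naturality (hi : W ≤ L.U i) (hj : W ≤ L.U j) (hk : W ≤ L.U k) {γ δ : 𝒢.fib W}
    (f : γ ⟶ δ) :
    (conj (D.families.gAt hi hj hk)).map ((D.families.lamAt hi hk).map f) ≫
        D.component hi hj hk δ =
      D.component hi hj hk γ ≫ (D.families.lamAt hi hj).map ((D.families.lamAt hj hk).map f) :=
  TransitionSystem.mt_naturality (S := D.sys W _) (i := ⟨i, hi⟩) (j := ⟨j, hj⟩) (k := ⟨k, hk⟩)
    (h := 𝟙 _) (D.faithfulAt (P.base_restr (L.x k) W hk).ge _ _)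
    (fun γ => (D.component_eq hi hj hk γ).cube _) f

/-- The arrow `m̃_ijk`. -/
noncomputable def mtHom (i j k : I) :
    (SelfEq.j 𝒢 (U₃ L.U i j k)).obj (D.families.g i j k) ⊗
        (D.families.lam i k).restrict (le_inf U₃_le.1 U₃_le.2.2) ⟶
      (D.families.lam i j).restrict (le_inf U₃_le.1 U₃_le.2.1) ⊗
        (D.families.lam j k).restrict (le_inf U₃_le.2.1 U₃_le.2.2) :=
  SelfEq.Hom.mk
    (fun W h =>
      { app := fun γ => D.component (h.trans U₃_le.1) (h.trans U₃_le.2.1) (h.trans U₃_le.2.2) γ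
        naturality := fun γ δ f => D.component_naturality _ _ _ f })
    (fun W h =>
      { unit := TransitionSystem.mt_unit (S := D.sys W _) (i := ⟨i, h.trans U₃_le.1⟩)
          (j := ⟨j, h.trans U₃_le.2.1⟩) (k := ⟨k, h.trans U₃_le.2.2⟩) (h := 𝟙 _)
          (D.faithfulAt (P.base_restr (L.x k) W _).ge _ _)
          (fun γ => (D.component_eq _ _ _ γ).cube _)
        tensor := TransitionSystem.mt_tensor (S := D.sys W _) (i := ⟨i, h.trans U₃_le.1⟩)
          (j := ⟨j, h.trans U₃_le.2.1⟩) (k := ⟨k, h.trans U₃_le.2.2⟩)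
          ⟨𝟙 _, D.faithfulAt (P.base_restr (L.x k) W _).ge _ _⟩
          (fun γ h' => (D.component_eq _ _ _ γ).cube h') })
    (fun {W' W} h' h γ => by
      have hi := h.trans (U₃_le (U := L.U) (i := i) (j := j) (k := k)).1
      have hj := h.trans (U₃_le (U := L.U) (i := i) (j := j) (k := k)).2.1
      have hk := h.trans (U₃_le (U := L.U) (i := i) (j := j) (k := k)).2.2
      have e := Restriction.mt_res (D.restriction (fun a : {a : I // W ≤ L.U a} => a.1) h'
          (fun a => a.2) (P.restr (L.x k) W' (h'.trans hk)))
        (i := ⟨i, hi⟩) (j := ⟨j, hj⟩) (k := ⟨k, hk⟩) (γ := γ) (h := 𝟙 _)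
        -- Faithfulness of the restriction functor holds because the test object has base `W'`, so
        -- the cartesian arrow `x_i|_{W'} ⟶ x_i|_W` can be cancelled.
        (have := P.cartesian (tr (L.x i) h' hi) (P.restr (L.x k) W' (h'.trans hk))
          (base_restr_le _ _ le_rfl)
         inferInstanceAs (Bicategory.postcomp _ _).Faithful)
        ((L.T i).faithfulAt _ (P.base_restr (L.x k) W' _).ge _)
        ((D.component_eq hi hj hk γ).cube _)
        ((D.component_eq (h'.trans hi) (h'.trans hj) (h'.trans hk) _).cube _)
      refine (congrArg (fun f => f ≫ _) (SelfEq.comp_nt (SelfEq.inner (D.families.g i j k))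
        ((D.families.lam i k).restrict (le_inf U₃_le.1 U₃_le.2.2)) h' h γ)).trans ?_
      exact e.trans (congrArg (fun f => D.component _ _ _ _ ≫ f)
        (SelfEq.comp_nt ((D.families.lam i j).restrict (le_inf U₃_le.1 U₃_le.2.1))
          ((D.families.lam j k).restrict (le_inf U₃_le.2.1 U₃_le.2.2)) h' h γ).symm))

/-- The arrow `ν_ijkl`. -/
noncomputable def nuHom (i j k l : I) : D.families.nuSrc (W := U₄ L.U i j k l) (i := i) (j := j)
      (k := k) (l := l) U₄_le.1 U₄_le.2.1 U₄_le.2.2.1 U₄_le.2.2.2 ⟶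
    D.families.nuTgt U₄_le.1 U₄_le.2.1 U₄_le.2.2.1 U₄_le.2.2.2 :=
  (D.exists_nuEq U₄_le.1 U₄_le.2.1 U₄_le.2.2.1 U₄_le.2.2.2).choose

lemma nuHom_eq (i j k l : I) :
    D.NuEq U₄_le.1 U₄_le.2.1 U₄_le.2.2.1 U₄_le.2.2.2 (D.nuHom i j k l) :=
  (D.exists_nuEq U₄_le.1 U₄_le.2.1 U₄_le.2.2.1 U₄_le.2.2.2).choose_spec

/-- `nuHom` is chosen above `U_ijkl` only. Its restrictions satisfy the cubes over smaller open sets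
by `Restriction.nu_res`, since the corrections made in `nuAt` are the ones appearing there. -/
lemma nuEq_nuAt (hi : W ≤ L.U i) (hj : W ≤ L.U j) (hk : W ≤ L.U k) (hl : W ≤ L.U l) :
    D.NuEq hi hj hk hl (nuAt D.nuHom hi hj hk hl) := by
  have h' : W ≤ U₄ L.U i j k l := le_inf (le_inf (le_inf hi hj) hk) hl
  have e := Restriction.nu_res (D.restriction
      (fun a : {a : I // U₄ L.U i j k l ≤ L.U a} => a.1) h' (fun a => a.2) (P.restr (L.x l) W hl))
    (i := ⟨i, U₄_le.1⟩) (j := ⟨j, U₄_le.2.1⟩) (k := ⟨k, U₄_le.2.2.1⟩) (l := ⟨l, U₄_le.2.2.2⟩)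
    (h := 𝟙 _)
    (have := P.cartesian (tr (L.x i) h' U₄_le.1) (P.restr (L.x l) W hl) (base_restr_le _ _ le_rfl)
     inferInstanceAs (Bicategory.postcomp _ _).Faithful)
    ((D.nuHom_eq i j k l).cube _)
  refine .of_cube ?_
  exact (congrArg (fun y => (D.sys W (P.restr (L.x l) W hl)).NuCube ⟨i, hi⟩ ⟨j, hj⟩ ⟨k, hk⟩
    ⟨l, hl⟩ y (𝟙 _)) (Category.assoc _ _ _)).mpr e

theorem induces : D.Induces D.mtHom D.nuHom where
  mt_cube hi hj hk γ := D.component_eq hi hj hk γ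
  nu_cube hi hj hk hl := D.nuEq_nuAt hi hj hk hl

variable {D} in
-- The brace is determined by its cube. An arrow of `𝓔q(𝒢)` is then determined because `conjIso` is
-- invertible and right multiplication by `g_ijk` is faithful.
lemma mtHom_unique {mt : D.families.MtFamily} {nu} (h : D.Induces mt nu) : mt = D.mtHom := by
  funext i j k
  ext W hW γ
  have e := BraceEq.eq (h.mt_cube (hW.trans U₃_le.1) (hW.trans U₃_le.2.1) (hW.trans U₃_le.2.2) γ)
    (D.component_eq (hW.trans U₃_le.1) (hW.trans U₃_le.2.1) (hW.trans U₃_le.2.2) γ)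
  exact whiskerRight_cancel _ ((cancel_epi (conjIso _ _).inv).1 e)

/-- Restriction from `U` to itself is isomorphic to the identity functor but not equal to it. This
is needed because, even for `W = U_ijkl`, the cube involves a restriction of `ν_ijkl`. -/
lemma res_le_rfl_injective {U : Opens X} {x y : 𝒢.fib U} {f g : x ⟶ y}
    (e : (𝒢.res le_rfl).map f = (𝒢.res le_rfl).map g) : f = g := by
  have n := (resId 𝒢.F U).hom.naturality f
  have n' := (resId 𝒢.F U).hom.naturality g
  have e' := n.symm.trans ((congrArg (· ≫ _) e).trans n')
  exact (cancel_epi _).1 e'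

variable {D} in
lemma nuHom_unique {mt : D.families.MtFamily} {nu} (h : D.Induces mt nu) : nu = D.nuHom := by
  funext i j k l
  have e := NuEq.eq (h.nu_cube (W := U₄ L.U i j k l) (i := i) (j := j) (k := k) (l := l)
      U₄_le.1 U₄_le.2.1 U₄_le.2.2.1 U₄_le.2.2.2)
    (D.nuEq_nuAt U₄_le.1 U₄_le.2.1 U₄_le.2.2.1 U₄_le.2.2.2)
  unfold nuAt at e
  rw [cancel_epi, cancel_mono] at e
  exact res_le_rfl_injective e

/-- The abstract equations are applied to the identity of `x_l|_W`, respectively `x_m|_W`, the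
source of all paths involved. There the action of `𝒢_W` on every arrow to `x_i|_W` is faithful. -/
theorem isCocycle : (Quadruple.mk D.families D.mtHom D.nuHom).IsCocycle where
  first {W i j k l} hi hj hk hl γ :=
    TransitionSystem.firstEquation (S := D.sys W (P.restr (L.x l) W hl)) (i := ⟨i, hi⟩)
      (j := ⟨j, hj⟩) (k := ⟨k, hk⟩) (l := ⟨l, hl⟩) (h := 𝟙 _)
      (D.faithfulAt (P.base_restr (L.x l) W hl).ge _ _)
      (fun h => (D.nuEq_nuAt hi hj hk hl).cube h)
      (mtijk := fun γ => D.component hi hj hk γ) (mtikl := fun γ => D.component hi hk hl γ)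
      (mtijl := fun γ => D.component hi hj hl γ) (mtjkl := fun γ => D.component hj hk hl γ)
      ((D.component_eq hi hj hk _).cube _) ((D.component_eq hi hk hl γ).cube _)
      ((D.component_eq hi hj hl γ).cube _) ((D.component_eq hj hk hl γ).cube _)
  second {W i j k l m} hi hj hk hl hm :=
    TransitionSystem.secondEquation (S := D.sys W (P.restr (L.x m) W hm)) (i := ⟨i, hi⟩)
      (j := ⟨j, hj⟩) (k := ⟨k, hk⟩) (l := ⟨l, hl⟩) (p := ⟨m, hm⟩) (h := 𝟙 _)
      (D.faithfulAt (P.base_restr (L.x m) W hm).ge _ _)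
      ((D.nuEq_nuAt hi hj hk hl).cube _) ((D.nuEq_nuAt hi hj hl hm).cube _)
      ((D.nuEq_nuAt hj hk hl hm).cube _) ((D.nuEq_nuAt hi hj hk hm).cube _)
      ((D.nuEq_nuAt hi hk hl hm).cube _)
      (brace D.mtHom hi hj hk (D.families.gAt hk hl hm))
      ((D.component_eq hi hj hk _).cube _)

end TransitionData

end Breen

/-! ### Semilinear functors and monoidality of `λ` -/

namespace Breen

open CategoryTheory TopologicalSpace

section

open MonoidalCategory

variable {C : Type*} [Category C] [MonoidalCategory C] {H₁ H₂ : Type*} [Category H₁] [Category H₂]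

/-- A functor between categories with an action of `C`, semilinear with respect to an endofunctor
of `C`. -/
structure SemilinearMap (A₂ : LeftAction C H₂) (A₁ : LeftAction C H₁) where
  Φ : H₂ ⥤ H₁
  lam : C ⥤ C
  M (γ : C) (h : H₂) : Φ.obj ((A₂.o γ).obj h) ≅ (A₁.o (lam.obj γ)).obj (Φ.obj h)
  M_map {γ δ : C} (f : γ ⟶ δ) (h : H₂) :
    Φ.map (A₂.m f h) ≫ (M δ h).hom = (M γ h).hom ≫ A₁.m (lam.map f) _
  M_nat (γ : C) {h h' : H₂} (u : h ⟶ h') :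
    Φ.map ((A₂.o γ).map u) ≫ (M γ h').hom = (M γ h).hom ≫ (A₁.o _).map (Φ.map u)

namespace SemilinearMap

variable {A₂ : LeftAction C H₂} {A₁ : LeftAction C H₁} (F : SemilinearMap A₂ A₁)

/-- The compatibility of `ε` with the units. -/
def UnitCond (e : 𝟙_ C ⟶ F.lam.obj (𝟙_ C)) : Prop :=
  ∀ h, F.Φ.map (A₂.unit h).hom ≫ (F.M _ h).hom = (A₁.unit _).hom ≫ A₁.m e _

/-- The compatibility of `μ` with the products. -/
def MulCond (m : ∀ γ δ, F.lam.obj γ ⊗ F.lam.obj δ ⟶ F.lam.obj (γ ⊗ δ)) : Prop :=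
  ∀ γ δ h, F.Φ.map (A₂.mul γ δ h).hom ≫ (F.M _ h).hom =
      (F.M γ _).hom ≫ (A₁.o _).map (F.M δ h).hom ≫ (A₁.mul _ _ _).hom ≫ A₁.m (m γ δ) _

/-- A semilinear functor whose target action is faithful at some object is semilinear with respect
to a monoidal functor. -/
@[reducible]
noncomputable def coreMonoidal [IsGroupoid C] {e : 𝟙_ C ⟶ F.lam.obj (𝟙_ C)}
    {m : ∀ γ δ, F.lam.obj γ ⊗ F.lam.obj δ ⟶ F.lam.obj (γ ⊗ δ)} (he : F.UnitCond e)
    (hm : F.MulCond m) {h : H₂} (hf : A₁.FaithfulAt (F.Φ.obj h)) : F.lam.CoreMonoidal where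
  εIso := have : IsIso e := IsGroupoid.all_isIso e
    asIso e
  μIso γ δ := have : IsIso (m γ δ) := IsGroupoid.all_isIso _
    asIso (m γ δ)
  μIso_hom_natural_left {γ γ'} f δ := by
    change F.lam.map f ▷ F.lam.obj δ ≫ m γ' δ = m γ δ ≫ F.lam.map (f ▷ δ)
    apply hf
    -- With this invertible prefix, `MulCond` replaces the constraint `m` by the image under `Φ` of
    -- the coherent `A₂.mul`. The claim becomes naturality of the action on the source; the
    -- remaining axioms use the same device.
    rw [← cancel_epi ((F.M γ _).hom ≫ (A₁.o _).map (F.M δ h).hom ≫ (A₁.mul _ _ _).hom)]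
    simp only [LeftAction.m_comp, LeftAction.m_whiskerRight, Category.assoc, Iso.hom_inv_id_assoc]
    rw [← reassoc_of% hm, ← F.M_map, LeftAction.m_whiskerRight, reassoc_of% LeftAction.m_nat,
      ← reassoc_of% F.M_map, ← hm]
    simp only [Functor.map_comp, Category.assoc, LeftAction.map_mul_hom_inv_assoc]
  μIso_hom_natural_right {δ δ'} γ f := by
    change F.lam.obj γ ◁ F.lam.map f ≫ m γ δ' = m γ δ ≫ F.lam.map (γ ◁ f)
    apply hf
    rw [← cancel_epi ((F.M γ _).hom ≫ (A₁.o _).map (F.M δ h).hom ≫ (A₁.mul _ _ _).hom)]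
    simp only [LeftAction.m_comp, LeftAction.m_whiskerLeft, Category.assoc, Iso.hom_inv_id_assoc]
    have e := congrArg (A₁.o (F.lam.obj γ)).map (F.M_map f h)
    simp only [Functor.map_comp] at e
    rw [← reassoc_of% hm, ← F.M_map, LeftAction.m_whiskerLeft, ← reassoc_of% e,
      ← reassoc_of% F.M_nat, ← hm]
    simp only [Functor.map_comp, Category.assoc, LeftAction.map_mul_hom_inv_assoc]
  associativity γ δ κ := by
    change m γ δ ▷ F.lam.obj κ ≫ m (γ ⊗ δ) κ ≫ F.lam.map (α_ γ δ κ).hom =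
      (α_ _ _ _).hom ≫ F.lam.obj γ ◁ m δ κ ≫ m γ (δ ⊗ κ)
    apply hf
    rw [← cancel_epi ((F.M γ _).hom ≫ (A₁.o _).map (F.M δ _).hom ≫
      (A₁.o _).map ((A₁.o _).map (F.M κ h).hom) ≫ (A₁.mul _ _ _).hom ≫ (A₁.mul _ _ _).hom)]
    -- Both sides are reduced to the associativity of the action on `H₂`, transported by `Φ`.
    trans F.Φ.map (A₂.mul γ δ _).hom ≫ F.Φ.map (A₂.mul _ κ h).hom ≫
      F.Φ.map (A₂.m (α_ γ δ κ).hom h) ≫ (F.M _ h).hom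
    · simp only [LeftAction.m_comp, LeftAction.m_whiskerRight, Category.assoc,
        Iso.hom_inv_id_assoc]
      have e := hm γ δ ((A₂.o κ).obj h)
      have e' := hm (γ ⊗ δ) κ h
      have n := F.M_map (α_ γ δ κ).hom h
      rw [reassoc_of% A₁.mul_nat, reassoc_of% LeftAction.m_nat, ← reassoc_of% e,
        ← reassoc_of% e', n]
    · have e := hm γ (δ ⊗ κ) h
      have e' := congrArg (A₁.o (F.lam.obj γ)).map (hm δ κ h)
      have n := F.M_nat γ (A₂.mul δ κ h).hom
      have a : (A₁.mul _ _ _).hom ≫ (A₁.mul _ _ _).hom ≫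
        A₁.m (α_ (F.lam.obj γ) (F.lam.obj δ) (F.lam.obj κ)).hom (F.Φ.obj h) = _ := A₁.assoc _ _ _ _
      have a' : F.Φ.map (A₂.mul γ δ _).hom ≫ F.Φ.map (A₂.mul _ κ h).hom ≫
          F.Φ.map (A₂.m (α_ γ δ κ).hom h) =
          F.Φ.map ((A₂.o γ).map (A₂.mul δ κ h).hom) ≫ F.Φ.map (A₂.mul γ (δ ⊗ κ) h).hom := by
        simp only [← Functor.map_comp]
        exact congrArg F.Φ.map (A₂.assoc γ δ κ h)
      simp only [Functor.map_comp] at e'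
      simp only [LeftAction.m_comp, LeftAction.m_whiskerLeft, Category.assoc]
      rw [reassoc_of% a, Iso.hom_inv_id_assoc, ← reassoc_of% e', ← reassoc_of% n, ← e]
      rw [reassoc_of% a']
  left_unitality γ := by
    change _ = e ▷ _ ≫ m (𝟙_ C) γ ≫ F.lam.map (λ_ γ).hom
    apply hf
    have n := A₁.unit_nat (F.M γ h).hom
    have n' := LeftAction.m_nat (A := A₁) e (F.M γ h).hom
    have e' := hm (𝟙_ C) γ h
    have a : F.Φ.map (A₂.unit ((A₂.o γ).obj h)).hom ≫ F.Φ.map (A₂.mul (𝟙_ C) γ h).hom ≫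
        F.Φ.map (A₂.m (λ_ γ).hom h) = 𝟙 _ := by
      rw [← Functor.map_comp, ← Functor.map_comp]
      exact (congrArg F.Φ.map (A₂.left_unit γ h)).trans (F.Φ.map_id _)
    rw [← cancel_epi ((F.M γ h).hom ≫ (A₁.unit _).hom ≫ (A₁.mul _ _ _).hom)]
    simp only [LeftAction.m_comp, LeftAction.m_whiskerRight, LeftAction.m_leftUnitor_hom,
      Category.assoc, Iso.hom_inv_id_assoc, Iso.hom_inv_id, Category.comp_id]
    rw [reassoc_of% n, reassoc_of% n', ← reassoc_of% he, ← reassoc_of% e', ← F.M_map,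
      reassoc_of% a]
  right_unitality γ := by
    change _ = _ ◁ e ≫ m γ (𝟙_ C) ≫ F.lam.map (ρ_ γ).hom
    apply hf
    have n := F.M_nat γ (A₂.unit h).hom
    have e' := hm γ (𝟙_ C) h
    have u := congrArg (A₁.o (F.lam.obj γ)).map (he h)
    have a : F.Φ.map ((A₂.o γ).map (A₂.unit h).hom) ≫ F.Φ.map (A₂.mul γ (𝟙_ C) h).hom ≫
        F.Φ.map (A₂.m (ρ_ γ).hom h) = 𝟙 _ := by
      rw [← Functor.map_comp, ← Functor.map_comp]
      exact (congrArg F.Φ.map (A₂.right_unit γ h)).trans (F.Φ.map_id _)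
    rw [← cancel_epi ((F.M γ h).hom ≫ (A₁.o _).map (A₁.unit _).hom ≫ (A₁.mul _ _ _).hom)]
    simp only [Functor.map_comp] at u
    simp only [LeftAction.m_comp, LeftAction.m_whiskerLeft, LeftAction.m_rightUnitor_hom,
      Category.assoc, Iso.hom_inv_id_assoc]
    rw [← reassoc_of% u, ← reassoc_of% n, ← reassoc_of% e', ← F.M_map, reassoc_of% a,
      ← Functor.map_comp, Iso.hom_inv_id, CategoryTheory.Functor.map_id, Category.comp_id]

end SemilinearMap

end

/-! ### Compatibility of semilinear functors with restrictions -/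

section Restriction

open MonoidalCategory Functor.LaxMonoidal

variable {C : Type*} [Category C] [MonoidalCategory C] {C' : Type*} [Category C']
  [MonoidalCategory C']

/-- A functor between categories with actions of `C'` and `C`, compatible with the actions along a
monoidal functor from `C` to `C'`. -/
structure LeftAction.Restr {H H' : Type*} [Category H] [Category H'] (A : LeftAction C H)
    (A' : LeftAction C' H') (R : C ⥤ C') [R.Monoidal] where
  t : H' ⥤ H
  ρ (γ : C) (h : H') : t.obj ((A'.o (R.obj γ)).obj h) ≅ (A.o γ).obj (t.obj h)
  ρ_map {γ δ : C} (f : γ ⟶ δ) (h : H') :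
    t.map (A'.m (R.map f) h) ≫ (ρ δ h).hom = (ρ γ h).hom ≫ A.m f _
  ρ_nat (γ : C) {h h' : H'} (u : h ⟶ h') :
    t.map ((A'.o (R.obj γ)).map u) ≫ (ρ γ h').hom = (ρ γ h).hom ≫ (A.o γ).map (t.map u)
  ρ_mul (γ δ : C) (h : H') :
    t.map (A'.mul _ _ h).hom ≫ t.map (A'.m (μ R γ δ) h) ≫ (ρ _ h).hom =
      (ρ γ _).hom ≫ (A.o γ).map (ρ δ h).hom ≫ (A.mul γ δ _).hom
  ρ_unit (h : H') :
    t.map (A'.unit h).hom ≫ t.map (A'.m (ε R) h) ≫ (ρ _ h).hom = (A.unit _).hom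

variable {H₁ H₂ H₁' H₂' : Type*} [Category H₁] [Category H₂] [Category H₁'] [Category H₂']
  {A₁ : LeftAction C H₁} {A₂ : LeftAction C H₂} {A₁' : LeftAction C' H₁'} {A₂' : LeftAction C' H₂'}
  {R : C ⥤ C'} [R.Monoidal]

/-- A compatibility with restrictions of semilinear functors. -/
structure SemilinearMap.Square (F : SemilinearMap A₂ A₁) (F' : SemilinearMap A₂' A₁')
    (R₂ : A₂.Restr A₂' R) (R₁ : A₁.Restr A₁' R) where
  pt (h : H₂') : R₁.t.obj (F'.Φ.obj h) ≅ F.Φ.obj (R₂.t.obj h)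
  pt_nat {h h' : H₂'} (u : h ⟶ h') :
    R₁.t.map (F'.Φ.map u) ≫ (pt h').hom = (pt h).hom ≫ F.Φ.map (R₂.t.map u)
  nt (γ : C) : F'.lam.obj (R.obj γ) ⟶ R.obj (F.lam.obj γ)
  M_res (γ : C) (h : H₂') :
    R₁.t.map (F'.M _ h).hom ≫ R₁.t.map (A₁'.m (nt γ) _) ≫ (R₁.ρ _ _).hom ≫
        (A₁.o _).map (pt h).hom = (pt _).hom ≫ F.Φ.map (R₂.ρ γ h).hom ≫ (F.M γ _).hom

namespace SemilinearMap.Square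

variable {F : SemilinearMap A₂ A₁} {F' : SemilinearMap A₂' A₁'} {R₂ : A₂.Restr A₂' R}
  {R₁ : A₁.Restr A₁' R} (S : F.Square F' R₂ R₁)

/-- `M_res` expresses the action of `nt` through `M` for `F` and for `F'`, both natural in `γ`. The
two faithfulness hypotheses remove first the restriction functor and then the action. -/
lemma naturality [R₁.t.Faithful] {h : H₂'} (hf : A₁'.FaithfulAt (F'.Φ.obj h)) {γ δ : C} (f : γ ⟶ δ) :
    F'.lam.map (R.map f) ≫ S.nt δ = S.nt γ ≫ R.map (F.lam.map f) := by
  apply hf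
  apply R₁.t.map_injective
  rw [← cancel_epi (R₁.t.map (F'.M _ h).hom), ← cancel_mono ((R₁.ρ _ _).hom ≫
    (A₁.o _).map (S.pt h).hom)]
  trans (S.pt _).hom ≫ F.Φ.map (R₂.ρ γ h).hom ≫ F.Φ.map (A₂.m f _) ≫ (F.M δ _).hom
  · have e := congrArg R₁.t.map (F'.M_map (R.map f) h)
    have e' := congrArg F.Φ.map (R₂.ρ_map f h)
    simp only [Functor.map_comp] at e e'
    simp only [LeftAction.m_comp, Functor.map_comp, Category.assoc]
    rw [← reassoc_of% e, S.M_res, reassoc_of% S.pt_nat, reassoc_of% e']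
  · simp only [LeftAction.m_comp, Functor.map_comp, Category.assoc]
    rw [reassoc_of% R₁.ρ_map, ← LeftAction.m_nat, reassoc_of% S.M_res, F.M_map]

lemma unit [R₁.t.Faithful] {e : 𝟙_ C ⟶ F.lam.obj (𝟙_ C)} {e' : 𝟙_ C' ⟶ F'.lam.obj (𝟙_ C')} (he : F.UnitCond e)
    (he' : F'.UnitCond e') {h : H₂'} (hf : A₁'.FaithfulAt (F'.Φ.obj h)) :
    (e' ≫ F'.lam.map (ε R)) ≫ S.nt (𝟙_ C) = ε R ≫ R.map e := by
  apply hf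
  apply R₁.t.map_injective
  rw [← cancel_epi (R₁.t.map (A₁'.unit _).hom), ← cancel_mono ((R₁.ρ _ _).hom ≫
    (A₁.o _).map (S.pt h).hom)]
  trans (S.pt h).hom ≫ (A₁.unit _).hom ≫ A₁.m e _
  · have a := congrArg R₁.t.map (he' h)
    have b := congrArg R₁.t.map (F'.M_map (ε R) h)
    have c := congrArg F.Φ.map (R₂.ρ_unit h)
    have d := S.pt_nat (A₂'.unit h).hom
    simp only [Functor.map_comp] at a b c
    simp only [LeftAction.m_comp, Functor.map_comp, Category.assoc]
    rw [← reassoc_of% a, ← reassoc_of% b, S.M_res, reassoc_of% S.pt_nat, reassoc_of% d,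
      reassoc_of% c, he]
  · have n := A₁.unit_nat (S.pt h).hom
    simp only [LeftAction.m_comp, Functor.map_comp, Category.assoc]
    rw [reassoc_of% R₁.ρ_map, reassoc_of% R₁.ρ_unit, ← LeftAction.m_nat, reassoc_of% n]

/-- `MulCond` for `F` and for `F'` and multiplicativity of the restrictions `ρ` connect `M_res` at
the product with `M_res` at the factors, taken at `δ • h` and at `h`. -/
lemma tensor [R₁.t.Faithful]
    {m : ∀ γ δ, F.lam.obj γ ⊗ F.lam.obj δ ⟶ F.lam.obj (γ ⊗ δ)}
    {m' : ∀ γ δ, F'.lam.obj γ ⊗ F'.lam.obj δ ⟶ F'.lam.obj (γ ⊗ δ)} (hm : F.MulCond m)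
    (hm' : F'.MulCond m') {h : H₂'} (hf : A₁'.FaithfulAt (F'.Φ.obj h)) (γ δ : C) :
    (m' _ _ ≫ F'.lam.map (μ R γ δ)) ≫ S.nt (γ ⊗ δ) =
      (S.nt γ ⊗ₘ S.nt δ) ≫ μ R _ _ ≫ R.map (m γ δ) := by
  apply hf
  apply R₁.t.map_injective
  rw [← cancel_epi (R₁.t.map (F'.M _ _).hom ≫ R₁.t.map ((A₁'.o _).map (F'.M _ h).hom) ≫
    R₁.t.map (A₁'.mul _ _ _).hom), ← cancel_mono ((R₁.ρ _ _).hom ≫ (A₁.o _).map (S.pt h).hom)]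
  trans (S.pt _).hom ≫ F.Φ.map (R₂.ρ γ _).hom ≫ F.Φ.map ((A₂.o γ).map (R₂.ρ δ h).hom) ≫
    F.Φ.map (A₂.mul γ δ _).hom ≫ (F.M _ _).hom
  · have a := congrArg R₁.t.map (hm' (R.obj γ) (R.obj δ) h)
    have b := congrArg R₁.t.map (F'.M_map (μ R γ δ) h)
    have c := congrArg F.Φ.map (R₂.ρ_mul γ δ h)
    have d := S.pt_nat (A₂'.mul (R.obj γ) (R.obj δ) h).hom
    simp only [Functor.map_comp] at a b c
    simp only [LeftAction.m_comp, Functor.map_comp, Category.assoc]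
    rw [← reassoc_of% a, ← reassoc_of% b, S.M_res, reassoc_of% S.pt_nat, reassoc_of% d,
      reassoc_of% c]
  · have a := R₁.ρ_mul (F.lam.obj γ) (F.lam.obj δ) (F'.Φ.obj h)
    have b := F.M_nat γ (R₂.ρ δ h).hom
    have c := S.M_res γ ((A₂'.o (R.obj δ)).obj h)
    have d := congrArg (A₁.o (F.lam.obj γ)).map (S.M_res δ h)
    simp only [Functor.map_comp] at d
    rw [hm γ δ, reassoc_of% b, ← reassoc_of% c, ← reassoc_of% d]
    simp only [LeftAction.m_comp, Functor.map_comp, Category.assoc,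
      MonoidalCategory.tensorHom_def, LeftAction.m_whiskerRight, LeftAction.m_whiskerLeft,
      LeftAction.map_mul_hom_inv_assoc, LeftAction.map_mul_inv_hom_assoc]
    have n₁ := R₁.t.congr_map (LeftAction.m_nat (A := A₁') (S.nt γ) (F'.M (R.obj δ) h).hom)
    have n₂ := R₁.ρ_nat (F.lam.obj γ) (F'.M (R.obj δ) h).hom
    have n₃ := R₁.ρ_nat (F.lam.obj γ) (A₁'.m (S.nt δ) (F'.Φ.obj h))
    have n₄ := LeftAction.m_nat (A := A₁) (m γ δ) (S.pt h).hom
    have n₅ := A₁.mul_nat (F.lam.obj γ) (F.lam.obj δ) (S.pt h).hom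
    simp only [Functor.map_comp] at n₁
    rw [reassoc_of% R₁.ρ_map, reassoc_of% a, ← n₄, reassoc_of% n₁, reassoc_of% n₃,
      reassoc_of% n₂, reassoc_of% n₅]

variable {C'' : Type*} [Category C''] [MonoidalCategory C''] {H₁'' H₂'' : Type*} [Category H₁'']
  [Category H₂''] {A₁'' : LeftAction C'' H₁''} {A₂'' : LeftAction C'' H₂''}
  {R' : C' ⥤ C''} [R'.Monoidal] {R'' : C ⥤ C''} [R''.Monoidal] {F'' : SemilinearMap A₂'' A₁''}
  {R₂' : A₂'.Restr A₂'' R'} {R₁' : A₁'.Restr A₁'' R'} {R₂'' : A₂.Restr A₂'' R''}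
  {R₁'' : A₁.Restr A₁'' R''}

/-- Cocycle condition for `nt` along two successive restrictions. As `nt` is pinned down by `M_res`,
it follows from the transitivity of the actions (`H₁`, `H₂`) and of the functor itself (`H`). -/
lemma comp (S : F.Square F' R₂ R₁) (S' : F'.Square F'' R₂' R₁') (S'' : F.Square F'' R₂'' R₁'')
    [R₁''.t.Faithful] (rc : ∀ γ, R'.obj (R.obj γ) ⟶ R''.obj γ)
    (T₁ : R₁'.t ⋙ R₁.t ≅ R₁''.t) (T₂ : R₂'.t ⋙ R₂.t ≅ R₂''.t)
    (H₁ : ∀ γ h, T₁.hom.app _ ≫ R₁''.t.map (A₁''.m (rc γ) h) ≫ (R₁''.ρ γ h).hom =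
      R₁.t.map (R₁'.ρ _ h).hom ≫ (R₁.ρ γ _).hom ≫ (A₁.o γ).map (T₁.hom.app h))
    (H₂ : ∀ γ h, T₂.hom.app _ ≫ R₂''.t.map (A₂''.m (rc γ) h) ≫ (R₂''.ρ γ h).hom =
      R₂.t.map (R₂'.ρ _ h).hom ≫ (R₂.ρ γ _).hom ≫ (A₂.o γ).map (T₂.hom.app h))
    (H : ∀ h, R₁.t.map (S'.pt h).hom ≫ (S.pt _).hom ≫ F.Φ.map (T₂.hom.app h) =
      T₁.hom.app _ ≫ (S''.pt h).hom) {h : H₂''} (hf : A₁''.FaithfulAt (F''.Φ.obj h)) (γ : C) :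
    S'.nt (R.obj γ) ≫ R'.map (S.nt γ) ≫ rc _ = F''.lam.map (rc γ) ≫ S''.nt γ := by
  apply hf
  apply R₁''.t.map_injective
  rw [← cancel_epi (T₁.hom.app _ ≫ R₁''.t.map (F''.M _ h).hom), ← cancel_mono ((R₁''.ρ _ _).hom ≫
    (A₁.o _).map (S''.pt h).hom)]
  trans R₁.t.map (S'.pt _).hom ≫ (S.pt _).hom ≫ F.Φ.map (R₂.t.map (R₂'.ρ _ h).hom) ≫
    F.Φ.map (R₂.ρ γ _).hom ≫ F.Φ.map ((A₂.o γ).map (T₂.hom.app h)) ≫ (F.M γ _).hom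
  · have a₁ := T₁.hom.naturality (F''.M (R'.obj (R.obj γ)) h).hom
    have a₂ := T₁.hom.naturality (A₁''.m (S'.nt (R.obj γ)) (F''.Φ.obj h))
    have a₃ := T₁.hom.naturality (A₁''.m (R'.map (S.nt γ)) (F''.Φ.obj h))
    have a₄ := R₁.t.congr_map (R₁'.ρ_map (S.nt γ) (F''.Φ.obj h))
    have a₅ := (A₁.o (F.lam.obj γ)).congr_map (H h)
    have a₆ := R₁.ρ_nat (F.lam.obj γ) (S'.pt h).hom
    have a₇ := R₁.t.congr_map (LeftAction.m_nat (A := A₁') (S.nt γ) (S'.pt h).hom)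
    have a₈ := R₁.t.congr_map (S'.M_res (R.obj γ) h)
    have a₉ := S.M_res γ (R₂'.t.obj h)
    have b₁ := F.M_nat γ (T₂.hom.app h)
    have b₂ := S.pt_nat (R₂'.ρ (R.obj γ) h).hom
    have b₃ := H₁ (F.lam.obj γ) (F''.Φ.obj h)
    simp only [Functor.map_comp, Functor.comp_map] at a₁ a₂ a₃ a₄ a₅ a₆ a₇ a₈
    simp only [Functor.comp_obj] at b₁
    simp only [LeftAction.m_comp, Functor.map_comp, Category.assoc]
    rw [← reassoc_of% a₁, ← reassoc_of% a₂, ← reassoc_of% a₃, reassoc_of% b₃,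
      ← a₅, reassoc_of% a₄, ← reassoc_of% a₆, ← reassoc_of% a₇, reassoc_of% a₈, b₁,
      ← reassoc_of% b₂, ← reassoc_of% a₉]
  · have a := R₁''.t.congr_map (F''.M_map (rc γ) h)
    have b := S''.pt_nat (A₂''.m (rc γ) h)
    have c := F.Φ.congr_map (H₂ γ h)
    have d := H ((A₂''.o (R'.obj (R.obj γ))).obj h)
    simp only [Functor.map_comp] at a c
    simp only [LeftAction.m_comp, Functor.map_comp, Category.assoc]
    rw [← reassoc_of% a, S''.M_res, reassoc_of% b, ← reassoc_of% d, reassoc_of% c]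

end SemilinearMap.Square

end Restriction

end Breen

/-! ### Conjugation of self-arrows by an arrow -/

namespace Breen

open CategoryTheory TopologicalSpace

section Transport

open Bicategory MonoidalCategory

variable {C : Type*} [Category C] [MonoidalCategory C] {B : Type*} [Bicategory B]
  [∀ a b : B, IsGroupoid (a ⟶ b)] {x y : B} (F : C ⥤ (y ⟶ y)ᴹᵒᵖ) [F.Monoidal]
  (G : C ⥤ (x ⟶ x)ᴹᵒᵖ) [G.Monoidal] (f : y ⟶ x)

/-- The functor `γ ↦ F γ ≫ f`. -/
def coorbit : C ⥤ (y ⟶ x) := F ⋙ unmopFunctor (y ⟶ y) ⋙ postcomp y f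

lemma coorbit_isEquivalence [F.IsEquivalence] [(postcomp y f).IsEquivalence] :
    (coorbit F f).IsEquivalence :=
  have : (unmopFunctor (y ⟶ y)).IsEquivalence :=
    (MonoidalOpposite.mopEquiv (y ⟶ y)).isEquivalence_inverse
  inferInstanceAs (F ⋙ unmopFunctor (y ⟶ y) ⋙ postcomp y f).IsEquivalence

variable [hG : ∀ k : y ⟶ x, (orbit G k).IsEquivalence]

/-- The functor `lam` such that `F γ ≫ f ≅ f ≫ G (lam γ)`. -/
noncomputable def transport : C ⥤ C := coorbit F f ⋙ (orbit G f).inv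

/-- The two-arrow `F γ ≫ f ⟶ f ≫ G (lam γ)`. -/
noncomputable def transportM (γ : C) :
    actObj F γ ≫ f ⟶ f ≫ actObj G ((transport F G f).obj γ) :=
  (orbit G f).asEquivalence.counitInv.app ((coorbit F f).obj γ)

lemma transportM_naturality {γ δ : C} (u : γ ⟶ δ) :
    Bicategory.whiskerRight (actMap F u) f ≫ transportM F G f δ =
      transportM F G f γ ≫ Bicategory.whiskerLeft f (actMap G ((transport F G f).map u)) :=
  (orbit G f).asEquivalence.counitInv.naturality ((coorbit F f).map u)

/-- Fullness of the orbit of `k`. It converts any prescribed two-arrow into an arrow of `C`, which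
is how all the structure of `transport` is produced. -/
lemma exists_whiskerLeft_actMap {γ δ : C} (k : y ⟶ x) (α : k ≫ actObj G γ ⟶ k ≫ actObj G δ) :
    ∃ u : γ ⟶ δ, Bicategory.whiskerLeft k (actMap G u) = α :=
  ⟨(orbit G k).preimage α, (orbit G k).map_preimage α⟩

instance isIso_of_locallyGroupoid {a b : B} {h k : a ⟶ b} (α : h ⟶ k) : IsIso α :=
  IsGroupoid.all_isIso α

lemma exists_transportUnit : ∃ e : 𝟙_ C ⟶ (transport F G f).obj (𝟙_ C),
    Bicategory.whiskerRight (actUnit F) f ≫ transportM F G f _ =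
      (Bicategory.leftUnitor _).hom ≫ (Bicategory.rightUnitor _).inv ≫
        Bicategory.whiskerLeft f (actUnit G ≫ actMap G e) := by
  obtain ⟨e, he⟩ := exists_whiskerLeft_actMap G f (inv ((Bicategory.leftUnitor _).hom ≫
    (Bicategory.rightUnitor _).inv ≫ Bicategory.whiskerLeft f (actUnit G)) ≫
      Bicategory.whiskerRight (actUnit F) f ≫ transportM F G f _)
  refine ⟨e, ?_⟩
  rw [Bicategory.whiskerLeft_comp, he]
  simp

/-- Every other two-arrow in the equation is invertible, so it can be solved for the term containing
`m`, and fullness of the orbit of `f` provides `m`. -/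
lemma exists_transportMul (γ δ : C) :
    ∃ m : (transport F G f).obj γ ⊗ (transport F G f).obj δ ⟶ (transport F G f).obj (γ ⊗ δ),
    Bicategory.whiskerRight (actMul F γ δ) f ≫ transportM F G f _ =
      (Bicategory.associator _ _ _).hom ≫ Bicategory.whiskerLeft _ (transportM F G f γ) ≫
        (Bicategory.associator _ _ _).inv ≫ Bicategory.whiskerRight (transportM F G f δ) _ ≫
          (Bicategory.associator _ _ _).hom ≫
            Bicategory.whiskerLeft f (actMul G _ _ ≫ actMap G m) := by
  obtain ⟨m, hm⟩ := exists_whiskerLeft_actMap G f (inv ((Bicategory.associator _ _ _).hom ≫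
    Bicategory.whiskerLeft _ (transportM F G f γ) ≫
        (Bicategory.associator _ _ _).inv ≫ Bicategory.whiskerRight (transportM F G f δ) _ ≫
          (Bicategory.associator _ _ _).hom ≫ Bicategory.whiskerLeft f (actMul G _ _)) ≫
    Bicategory.whiskerRight (actMul F γ δ) f ≫ transportM F G f _)
  refine ⟨m, ?_⟩
  rw [Bicategory.whiskerLeft_comp, hm]
  simp

/-- The unit constraint of `transport`. -/
noncomputable def transportUnit : 𝟙_ C ⟶ (transport F G f).obj (𝟙_ C) :=
  (exists_transportUnit F G f).choose

/-- The tensor constraint of `transport`. -/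
noncomputable def transportMul (γ δ : C) :
    (transport F G f).obj γ ⊗ (transport F G f).obj δ ⟶ (transport F G f).obj (γ ⊗ δ) :=
  (exists_transportMul F G f γ δ).choose

/-- The semilinear functor of composition with `f`. -/
noncomputable def transportMap (z : B) : SemilinearMap (arrowAction F z) (arrowAction G z) where
  Φ := postcomp z f
  lam := transport F G f
  M γ h := cell₂Iso (transportM F G f γ) h
  M_map {γ δ} u h := by
    change Bicategory.whiskerRight (Bicategory.whiskerLeft h (actMap F u)) f ≫
      cell₂ (transportM F G f δ) h = cell₂ (transportM F G f γ) h ≫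
        Bicategory.whiskerLeft (h ≫ f) (actMap G ((transport F G f).map u))
    have e := congrArg (fun α => Bicategory.whiskerLeft h α) (transportM_naturality F G f u)
    simp only [Bicategory.whiskerLeft_comp] at e
    simp only [cell₂]
    simp [reassoc_of% e]
  M_nat γ h h' u := cell₂_nat _ u

/-- The equation defining the unit constraint, whiskered with an arbitrary `h`. Although solved on
`f` alone, it therefore holds on all arrows. -/
lemma transportMap_unitCond (z : B) : (transportMap F G f z).UnitCond (transportUnit F G f) :=
  fun h => ((cell_unit_iff _ _ _ h).2 (congrArg (fun α => Bicategory.whiskerLeft h α)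
    (exists_transportUnit F G f).choose_spec)).trans (cell₀_comp _ _ _)

lemma transportMap_mulCond (z : B) : (transportMap F G f z).MulCond (transportMul F G f) :=
  fun γ δ h => ((cell_mul_iff _ _ _ _ _ h).2 (congrArg (fun α => Bicategory.whiskerLeft h α)
    (exists_transportMul F G f γ δ).choose_spec)).trans
      (congrArg (fun α => cell₂ _ _ ≫ Bicategory.whiskerRight (cell₂ _ h) _ ≫ α) (cell₁_comp _ _ _))

/-- The constraints were chosen without coherence. Coherence follows from faithfulness of the action
at `𝟙 y ≫ f`. -/
noncomputable instance [IsGroupoid C] : (transport F G f).Monoidal :=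
  ((transportMap F G f y).coreMonoidal (transportMap_unitCond F G f y)
    (transportMap_mulCond F G f y) (h := 𝟙 y) (faithfulAt_of_orbit G _ (hG _))).toMonoidal

end Transport

end Breen

/-! ### The self-equivalence attached to a path, and existence of the choices -/

namespace Breen

open CategoryTheory TopologicalSpace

lemma comp_inv_comp_inv_comp {C : Type*} [Category C] {a b c d : C} (f : a ⟶ b) [IsIso f]
    (g : a ⟶ d) (h : c ⟶ d) [IsIso h] : f ≫ (inv f ≫ g ≫ inv h) ≫ h = g := by simp

namespace EndTriv

open Bicategory FibredTwoGroupoid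

variable {X : Type w} [TopologicalSpace X] {𝒢 : GrStack.{v, u} X}
  {P : FibredTwoGroupoid.{w, w₁, v₁, u₁} X} {x y z : P.Ob}

/-- Compatibility with restrictions of the action of `𝒢` on arrows. -/
noncomputable def actionRestr (T : EndTriv 𝒢 P x) {W W' : Opens X} (h : W' ≤ W) (hW : W ≤ P.base x)
    (z : P.Ob) : (T.action W hW z).Restr (T.action W' (h.trans hW) z) (𝒢.res h) where
  t := postcomp z (tr x h hW)
  ρ γ k := cell₂Iso (T.resCell h hW γ) k
  ρ_map {γ δ} f k := by
    have e := congrArg (fun α => k ◁ α) (T.cell_naturality h hW f)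
    change (k ◁ actMap _ _) ▷ tr x h hW ≫ cell₂ (T.cell h hW δ) k =
      cell₂ (T.cell h hW γ) k ≫ (k ≫ tr x h hW) ◁ actMap _ f
    simp only [whiskerLeft_comp] at e
    simp only [cell₂]
    simp [reassoc_of% e]
  ρ_nat γ k k' u := cell₂_nat _ u
  ρ_mul γ δ k := by
    have e' := (cell_mul_iff _ (T.mul hW γ δ) (T.cell h hW γ)
      (T.cell h hW δ) (T.cell h hW _) k).2 (congrArg (fun α => k ◁ α) (T.cell_mul h hW γ δ))
    refine Eq.trans ?_ e'
    rw [cell₁_comp, comp_whiskerRight, Category.assoc]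
    rfl
  ρ_unit k := by
    have e' := (cell_unit_iff _ _ (T.cell h hW _) k).2 (congrArg (fun α => k ◁ α)
      (T.cell_unit h hW))
    refine Eq.trans ?_ e'
    rw [cell₀_comp, comp_whiskerRight, Category.assoc]
    rfl

instance (T : EndTriv 𝒢 P x) {W W' : Opens X} (h : W' ≤ W) (hW : W ≤ P.base x)
    (hy : W' ≤ P.base y) : (T.actionRestr h hW (P.restr y W' hy)).t.IsEquivalence :=
  P.cartesian _ _ (base_restr_le _ _ le_rfl)

variable (Tx : EndTriv 𝒢 P x) (Ty : EndTriv 𝒢 P y) {V : Opens X}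
    {hy : V ≤ P.base y} {hx : V ≤ P.base x} (φ : P.restr y V hy ⟶ P.restr x V hx)

instance orbit_restr_isEquivalence {W : Opens X} (hx : W ≤ P.base x) (hy : W ≤ P.base y)
    (k : P.restr y W hy ⟶ P.restr x W hx) : (orbit (Tx.fn W hx) k).IsEquivalence :=
  Tx.orbit_isEquivalence hx (P.base_restr _ _ _).ge k

/-- The functor `lam` on `𝒢_W` such that `φ γ ≅ lam(γ) φ`. -/
noncomputable abbrev conjBy {W : Opens X} (h : W ≤ V) : 𝒢.fib W ⥤ 𝒢.fib W :=
  transport (Ty.fn W (h.trans hy)) (Tx.fn W (h.trans hx)) (resPath φ h)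

/-- The two-arrow `φ γ ⟹ lam(γ) φ`. -/
noncomputable abbrev conjByM {W : Opens X} (h : W ≤ V) (γ : 𝒢.fib W) :
    Ty.obj (h.trans hy) γ ≫ resPath φ h ⟶
      resPath φ h ≫ Tx.obj (h.trans hx) ((conjBy Tx Ty φ h).obj γ) :=
  transportM (Ty.fn W (h.trans hy)) (Tx.fn W (h.trans hx)) (resPath φ h) γ

/-- `γ ↦ φ γ` is an equivalence because `φ` is cartesian, and `γ ↦ γ φ` because it is an orbit
functor; `conjBy` is the first followed by a quasi-inverse of the second. -/
lemma conjBy_isEquivalence {W : Opens X} (h : W ≤ V) : (conjBy Tx Ty φ h).IsEquivalence :=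
  have : (postcomp (P.restr y W (h.trans hy)) (resPath φ h)).IsEquivalence :=
    P.cartesian _ _ (base_restr_le _ _ le_rfl)
  have := coorbit_isEquivalence (Ty.fn W (h.trans hy)) (resPath φ h)
  inferInstanceAs (_ ⋙ _).IsEquivalence

lemma exists_conjByRes {W' W : Opens X} (h' : W' ≤ W) (h : W ≤ V) (γ : 𝒢.fib W) :
    ∃ n : (conjBy Tx Ty φ (h'.trans h)).obj ((𝒢.res h').obj γ) ⟶
        (𝒢.res h').obj ((conjBy Tx Ty φ h).obj γ),
    conjByM Tx Ty φ (h'.trans h) ((𝒢.res h').obj γ) ▷ tr x h' (h.trans hx) ≫ (α_ _ _ _).hom ≫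
      _ ◁ (Tx.map _ n ▷ _ ≫ Tx.resCell h' (h.trans hx) _) ≫ (α_ _ _ _).inv ≫
        resPathTr φ h' h ▷ _ =
    (α_ _ _ _).hom ≫ _ ◁ resPathTr φ h' h ≫ (α_ _ _ _).inv ≫ Ty.resCell h' (h.trans hy) γ ▷ _ ≫
      (α_ _ _ _).hom ≫ _ ◁ conjByM Tx Ty φ h γ ≫ (α_ _ _ _).inv := by
  have i₁ : IsIso (cell₂ (conjByM Tx Ty φ (h'.trans h) ((𝒢.res h').obj γ)) (𝟙 _) ▷
      tr x h' (h.trans hx)) := IsGroupoid.all_isIso _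
  -- The required square prescribes `n` only after composition with the transition arrow of `x`.
  -- This arrow is cartesian, so `cancel` removes it, and the torsor property then yields `n`.
  obtain ⟨n, hn⟩ := exists_whiskerLeft_actMap (Tx.fn W' ((h'.trans h).trans hx))
    (𝟙 (P.restr y W' ((h'.trans h).trans hy)) ≫ resPath φ (h'.trans h))
    (cancel (tr x h' (h.trans hx))
      (@inv _ _ _ _ _ i₁ ≫
      (cell₂ (resPathTr φ h' h) (𝟙 _ ≫ _) ≫ cell₂ (Ty.resCell h' (h.trans hy) γ) (𝟙 _) ▷ _ ≫
        cell₂ (conjByM Tx Ty φ h γ) (𝟙 _ ≫ _)) ≫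
      inv (cell₂ (Tx.resCell h' (h.trans hx) _) (𝟙 _ ≫ _) ≫
        cell₂ (resPathTr φ h' h) (𝟙 _) ▷ _)))
  refine ⟨n, whiskerLeft_id_injective ((cell_res_iff _ _ _ _ _ _ (𝟙 _)).1 ?_)⟩
  have e := (congrArg (· ▷ tr x h' (h.trans hx)) hn).trans (cancel_whiskerRight _ _)
  refine (congrArg (fun α => _ ≫ α ≫ _) e).trans ?_
  exact @comp_inv_comp_inv_comp _ _ _ _ _ _ _ i₁ _ _ _

/-- Compatibility of `lam` with restrictions. -/
noncomputable def conjByRes {W' W : Opens X} (h' : W' ≤ W) (h : W ≤ V) (γ : 𝒢.fib W) :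
    (conjBy Tx Ty φ (h'.trans h)).obj ((𝒢.res h').obj γ) ⟶
        (𝒢.res h').obj ((conjBy Tx Ty φ h).obj γ) :=
  (exists_conjByRes Tx Ty φ h' h γ).choose

/-- Compatibility with restrictions of the action of `φ` on arrows. -/
noncomputable def conjBySquare {W' W : Opens X} (h' : W' ≤ W) (h : W ≤ V) (z : P.Ob) :
    (transportMap (Ty.fn W (h.trans hy)) (Tx.fn W (h.trans hx)) (resPath φ h) z).Square
      (transportMap (Ty.fn W' ((h'.trans h).trans hy)) (Tx.fn W' ((h'.trans h).trans hx))
        (resPath φ (h'.trans h)) z)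
      (Ty.actionRestr h' (h.trans hy) z) (Tx.actionRestr h' (h.trans hx) z) where
  pt k := cell₂Iso (resPathTr φ h' h) k
  pt_nat u := cell₂_nat _ u
  nt := conjByRes Tx Ty φ h' h
  M_res γ k := (cell_res_iff _ _ _ _ _ _ k).2
    (congrArg (fun α => k ◁ α) (exists_conjByRes Tx Ty φ h' h γ).choose_spec)

lemma faithfulAt_conjBy {W : Opens X} (h : W ≤ V) :
    (Tx.action W (h.trans hx) (P.restr y W (h.trans hy))).FaithfulAt
      ((transportMap (Ty.fn W (h.trans hy)) (Tx.fn W (h.trans hx)) (resPath φ h) _).Φ.obj (𝟙 _)) :=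
  Tx.faithfulAt _ (P.base_restr _ _ _).ge _

/-- Conjugation by a path, as a self-equivalence. -/
noncomputable def conjSelfEq : SelfEq 𝒢 V where
  fn W h := conjBy Tx Ty φ h
  monoidal W h := inferInstance
  isEquivalence W h := conjBy_isEquivalence Tx Ty φ h
  nat {W' W} h' h := NatIso.ofComponents
    (fun γ => @asIso _ _ _ _ (conjByRes Tx Ty φ h' h γ) (IsGroupoid.all_isIso _))
    (fun f => (conjBySquare Tx Ty φ h' h (P.restr y W' ((h'.trans h).trans hy))).naturality
      (faithfulAt_conjBy Tx Ty φ (h'.trans h)) f)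
  nat_isMonoidal {W' W} h' h :=
    { unit := (conjBySquare Tx Ty φ h' h (P.restr y W' ((h'.trans h).trans hy))).unit
        (transportMap_unitCond _ _ _ _) (transportMap_unitCond _ _ _ _)
        (faithfulAt_conjBy Tx Ty φ (h'.trans h))
      tensor := (conjBySquare Tx Ty φ h' h (P.restr y W' ((h'.trans h).trans hy))).tensor
        (transportMap_mulCond _ _ _ _) (transportMap_mulCond _ _ _ _)
        (faithfulAt_conjBy Tx Ty φ (h'.trans h)) }
  nat_comp {W'' W' W} h'' h' h γ := by
    -- The test object lies over the smallest open set `W''`, where the action is faithful and where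
    -- the restriction functors are equivalences.
    let z := P.restr y W'' ((h''.trans (h'.trans h)).trans hy)
    refine SemilinearMap.Square.comp (conjBySquare Tx Ty φ h' h z)
      (conjBySquare Tx Ty φ h'' (h'.trans h) z) (conjBySquare Tx Ty φ (h''.trans h') h z)
      (fun γ => (𝒢.rc h' h'' γ).hom)
      (NatIso.ofComponents (fun k => @asIso _ _ _ _ (cell₁ (trComp x h'' h' (h.trans hx)) k)
        (IsGroupoid.all_isIso _)) (fun u => cell₁_nat _ u))
      (NatIso.ofComponents (fun k => @asIso _ _ _ _ (cell₁ (trComp y h'' h' (h.trans hy)) k)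
        (IsGroupoid.all_isIso _)) (fun u => cell₁_nat _ u))
      (fun γ k => cell_comp_of _ _ _ _ _ (Tx.cell_comp h'' h' (h.trans hx) γ) k)
      (fun γ k => cell_comp_of _ _ _ _ _ (Ty.cell_comp h'' h' (h.trans hy) γ) k)
      (fun k => cell_resPathTr_comp φ h'' h' h k)
      (faithfulAt_conjBy Tx Ty φ (h''.trans (h'.trans h))) γ

/-- Conjugation by a path. -/
noncomputable def pathConj : PathConj Tx Ty φ where
  lam := conjSelfEq Tx Ty φ
  M h γ := conjByM Tx Ty φ h γ
  M_naturality h _ _ f := transportM_naturality _ _ _ f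
  M_unit h := (exists_transportUnit _ _ _).choose_spec
  M_mul h γ δ := (exists_transportMul _ _ _ γ δ).choose_spec
  M_res h' h γ := (exists_conjByRes Tx Ty φ h' h γ).choose_spec

end EndTriv

namespace LocalTriv

open Bicategory FibredTwoGroupoid ObjectFamilies

variable {X : Type w} [TopologicalSpace X] {𝒢 : GrStack.{v, u} X}
  {P : FibredTwoGroupoid.{w, w₁, v₁, u₁} X} {I : Type t} (L : LocalTriv 𝒢 P I)

/-- The choices in the construction of a quadruple exist. -/
lemma nonempty_transitionData : Nonempty (TransitionData L) := by
  have H (i j k : I) : ∃ (g : 𝒢.fib (U₃ L.U i j k)), Nonempty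
      (L.path (W := U₃ L.U i j k) (i := i) (j := k) U₃_le.1 U₃_le.2.2 ≫ L.obj U₃_le.1 g ⟶
    L.path (j := k) (i := j) U₃_le.2.1 U₃_le.2.2 ≫ L.path (i := i) U₃_le.1 U₃_le.2.1) := by
    -- The object `g_ijk` is a preimage of the path `φ_ij φ_jk` under the orbit functor of `φ_ik`,
    -- which is essentially surjective.
    let F := orbit ((L.T i).fn (U₃ L.U i j k) U₃_le.1)
      (L.path (i := i) (j := k) U₃_le.1 U₃_le.2.2)
    exact ⟨F.objPreimage _, ⟨(F.objObjPreimageIso _).hom⟩⟩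
  choose g m using H
  exact ⟨⟨fun i j => (L.T i).pathConj (L.T j) (L.φ i j), g, fun i j k => (m i j k).some⟩⟩

end LocalTriv

end Breen

/-! ### Inverses in `𝓔q(𝒢)` and normalization -/

namespace Breen

open CategoryTheory TopologicalSpace MonoidalCategory

section Inverse

variable {C D : Type*} [Category C] [Category D] [MonoidalCategory C] [MonoidalCategory D]
  (F : C ⥤ D) [F.Monoidal] [F.IsEquivalence]

/-- The inverse of a monoidal equivalence is monoidal. -/
noncomputable instance invMonoidal : F.inv.Monoidal :=
  have : F.asEquivalence.functor.Monoidal := inferInstanceAs F.Monoidal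
  F.asEquivalence.inverseMonoidal

/-- It makes the unit and counit of the equivalence monoidal, and hence also the restriction
isomorphisms `invNat` assembled from them. -/
lemma adjunction_isMonoidal : @Adjunction.IsMonoidal _ _ _ _ _ _ F F.inv F.adjunction _ _ := by
  letI := F.adjunction.rightAdjointLaxMonoidal
  exact (inferInstance : F.adjunction.IsMonoidal)

/-- The counit of an equivalence. -/
noncomputable def invCounit : F.inv ⋙ F ≅ 𝟭 D := F.asEquivalence.counitIso

/-- The unit of an equivalence. -/
noncomputable def invUnit : 𝟭 C ≅ F ⋙ F.inv := F.asEquivalence.unitIso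

instance : NatTrans.IsMonoidal (invCounit F).hom :=
  have := adjunction_isMonoidal F
  inferInstanceAs (NatTrans.IsMonoidal F.adjunction.counit)

instance : NatTrans.IsMonoidal (invUnit F).hom :=
  have := adjunction_isMonoidal F
  inferInstanceAs (NatTrans.IsMonoidal F.adjunction.unit)

/-- A triangle identity of the adjoint equivalence. -/
lemma map_invUnit_inv_app (x : C) :
    F.map ((invUnit F).inv.app x) = (invCounit F).hom.app (F.obj x) := by
  rw [← cancel_epi (F.map ((invUnit F).hom.app x)), ← Functor.map_comp, Iso.hom_inv_id_app,
    CategoryTheory.Functor.map_id]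
  exact (F.asEquivalence.functor_unitIso_comp x).symm

lemma map_inv_map_invCounit_assoc {x y z : D} (f : x ⟶ y) (g : y ⟶ z) :
    F.map (F.inv.map f) ≫ (invCounit F).hom.app y ≫ g = (invCounit F).hom.app x ≫ f ≫ g := by
  have n : F.map (F.inv.map f) ≫ (invCounit F).hom.app y = (invCounit F).hom.app x ≫ f :=
    (invCounit F).hom.naturality f
  rw [← Category.assoc, n, Category.assoc]

end Inverse

namespace SelfEq

variable {X : Type w} [TopologicalSpace X] {𝒢 : GrStack.{v, u} X} {U : Opens X} (F : SelfEq 𝒢 U)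

/-- Compatibility with restrictions of the inverse of a self-equivalence. -/
noncomputable def invNat {W' W : Opens X} (h' : W' ≤ W) (h : W ≤ U) :
    𝒢.res h' ⋙ (F.fn W' (h'.trans h)).inv ≅ (F.fn W h).inv ⋙ 𝒢.res h' :=
  (Functor.leftUnitor _).symm ≪≫ Functor.isoWhiskerRight (invCounit (F.fn W h)).symm _ ≪≫
    Functor.associator _ _ _ ≪≫ Functor.isoWhiskerLeft ((F.fn W h).inv)
      ((Functor.associator _ _ _).symm ≪≫
        Functor.isoWhiskerRight (F.nat h' h).symm ((F.fn W' (h'.trans h)).inv) ≪≫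
        Functor.associator _ _ _ ≪≫ Functor.isoWhiskerLeft (𝒢.res h')
          (invUnit (F.fn W' (h'.trans h))).symm ≪≫ Functor.rightUnitor _)

instance {W' W : Opens X} (h' : W' ≤ W) (h : W ≤ U) : NatTrans.IsMonoidal (F.invNat h' h).hom := by
  change NatTrans.IsMonoidal ((Functor.leftUnitor _).inv ≫
    Functor.whiskerRight (invCounit (F.fn W h)).inv _ ≫ (Functor.associator _ _ _).hom ≫
    Functor.whiskerLeft ((F.fn W h).inv) ((Functor.associator _ _ _).inv ≫
      Functor.whiskerRight (F.nat h' h).inv ((F.fn W' (h'.trans h)).inv) ≫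
      (Functor.associator _ _ _).hom ≫ Functor.whiskerLeft (𝒢.res h')
          (invUnit (F.fn W' (h'.trans h))).inv ≫ (Functor.rightUnitor _).hom))
  infer_instance

/-- Since `F` is faithful, this equation determines `invNat`. It expresses that the counit is
compatible with restrictions, which is the condition needed for `compInverse`. -/
lemma invNat_counit {W' W : Opens X} (h' : W' ≤ W) (h : W ≤ U) (γ : 𝒢.fib W) :
    (F.fn W' (h'.trans h)).map ((F.invNat h' h).hom.app γ) ≫
        (F.nt h' h (((F.fn W h).inv).obj γ)).hom ≫ (𝒢.res h').map ((invCounit (F.fn W h)).hom.app γ) =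
      (invCounit (F.fn W' (h'.trans h))).hom.app ((𝒢.res h').obj γ) := by
  have e : (F.invNat h' h).hom.app γ = (F.fn W' (h'.trans h)).inv.map ((𝒢.res h').map
      ((invCounit (F.fn W h)).inv.app γ)) ≫ (F.fn W' (h'.trans h)).inv.map
        (F.nt h' h ((F.fn W h).inv.obj γ)).inv ≫ (invUnit (F.fn W' (h'.trans h))).inv.app _ := by
    simp [invNat, nt]
  rw [e]
  simp only [Functor.map_comp, Category.assoc, map_invUnit_inv_app]
  rw [map_inv_map_invCounit_assoc, map_inv_map_invCounit_assoc, Iso.inv_hom_id_assoc, ← Functor.map_comp, Iso.inv_hom_id_app,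
    CategoryTheory.Functor.map_id]
  exact Category.comp_id _

/-- The inverse of a self-equivalence. -/
noncomputable def inverse : SelfEq 𝒢 U where
  fn W h := (F.fn W h).inv
  monoidal W h := inferInstance
  isEquivalence W h := inferInstance
  nat h' h := F.invNat h' h
  nat_isMonoidal h' h := inferInstance
  nat_comp {W'' W' W} h'' h' h γ := by
    -- Coherence of the inverse is checked after applying `F` and composing with the counit. There
    -- `invNat_counit` reduces it to the coherence of `F` and naturality of the counit and of the
    -- transitivity isomorphism.
    apply (F.fn W'' ((h''.trans h').trans h)).map_injective
    rw [← cancel_mono ((F.nt (h''.trans h') h (((F.fn W h).inv).obj γ)).hom ≫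
      (𝒢.res (h''.trans h')).map ((invCounit (F.fn W h)).hom.app γ))]
    have a₁ := F.nt_comp h'' h' h (((F.fn W h).inv).obj γ)
    have a₂ := (𝒢.resComp h' h'').hom.naturality ((invCounit (F.fn W h)).hom.app γ)
    have a₃ := (𝒢.res h'').congr_map (F.invNat_counit h' h γ)
    have a₄ := F.nt_naturality h'' (h'.trans h) ((F.invNat h' h).hom.app γ)
    have a₅ := F.invNat_counit h'' (h'.trans h) ((𝒢.res h').obj γ)
    have a₆ := F.invNat_counit (h''.trans h') h γ
    have a₇ := (invCounit (F.fn W'' ((h''.trans h').trans h))).hom.naturality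
      ((𝒢.resComp h' h'').hom.app γ)
    simp only [Functor.map_comp] at a₃
    simp only [Functor.comp_map, Functor.id_map] at a₂ a₇
    simp only [Functor.map_comp, Category.assoc]
    have b₁ := reassoc_of% a₁
    have b₃ := reassoc_of% a₃
    have b₄ := reassoc_of% a₄
    have b₅ := reassoc_of% a₅
    rw [a₆]
    refine Eq.trans ?_ a₇.symm
    refine (congrArg (fun α => _ ≫ _ ≫ α) (b₁ _).symm).trans ?_
    refine (congrArg (fun α => _ ≫ _ ≫ _ ≫ _ ≫ α) a₂.symm).trans ?_
    refine (congrArg (fun α => _ ≫ α) (b₄ _)).trans ?_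
    refine (congrArg (fun α => _ ≫ _ ≫ α) (b₃ _)).trans ?_
    exact (reassoc_of% a₅) _

/-- The composite of a self-equivalence and its inverse is the identity. -/
noncomputable def compInverse : comp F F.inverse ≅ one 𝒢 U :=
  isoMk (fun W h => invCounit (F.fn W h)) (fun W h => inferInstanceAs
    (NatTrans.IsMonoidal (invCounit (F.fn W h)).hom)) (fun {W' W} h' h γ => by
    rw [comp_nt, one_nt]
    exact (Category.assoc _ _ _).trans
      ((F.invNat_counit h' h γ).trans (Category.comp_id _).symm))

end SelfEq

lemma exists_isNormalization {C : Type*} [Category C] [MonoidalCategory C] {Y Z Y' : C}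
    (e : Y ⊗ Y' ≅ 𝟙_ C) (a : Y ⟶ Z) : ∃ b, IsNormalization a b := ⟨_, Y', e, rfl⟩

/-- Only a right inverse of the source of each arrow is required: the inverse self-equivalence for
`m̃_ijk`, and the chosen tensor inverse for `ν_ijkl`. -/
lemma Quadruple.exists_isNormalizationOf {X : Type w} [TopologicalSpace X] {𝒢 : GrStack.{v, u} X}
    {I : Type t} {U : I → Opens X} (Q : Quadruple 𝒢 U) :
    ∃ N : SquareQuadruple 𝒢 U, N.IsNormalizationOf Q := by
  choose mt hmt using fun i j k => exists_isNormalization (SelfEq.compInverse _) (Q.mt i j k)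
  choose nu hnu using fun i j k l => exists_isNormalization (tinvIso' _) (Q.nu i j k l)
  exact ⟨⟨Q.obj, mt, nu⟩, rfl, hmt, hnu⟩

end Breen

theorem proposition6p7 {X : Type w} [TopologicalSpace X] (𝒢 : Breen.GrStack.{v, u} X)
    (P : Breen.FibredTwoGroupoid.{w, w₁, v₁, u₁} X) (hP : P.IsTwoGerbe) {I : Type t}
    (L : Breen.LocalTriv 𝒢 P I) :
    Nonempty (Breen.TransitionData L) ∧
      ∀ D : Breen.TransitionData L,
        ∃ (mt : D.families.MtFamily) (nu : D.families.NuFamily),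
          D.Induces mt nu ∧
          (∀ (mt' : D.families.MtFamily) (nu' : D.families.NuFamily),
            D.Induces mt' nu' → mt' = mt ∧ nu' = nu) ∧
          (Breen.Quadruple.mk D.families mt nu).IsCocycle ∧
          ∃ N : Breen.SquareQuadruple 𝒢 L.U,
            N.IsNormalizationOf (Breen.Quadruple.mk D.families mt nu) ∧ N.IsCocycle := by
  refine ⟨L.nonempty_transitionData, fun D => ⟨D.mtHom, D.nuHom, D.induces,
    fun mt' nu' h => ⟨D.mtHom_unique h, D.nuHom_unique h⟩, D.isCocycle, ?_⟩⟩
  obtain ⟨N, hN⟩ := Breen.Quadruple.exists_isNormalizationOf (Breen.Quadruple.mk D.families D.mtHom D.nuHom)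
  exact ⟨N, hN, _, D.isCocycle, hN⟩
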